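/- All logarithms are natural. For $p\ge 1$ let $N=2p$. A $k$-face of the $N$-cube is a word in $\{0,1,*\}^N$ with exactly $k$ entries $*$; its boundary consists of the $(k-1)$-faces obtained by replacing one $*$ by $0$ or $1$. The faces of the projective cube are the faces of the $N$-cube with each face identified with its antipode (all entries $0,1$ complemented). **Projective code.** There is one qubit for every $p$-face of the projective $N$-cube; let $n$ be their number, $n=2^{p-1}\binom{2p}{p}$ for large $p$. Every $(p-1)$-face $f$ gives the check $C_f=\prod X_q$ over the $p$-faces $q$ having $f$ in their boundary, and every $(p+1)$-face $g$ gives the check $C_g=\prod Z_q$ over the $p$-faces $q$ in its boundary. Let $m$ be the number of checks. For a Pauli operator $P$ let $|P|$ be the minimal weight of $PQ$ over all Pauli operators $Q$ commuting with all checks. A family of checks has soundness $s$ if every Pauli operator $P$ violates at least a fraction $s|P|/n$ of the checks in the family; $P$ violates a check $C_i$ if it does not commute with it. **Amplification.** Put $s=1/\log^2 n$. An amplification is a family $\mathcal F$ of $m'=\lceil n\log^4 n\rceil$ tuples, each of $\lceil 1/s\rceil$ checks of the projective code, where a tuple counts as violated if one of its checks is, such that $\mathcal F$ has soundness $1/e$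 and every qubit is in the support of at most $\lceil\log^7 n\rceil$ tuples. The amplified projective code $\mathcal C_{pa}$ is the union of the projective code and such a family $\mathcal F$; its Hamiltonian is $$H=\sum_{i}\tfrac12(I-C_i)+\sum_{S\in\mathcal F}\Big(I-\prod_{i\in S}\tfrac12(I+C_i)\Big),$$ with $m+m'$ terms, and $\tilde H=H/\lambda$ with $\lambda=(m+m')/n$. The thermal state at inverse temperature $\beta<\infty$ is $e^{-\beta\tilde H}/Z$, $Z=\mathrm{tr}\,e^{-\beta\tilde H}$; at $\beta=\infty$ every density operator supported on $\ker H$ is called a thermal state. **Theorem.** There are an absolute constant $c>0$ and a $p_0$ such that for all $p\ge p_0$ the projective code has soundness $1/\log^2 n$, an amplification $\mathcal F$ exists, and for every amplification $\mathcal F$ the following holds. Every term of $H$ acts on at most $\lceil\log^3 n\rceil$ qubits, and the terms commute pairwise. For every $\beta$ with $20e\,(\log\log n)^2\le\beta\le\infty$ and every thermal state $\rho$ at inverse temperature $\beta$, every $a\ge n$, every set of $n$ of the $a$ qubits (identified in any way with the qubits of the code) and every quantum circuit $U$ on $a$ qubits, made of layers of unitary gates that act on disjoint sets of at most two qubits: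 if the state of the $n$ chosen qubits after applying $U$ to $|0^{a}\rangle$ is within trace distance $0.1\,n^{-2}$ of $\rho$, where the trace distance of $\rho,\sigma$ is $\frac12\|\rho-\sigma\|_1$, then the depth of $U$ is at least $c\ln n$. -/

import Mathlib

noncomputable section

namespace ThermalTQO

/-! ### Qubits, Pauli operators and states -/

/-- Operators on the qubits labelled by `ι`, in the computational basis `ι → ZMod 2`. -/
abbrev Op (ι : Type) : Type := Matrix (ι → ZMod 2) (ι → ZMod 2) ℂ

/-- A Pauli operator up to phase: on qubit `q` it is `X ^ (P.1 q) * Z ^ (P.2 q)`. -/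
abbrev Pauli (ι : Type) : Type := (ι → ZMod 2) × (ι → ZMod 2)

variable {ι κ : Type} [Fintype ι] [DecidableEq ι] [Fintype κ]

/-- The matrix of a Pauli operator: the tensor product of the `2 × 2` matrices
`X ^ a * Z ^ b`, whose `(x, y)` entry is `(-1) ^ (b * y)` if `x = y + a`, and `0` otherwise. -/
def Pauli.toOp (P : Pauli ι) : Op ι :=
  fun x y => ∏ q, if x q = y q + P.1 q then (-1 : ℂ) ^ (P.2 q * y q).val else 0

/-- The number of qubits on which a Pauli operator is not the identity. -/
def Pauli.weight (P : Pauli ι) : ℕ := {q | P.1 q ≠ 0 ∨ P.2 q ≠ 0}.ncard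

/-- The operator `A` on the qubits of `T`, tensored with the identity on all other qubits. -/
def extendOp (T : Finset ι) (A : Op T) : Op ι :=
  fun x y => if ∀ i, i ∉ T → x i = y i then A (fun i => x i) (fun i => y i) else 0

/-- `M` acts non-trivially only on qubits of `T`. -/
def ActsOn (T : Finset ι) (M : Op ι) : Prop := ∃ A : Op T, M = extendOp T A

/-- The trace norm: the sum of the singular values. -/
def traceNorm (M : Op ι) : ℝ :=
  ∑ x, Real.sqrt ((Matrix.isHermitian_conjTranspose_mul_self M).eigenvalues x)

/-- The trace distance. -/
def traceDist (ρ σ : Op ι) : ℝ := traceNorm (ρ - σ) / 2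

open Classical in
/-- The partial trace of an operator on the qubits `ι` that keeps the qubits in the image of `S`
and traces out all the others. -/
def reducedOp {Q : Type} (S : Q ↪ ι) (M : Op ι) : Op Q :=
  fun x y => ∑ u : ι → ZMod 2, ∑ v : ι → ZMod 2,
    if (∀ q, u (S q) = x q) ∧ (∀ q, v (S q) = y q) ∧ (∀ i, i ∉ Set.range S → u i = v i)
    then M u v else 0

/-! ### Quantum circuits -/

/-- A gate: a unitary on at most two qubits. -/
structure Gate (ι : Type) [Fintype ι] [DecidableEq ι] where
  wires : Finset ι
  card_wires : wires.card ≤ 2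
  op : Op wires
  unitary : op ∈ Matrix.unitaryGroup (wires → ZMod 2) ℂ

/-- A layer: gates on pairwise disjoint sets of qubits. -/
structure Layer (ι : Type) [Fintype ι] [DecidableEq ι] where
  gates : List (Gate ι)
  disjoint : gates.Pairwise fun g h => Disjoint g.wires h.wires

/-- A circuit: a list of layers. Its depth is the length of the list. -/
abbrev Circuit (ι : Type) [Fintype ι] [DecidableEq ι] : Type := List (Layer ι)

/-- The unitary of a layer. -/
def Layer.toOp (l : Layer ι) : Op ι := (l.gates.map fun g => extendOp g.wires g.op).prod

/-- The unitary of a circuit (the last layer of the list acts first). -/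
def Circuit.toOp (U : Circuit ι) : Op ι := (U.map Layer.toOp).prod

/-- The number of layers. -/
def Circuit.depth (U : Circuit ι) : ℕ := List.length U

/-- The projection on the all-zero state. -/
def zeroState : Op ι := Matrix.single 0 0 1

/-- The state `U |0…0⟩⟨0…0| U†`. -/
def Circuit.output (U : Circuit ι) : Op ι :=
  Circuit.toOp U * zeroState * (Circuit.toOp U).conjTranspose

/-! ### Thermal states of a Hamiltonian with terms `h i` -/

/-- The Hamiltonian `H`, the sum of its terms. -/
def hamiltonian (h : κ → Op ι) : Op ι := ∑ i, h i

/-- The Hamiltonian rescaled to unit energy density: `H / λ`, where `λ` is the number of terms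
divided by the number of qubits. -/
def scaledHamiltonian (h : κ → Op ι) : Op ι :=
  ((Fintype.card κ / Fintype.card ι : ℝ)⁻¹ : ℝ) • hamiltonian h

/-- The Gibbs state at the finite inverse temperature `β`. -/
def gibbsState (h : κ → Op ι) (β : ℝ) : Op ι :=
  (NormedSpace.exp (-(β • scaledHamiltonian h))).trace⁻¹ •
    NormedSpace.exp (-(β • scaledHamiltonian h))

open scoped ComplexOrder in
/-- A density operator supported on the kernel of the Hamiltonian
(a thermal state at temperature zero). -/
def IsGroundState (h : κ → Op ι) (ρ : Op ι) : Prop :=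
  ρ.PosSemidef ∧ ρ.trace = 1 ∧ hamiltonian h * ρ = 0

/-- `ρ` is a thermal state at some inverse temperature `β` with `b ≤ β ≤ ∞`. -/
def IsThermalState (h : κ → Op ι) (b : ℝ) (ρ : Op ι) : Prop :=
  (∃ β : ℝ, b ≤ β ∧ ρ = gibbsState h β) ∨ IsGroundState h ρ

/-! ### The projective cube -/

/-- A `k`-face of the `N`-cube: a word over `0, 1, *` with exactly `k` entries `*`
(here `none` is `*`). -/
abbrev Face (N k : ℕ) : Type := {w : Fin N → Option Bool // {i | w i = none}.ncard = k}

/-- Complementing all the entries that are not `*`. -/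
def antipode {N : ℕ} (w : Fin N → Option Bool) : Fin N → Option Bool :=
  fun i => (w i).map not

theorem antipode_antipode {N : ℕ} (w : Fin N → Option Bool) : antipode (antipode w) = w := by
  funext i
  cases h : w i <;> simp [antipode, h]

/-- Two faces are identified if they are equal or antipodal. -/
instance faceSetoid (N k : ℕ) : Setoid (Face N k) where
  r f g := f.1 = g.1 ∨ f.1 = antipode g.1
  iseqv :=
    { refl := fun _ => Or.inl rfl
      symm := by
        rintro f g (h | h)
        · exact Or.inl h.symm
        · exact Or.inr (by rw [h, antipode_antipode])
      trans := by
        rintro f g k (h | h) (h' | h')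
        · exact Or.inl (h.trans h')
        · exact Or.inr (h.trans h')
        · exact Or.inr (by rw [h, h'])
        · exact Or.inl (by rw [h, h', antipode_antipode]) }

/-- A `k`-face of the projective `N`-cube. -/
def ProjFace (N k : ℕ) : Type := Quotient (faceSetoid N k)

instance (N k : ℕ) : Finite (ProjFace N k) := inferInstanceAs (Finite (Quotient (faceSetoid N k)))

instance (N k : ℕ) : Fintype (ProjFace N k) := Fintype.ofFinite _

instance (N k : ℕ) : DecidableEq (ProjFace N k) := Classical.decEq _

/-- `v` arises from `w` by replacing one entry `*` by `0` or `1`. -/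
def IsFacet {N : ℕ} (v w : Fin N → Option Bool) : Prop :=
  ∃ i, w i = none ∧ v i ≠ none ∧ ∀ j, j ≠ i → v j = w j

/-- The face `f` of the projective cube lies in the boundary of the face `g`. -/
def InBoundary {N k l : ℕ} (f : ProjFace N k) (g : ProjFace N l) : Prop :=
  ∃ (v : Face N k) (w : Face N l), Quotient.mk _ v = f ∧ Quotient.mk _ w = g ∧ IsFacet v.1 w.1

/-! ### The projective code with `N = 2 p` -/

/-- The qubits: the `p`-faces of the projective `2p`-cube. -/
abbrev Qubit (p : ℕ) : Type := ProjFace (2 * p) p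

/-- The checks: the `(p-1)`-faces (checks of type `X`) and the `(p+1)`-faces (checks of
type `Z`) of the projective `2p`-cube. -/
abbrev Check (p : ℕ) : Type := ProjFace (2 * p) (p - 1) ⊕ ProjFace (2 * p) (p + 1)

/-- The number of qubits. -/
abbrev numQubits (p : ℕ) : ℕ := Fintype.card (Qubit p)

/-- The qubits in the support of a check: those with the `(p-1)`-face in their boundary, or those
in the boundary of the `(p+1)`-face. -/
def InSupport {p : ℕ} (q : Qubit p) : Check p → Prop
  | .inl f => InBoundary f q
  | .inr g => InBoundary q g

open Classical in
/-- The Pauli operator of a check. -/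
def checkPauli {p : ℕ} : Check p → Pauli (Qubit p)
  | .inl f => (fun q => if InSupport q (.inl f) then 1 else 0, 0)
  | .inr g => (0, fun q => if InSupport q (.inr g) then 1 else 0)

/-- The check as an operator. -/
def checkOp {p : ℕ} (i : Check p) : Op (Qubit p) := (checkPauli i).toOp

/-- The Pauli error `P` violates the check `i`: the two operators do not commute. -/
def Violates {p : ℕ} (P : Pauli (Qubit p)) (i : Check p) : Prop :=
  ¬ Commute (checkOp i) P.toOp

/-- The minimal weight of a Pauli error modulo the Pauli operators that commute with all checks. -/
def reducedWeight {p : ℕ} (P : Pauli (Qubit p)) : ℕ :=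
  sInf {w | ∃ z : Pauli (Qubit p), (∀ i, ¬ Violates z i) ∧ w = (P + z).weight}

/-- A family of checks, given through the relation "the error `P` violates the check `j`", has
soundness `s` with respect to the projective code: every Pauli error `P` violates at least a
fraction `s * |P| / n` of the checks. -/
def HasSoundness {p : ℕ} (viol : Pauli (Qubit p) → κ → Prop) (s : ℝ) : Prop :=
  ∀ P : Pauli (Qubit p), s * (reducedWeight P / numQubits p : ℝ) ≤
    ({j | viol P j}.ncard / Fintype.card κ : ℝ)

/-! ### Amplification -/

/-- The soundness `1 / log² n` of the projective code. -/
def baseSoundness (p : ℕ) : ℝ := 1 / Real.log (numQubits p) ^ 2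

/-- The number `⌈1 / s⌉` of checks of the projective code in every amplified check. -/
def tupleSize (p : ℕ) : ℕ := ⌈1 / baseSoundness p⌉₊

/-- The number `⌈n log⁴ n⌉` of amplified checks. -/
def numAmplified (p : ℕ) : ℕ := ⌈numQubits p * Real.log (numQubits p) ^ 4⌉₊

/-- A family of tuples of checks of the projective code. -/
abbrev TupleFamily (p : ℕ) : Type := Fin (numAmplified p) → Fin (tupleSize p) → Check p

/-- An amplified check is violated if one of the checks in its tuple is. -/
def ViolatesTuple {p : ℕ} (F : TupleFamily p) (P : Pauli (Qubit p))
    (j : Fin (numAmplified p)) : Prop :=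
  ∃ k, Violates P (F j k)

/-- `F` amplifies the projective code: the amplified checks have soundness `1 / e`, and every
qubit is in the support of at most `⌈log⁷ n⌉` of them. -/
structure IsAmplification {p : ℕ} (F : TupleFamily p) : Prop where
  sound : HasSoundness (ViolatesTuple F) (1 / Real.exp 1)
  degree : ∀ q : Qubit p,
    {j | ∃ k, InSupport q (F j k)}.ncard ≤ ⌈Real.log (numQubits p) ^ 7⌉₊

/-- The terms of the Hamiltonian of the union of the projective code and its amplification:
`(I - C_i) / 2` for the checks of the projective code and `I - ∏_{i ∈ S} (I + C_i) / 2` for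
the amplified checks. -/
def amplifiedTerms {p : ℕ} (F : TupleFamily p) :
    Check p ⊕ Fin (numAmplified p) → Op (Qubit p)
  | .inl i => (1 / 2 : ℂ) • (1 - checkOp i)
  | .inr j => 1 - (List.ofFn fun k => (1 / 2 : ℂ) • (1 + checkOp (F j k))).prod

end ThermalTQO

end

open ThermalTQO

noncomputable section

namespace ThermalTQO

open Finset Matrix

set_option linter.unusedSectionVars false

section

/-! ### Chains and cochains of the cube -/

/-! The projective code is a CSS code: the two parts of a Pauli error are antipode-invariant chains
of degree `p` in the `2p`-cube, and its syndrome consists of the boundary of one part and the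
coboundary of the other.

Soundness is isoperimetry. The boundary or coboundary of an invariant chain is also that of an
invariant chain larger by a factor of at most `p + 1`, which is logarithmic in the number `n` of
qubits (`exists_invariant_filling`, `exists_invariant_cofilling`). So an error of reduced weight `r`
violates at least `r / (p + 1)` checks. For amplification, random tuples are drawn: exponential
moment bounds and a union bound over minimal errors and over qubits leave a good family
(`exists_family`).

All terms of the Hamiltonian are functions of the syndrome, hence commute, and a Gibbs state induces
the syndrome law of a random Pauli error with Boltzmann weight (`trace_gibbsState_mul_fc`). By the
soundness of the amplification, the energy of a minimal error is at least linear in its weight. A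
Peierls argument (`sum_boltz_isBad_le`) then shows that large connected clusters, at least half
covered by an isolated part of the minimal error, are unlikely: the required `β`, of order `(log log
n) ^ 2`, beats the entropy of walks in a graph of degree polylogarithmic in `n`.

Without such clusters, decoding to a minimal error is local (`symp_eq_of_agree`). A logical operator
multiplied by the sign of its decoded correction is a unitary `dressed`. On good syndromes it agrees
with a unitary that avoids any prescribed small set of qubits (`exists_dressed_eq`); this combines
locality with the cleaning lemma and with the distance `2 ^ (p - 1)`, a power of `n`
(`exists_logical`).

Now let a shallow circuit `U` prepare a state close to a thermal one. Conjugate a dressed logical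
operator by `U` and apply it to the all-zero state. Whether a given qubit is then `1` is decided by
an observable on a small light cone, which the dressed operator can avoid up to a small error, so
every qubit stays `0` with high probability. Two anticommuting unitaries would thus both nearly fix
the all-zero state, which is impossible (`half_le_of_anticommute`, `half_le_of_local_unitaries`). -/

abbrev Word (M : ℕ) : Type := Fin M → Option Bool

/-- Chains (and cochains) of all degrees of the `M`-cube. -/
abbrev Chain (M : ℕ) : Type := Word M → ZMod 2

def stars {M : ℕ} (f : Word M) : ℕ := {i | f i = none}.ncard

theorem stars_eq_card {M : ℕ} (f : Word M) : stars f = #{i | f i = none} := by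
  rw [stars, Set.ncard_eq_toFinset_card']; congr 1; ext; simp

def bd {M : ℕ} (b : Chain M) : Chain M := fun f =>
  ∑ j, if f j = none then 0 else b (Function.update f j none)

def cobd {M : ℕ} (a : Chain M) : Chain M := fun f =>
  ∑ j, if f j = none then
    a (Function.update f j (some false)) + a (Function.update f j (some true)) else 0

def HasDegree {M : ℕ} (k : ℕ) (b : Chain M) : Prop := ∀ f, b f ≠ 0 → stars f = k

def size {M : ℕ} (b : Chain M) : ℕ := #{f | b f ≠ 0}

/-- The isoperimetric estimates are inductions on the dimension: a chain is cut into its three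
slices in one coordinate direction and reassembled by `glue`. -/
def slice {M : ℕ} (i : Fin (M + 1)) (x : Option Bool) (b : Chain (M + 1)) : Chain M :=
  fun f => b (i.insertNth x f)

def glue {M : ℕ} (i : Fin (M + 1)) (u v w : Chain M) : Chain (M + 1) := fun f =>
  match f i with
  | none => w (i.removeNth f)
  | some false => u (i.removeNth f)
  | some true => v (i.removeNth f)

def flipAll {M : ℕ} (b : Chain M) : Chain M := fun f => b (antipode f)

def IsInvariant {M : ℕ} (b : Chain M) : Prop := ∀ f, b (antipode f) = b f

section Basic

variable {M : ℕ}

@[simp] theorem slice_glue_none (i : Fin (M + 1)) (u v w : Chain M) :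
    slice i none (glue i u v w) = w := by
  funext f; simp [slice, glue]

@[simp] theorem slice_glue_false (i : Fin (M + 1)) (u v w : Chain M) :
    slice i (some false) (glue i u v w) = u := by
  funext f; simp [slice, glue]

@[simp] theorem slice_glue_true (i : Fin (M + 1)) (u v w : Chain M) :
    slice i (some true) (glue i u v w) = v := by
  funext f; simp [slice, glue]

theorem ext_slice (i : Fin (M + 1)) {a b : Chain (M + 1)} (h : ∀ x, slice i x a = slice i x b) :
    a = b := by
  funext f
  have := congrFun (h (f i)) (i.removeNth f)
  simpa [slice] using this

theorem sum_slice {A : Type*} [AddCommMonoid A] (i : Fin (M + 1)) (F : Word (M + 1) → A) :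
    ∑ f, F f = ∑ f : Word M, F (i.insertNth none f) + (∑ f : Word M, F (i.insertNth (some false) f)
      + ∑ f : Word M, F (i.insertNth (some true) f)) := by
  rw [← (Fin.insertNthEquiv (fun _ => Option Bool) i).sum_comp, Fintype.sum_prod_type,
    Fintype.sum_option, Fintype.sum_bool, add_comm (∑ y, _) (∑ y, _)]
  rfl

theorem size_eq_sum (b : Chain M) : size b = ∑ f, if b f ≠ 0 then 1 else 0 := by
  rw [size, card_filter]

theorem size_slice (i : Fin (M + 1)) (b : Chain (M + 1)) :
    size b = size (slice i none b) + (size (slice i (some false) b) +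
      size (slice i (some true) b)) := by
  simp only [size_eq_sum]
  rw [sum_slice i]
  rfl

theorem size_glue (i : Fin (M + 1)) (u v w : Chain M) :
    size (glue i u v w) = size w + (size u + size v) := by
  rw [size_slice i]; simp

theorem size_zero : size (0 : Chain M) = 0 := by simp [size]

theorem size_add_le (a b : Chain M) : size (a + b) ≤ size a + size b := by
  unfold size
  refine le_trans (card_le_card ?_) (card_union_le _ _)
  intro f
  simp only [mem_filter, mem_univ, true_and, mem_union, Pi.add_apply]
  intro h
  by_contra! h'
  exact h (by simp [h'.1, h'.2])

theorem antipode_antipode_word (f : Word M) : antipode (antipode f) = f := antipode_antipode f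

theorem size_flipAll (b : Chain M) : size (flipAll b) = size b := by
  simp only [size_eq_sum, flipAll]
  exact Equiv.sum_comp (Function.Involutive.toPerm antipode antipode_antipode_word)
    (fun f => if b f ≠ 0 then 1 else 0)

theorem flipAll_flipAll (b : Chain M) : flipAll (flipAll b) = b := by
  funext f; simp [flipAll, antipode_antipode]

theorem flipAll_add (a b : Chain M) : flipAll (a + b) = flipAll a + flipAll b := rfl

theorem isInvariant_iff {b : Chain M} : IsInvariant b ↔ flipAll b = b :=
  ⟨fun h => funext h, fun h f => congrFun h f⟩

theorem antipode_update (f : Word M) (j : Fin M) (x : Option Bool) :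
    antipode (Function.update f j x) = Function.update (antipode f) j (x.map not) := by
  funext i
  rcases eq_or_ne i j with rfl | h
  · simp [antipode]
  · simp [antipode, h]

theorem antipode_eq_none {f : Word M} {j : Fin M} : antipode f j = none ↔ f j = none := by
  simp [antipode]

theorem stars_antipode (f : Word M) : stars (antipode f) = stars f := by
  simp only [stars, antipode_eq_none]

theorem antipode_insertNth (i : Fin (M + 1)) (x : Option Bool) (f : Word M) :
    antipode (i.insertNth x f : Word (M + 1)) = i.insertNth (x.map not) (antipode f) := by
  funext j
  refine Fin.succAboveCases i ?_ (fun j => ?_) j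
  · simp [antipode]
  · simp [antipode]

theorem slice_flipAll (i : Fin (M + 1)) (x : Option Bool) (b : Chain (M + 1)) :
    slice i x (flipAll b) = flipAll (slice i (x.map not) b) := by
  funext f
  simp [slice, flipAll, antipode_insertNth]

theorem bd_add (a b : Chain M) : bd (a + b) = bd a + bd b := by
  funext f
  simp only [bd, Pi.add_apply, ← sum_add_distrib]
  refine sum_congr rfl fun j _ => ?_
  split_ifs <;> simp

theorem cobd_add (a b : Chain M) : cobd (a + b) = cobd a + cobd b := by
  funext f
  simp only [cobd, Pi.add_apply, ← sum_add_distrib]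
  refine sum_congr rfl fun j _ => ?_
  split_ifs <;> simp [add_add_add_comm]

theorem bd_zero : bd (0 : Chain M) = 0 := by
  funext f; simp [bd]

theorem cobd_zero : cobd (0 : Chain M) = 0 := by
  funext f; simp [cobd]

theorem bd_flipAll (b : Chain M) : bd (flipAll b) = flipAll (bd b) := by
  funext f
  simp only [bd, flipAll, antipode_eq_none, antipode_update, Option.map_none]

theorem cobd_flipAll (b : Chain M) : cobd (flipAll b) = flipAll (cobd b) := by
  funext f
  simp only [cobd, flipAll, antipode_eq_none, antipode_update, Option.map_some, Bool.not_false,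
    Bool.not_true]
  refine sum_congr rfl fun j _ => ?_
  split_ifs
  · rw [add_comm]
  · rfl

theorem update_insertNth_self (i : Fin (M + 1)) (x y : Option Bool) (f : Word M) :
    Function.update (i.insertNth x f : Word (M + 1)) i y = i.insertNth y f := by
  simp

theorem slice_none_bd (i : Fin (M + 1)) (b : Chain (M + 1)) :
    slice i none (bd b) = bd (slice i none b) := by
  funext f
  simp only [slice, bd]
  rw [Fin.sum_univ_succAbove _ i]
  simp

/-- A face that is free in direction `i` has one facet on each side of the cube; these facets give
the extra term. -/
theorem slice_some_bd (i : Fin (M + 1)) (x : Bool) (b : Chain (M + 1)) :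
    slice i (some x) (bd b) = slice i none b + bd (slice i (some x) b) := by
  funext f
  simp only [slice, bd, Pi.add_apply]
  rw [Fin.sum_univ_succAbove _ i]
  simp

theorem slice_some_cobd (i : Fin (M + 1)) (x : Bool) (b : Chain (M + 1)) :
    slice i (some x) (cobd b) = cobd (slice i (some x) b) := by
  funext f
  simp only [slice, cobd]
  rw [Fin.sum_univ_succAbove _ i]
  simp

theorem slice_none_cobd (i : Fin (M + 1)) (b : Chain (M + 1)) :
    slice i none (cobd b) =
      slice i (some false) b + slice i (some true) b + cobd (slice i none b) := by
  funext f
  simp only [slice, cobd, Pi.add_apply]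
  rw [Fin.sum_univ_succAbove _ i]
  simp

theorem stars_insertNth (i : Fin (M + 1)) (x : Option Bool) (f : Word M) :
    stars (i.insertNth x f : Word (M + 1)) = (if x = none then 1 else 0) + stars f := by
  rw [stars_eq_card, stars_eq_card, card_filter, card_filter, Fin.sum_univ_succAbove _ i]
  simp

theorem HasDegree.slice_some {k : ℕ} {b : Chain (M + 1)} (h : HasDegree k b) (i : Fin (M + 1))
    (x : Bool) : HasDegree k (slice i (some x) b) := by
  intro f hf
  simpa [stars_insertNth] using h _ hf

theorem HasDegree.slice_none {k : ℕ} {b : Chain (M + 1)} (h : HasDegree (k + 1) b)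
    (i : Fin (M + 1)) : HasDegree k (slice i none b) := by
  intro f hf
  have := h _ hf
  rw [stars_insertNth] at this
  simp at this
  omega

theorem HasDegree.slice_none_zero {b : Chain (M + 1)} (h : HasDegree 0 b)
    (i : Fin (M + 1)) : slice i none b = 0 := by
  funext f
  by_contra hf
  have := h _ hf
  rw [stars_insertNth] at this
  simp at this

theorem hasDegree_glue {k : ℕ} {i : Fin (M + 1)} {u v w : Chain M} (hu : HasDegree (k + 1) u)
    (hv : HasDegree (k + 1) v) (hw : HasDegree k w) : HasDegree (k + 1) (glue i u v w) := by
  intro f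
  rw [← Fin.insertNth_self_removeNth i f, stars_insertNth]
  rcases f i with _ | _ | _
  · intro h
    have := hw (i.removeNth f) (by simpa [glue] using h)
    simp; omega
  · intro h
    have := hu (i.removeNth f) (by simpa [glue] using h)
    simp; omega
  · intro h
    have := hv (i.removeNth f) (by simpa [glue] using h)
    simp; omega

theorem hasDegree_glue_zero {i : Fin (M + 1)} {u v : Chain M} (hu : HasDegree 0 u)
    (hv : HasDegree 0 v) : HasDegree 0 (glue i u v 0) := by
  intro f
  rw [← Fin.insertNth_self_removeNth i f, stars_insertNth]
  rcases f i with _ | _ | _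
  · intro h
    simp [glue] at h
  · intro h
    have := hu (i.removeNth f) (by simpa [glue] using h)
    simp; omega
  · intro h
    have := hv (i.removeNth f) (by simpa [glue] using h)
    simp; omega

theorem HasDegree.add {k : ℕ} {a b : Chain M} (ha : HasDegree k a) (hb : HasDegree k b) :
    HasDegree k (a + b) := by
  intro f hf
  by_cases h : a f = 0
  · exact hb f (by simpa [h] using hf)
  · exact ha f h

theorem hasDegree_zero (k : ℕ) : HasDegree k (0 : Chain M) := by
  intro f hf; simp at hf

theorem HasDegree.flipAll {k : ℕ} {a : Chain M} (ha : HasDegree k a) :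
    HasDegree k (flipAll a) := by
  intro f hf
  rw [← stars_antipode]
  exact ha _ hf

theorem stars_update_none {f : Word M} {j : Fin M} (h : f j ≠ none) :
    stars (Function.update f j none) = stars f + 1 := by
  rw [stars_eq_card, stars_eq_card, ← card_insert_of_notMem (a := j) (by simpa using h)]
  congr 1; ext i
  rcases eq_or_ne i j with rfl | h' <;> simp_all

theorem stars_update_some {f : Word M} {j : Fin M} (h : f j = none) (x : Bool) :
    stars (Function.update f j (some x)) + 1 = stars f := by
  have := stars_update_none (f := Function.update f j (some x)) (j := j) (by simp)
  rw [← this]; simp [← h]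

theorem HasDegree.bd {k : ℕ} {a : Chain M} (ha : HasDegree (k + 1) a) : HasDegree k (bd a) := by
  intro f hf
  obtain ⟨j, -, hj⟩ := exists_ne_zero_of_sum_ne_zero hf
  split_ifs at hj with h
  · simp at hj
  · have := ha _ hj
    rw [stars_update_none h] at this
    omega

theorem HasDegree.cobd {k : ℕ} {a : Chain M} (ha : HasDegree k a) :
    HasDegree (k + 1) (cobd a) := by
  intro f hf
  obtain ⟨j, -, hj⟩ := exists_ne_zero_of_sum_ne_zero hf
  split_ifs at hj with h
  · have : HasDegree k a := ha
    by_cases h0 : a (Function.update f j (some false)) = 0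
    · rw [h0, zero_add] at hj
      rw [← stars_update_some h true, ha _ hj]
    · rw [← stars_update_some h false, ha _ h0]
  · simp at hj

theorem chain_add_self (a : Chain M) : a + a = 0 := by
  funext f; exact CharTwo.add_self_eq_zero _

theorem chain_add_eq_zero {a b : Chain M} : a + b = 0 ↔ a = b := by
  constructor
  · intro h
    funext f
    exact CharTwo.add_eq_zero.1 (congrFun h f)
  · rintro rfl; exact chain_add_self a

theorem hasDegree_eq_zero {k : ℕ} {b : Chain M} (h : HasDegree k b) (hk : M < k) : b = 0 := by
  funext f
  by_contra hf
  have h1 := h f hf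
  have : stars f ≤ M := by
    rw [stars_eq_card]; exact (card_filter_le _ _).trans (by simp)
  omega

theorem bd_bd (b : Chain M) : bd (bd b) = 0 := by
  induction M with
  | zero => funext f; simp [bd]
  | succ M ih =>
    refine ext_slice 0 ?_
    rintro (_ | x)
    · rw [slice_none_bd, slice_none_bd, ih]; rfl
    · rw [slice_some_bd, slice_some_bd, slice_none_bd, bd_add, ih, add_zero, chain_add_self]; rfl

theorem cobd_cobd (b : Chain M) : cobd (cobd b) = 0 := by
  induction M with
  | zero => funext f; simp [cobd]
  | succ M ih =>
    refine ext_slice 0 ?_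
    rintro (_ | x)
    · rw [slice_none_cobd, slice_none_cobd, slice_some_cobd, slice_some_cobd, cobd_add, cobd_add,
        ih, add_zero, chain_add_self]; rfl
    · rw [slice_some_cobd, slice_some_cobd, ih]; rfl

/-- Double counting of pairs of a face and one of its `k` free directions. Averaging then yields
directions with many or with few faces. -/
theorem sum_size_slice_none {k : ℕ} {b : Chain (M + 1)} (h : HasDegree k b) :
    ∑ i, size (slice i none b) = k * size b := by
  have h1 : ∀ i, size (slice i none b) = ∑ f, if b f ≠ 0 ∧ f i = none then 1 else 0 := by
    intro i
    rw [sum_slice i, size_eq_sum]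
    simp only [slice, Fin.insertNth_apply_same, and_true, reduceCtorEq, and_false, if_false,
      sum_const_zero, add_zero]
    exact sum_congr rfl fun f _ => by congr
  simp only [h1]
  rw [sum_comm]
  have h2 : ∀ f : Word (M + 1), (∑ i, if b f ≠ 0 ∧ f i = none then 1 else 0) =
      if b f ≠ 0 then k else 0 := by
    intro f
    split_ifs with hf
    · rw [← h f hf, stars_eq_card, card_filter]; simp [hf]
    · simp [hf]
  simp only [h2]
  rw [size, ← sum_filter, sum_const, smul_eq_mul, mul_comm]

theorem exists_slice_none_ge {k : ℕ} {b : Chain (M + 1)} (h : HasDegree k b) :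
    ∃ i, k * size b ≤ (M + 1) * size (slice i none b) := by
  by_contra! hc
  have := sum_lt_sum_of_nonempty (s := univ) univ_nonempty (fun i _ => hc i)
  simp only [← mul_sum, sum_size_slice_none h, sum_const, card_univ, Fintype.card_fin,
    smul_eq_mul] at this
  nlinarith

theorem exists_slice_none_le {k : ℕ} {b : Chain (M + 1)} (h : HasDegree k b) :
    ∃ i, (M + 1) * size (slice i none b) ≤ k * size b := by
  by_contra! hc
  have := sum_lt_sum_of_nonempty (s := univ) univ_nonempty (fun i _ => hc i)
  simp only [← mul_sum, sum_size_slice_none h, sum_const, card_univ, Fintype.card_fin,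
    smul_eq_mul] at this
  nlinarith

end Basic

end

/-! ### Isoperimetry: fillings and cofillings in the cube and in the projective cube -/

/-- The smaller of the two sides of `b` in direction `i` is swept across the cube; the cycle `b0 +
b1` that arises on the other side is filled by induction. Taking `i` with at least the average
number of faces of `b` bounds `|b0| + |b1|` by `(1 - k / (M + 1)) |b|`, just enough to reproduce the
constant `(M - k) / (2 (k + 1))`. For `k = 0` a cycle bounds only if its coefficients sum to zero.
-/
theorem exists_filling {M : ℕ} (k : ℕ) (b : Chain M) (hd : HasDegree k b) (hb : bd b = 0)
    (h0 : k = 0 → ∑ f, b f = 0) :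
    ∃ c : Chain M, HasDegree (k + 1) c ∧ bd c = b ∧
      2 * (k + 1) * size c + k * size b ≤ M * size b := by
  induction M with
  | zero =>
    have hb0 : b = 0 := by
      rcases Nat.eq_zero_or_pos k with rfl | hk
      · funext f
        have h := h0 rfl
        rw [Fintype.sum_unique] at h
        exact (congrArg b (Subsingleton.elim f _)).trans h
      · exact hasDegree_eq_zero hd hk
    subst hb0
    exact ⟨0, hasDegree_zero _, bd_zero, by simp [size_zero]⟩
  | succ M ih =>
    obtain ⟨i, hi⟩ := exists_slice_none_ge hd
    set b0 := slice i (some false) b with hb0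
    set b1 := slice i (some true) b with hb1
    set bn := slice i none b with hbn
    have e0 : bn + bd b0 = 0 := by
      rw [hbn, hb0, ← slice_some_bd, hb]; rfl
    have e1 : bn + bd b1 = 0 := by
      rw [hbn, hb1, ← slice_some_bd, hb]; rfl
    have hs : bd (b0 + b1) = 0 := by
      rw [bd_add, ← chain_add_eq_zero.1 e0, ← chain_add_eq_zero.1 e1, chain_add_self]
    have hdeg : HasDegree k (b0 + b1) := (hd.slice_some i false).add (hd.slice_some i true)
    have hpar : k = 0 → ∑ f, (b0 + b1) f = 0 := by
      intro hk
      have h := h0 hk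
      subst hk
      rw [sum_slice i] at h
      have hz : ∀ f, b (i.insertNth none f) = 0 := fun f =>
        congrFun (hd.slice_none_zero i) f
      simp only [hz, sum_const_zero, zero_add] at h
      rw [← h, ← sum_add_distrib]
      rfl
    obtain ⟨c', hc'd, hc'b, hc's⟩ := ih (b0 + b1) hdeg hs hpar
    have hsz : size b = size bn + (size b0 + size b1) := size_slice i b
    have hadd := size_add_le b0 b1
    -- The inductive constant is meaningful only for `k ≤ M`; in higher degree both sides are empty.
    have hk : size b0 + size b1 = 0 ∨ k ≤ M := by
      by_contra! h
      exact h.1 (by rw [hb0, hb1, hasDegree_eq_zero (hd.slice_some i false) h.2,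
        hasDegree_eq_zero (hd.slice_some i true) h.2, size_zero])
    -- Here `s` is the size of the swept side, at most half of both sides together.
    have key : ∀ s, 2 * s ≤ size b0 + size b1 →
        2 * (k + 1) * (s + size c') + k * size b ≤ (M + 1) * size b := by
      intro s hs
      rcases hk with hk | hk
      · have hz : size (b0 + b1) = 0 := by omega
        have hc0 : size c' = 0 := by
          rw [hz] at hc's
          nlinarith
        have : s = 0 := by omega
        rw [this, hc0]
        nlinarith
      · obtain ⟨r, rfl⟩ := Nat.exists_eq_add_of_le hk
        nlinarith
    rcases le_total (size b0) (size b1) with hle | hle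
    · refine ⟨glue i 0 c' b0, hasDegree_glue (hasDegree_zero _) hc'd (hd.slice_some i false), ?_,
        ?_⟩
      · refine ext_slice i ?_
        rintro (_ | _ | _)
        · rw [slice_none_bd, slice_glue_none, ← hbn]; exact (chain_add_eq_zero.1 e0).symm
        · rw [slice_some_bd]; simp [bd_zero, hb0]
        · rw [slice_some_bd, slice_glue_none, slice_glue_true, hc'b, ← add_assoc, chain_add_self,
            zero_add]
      · rw [size_glue, size_zero, zero_add]
        exact key _ (by omega)
    · refine ⟨glue i c' 0 b1, hasDegree_glue hc'd (hasDegree_zero _) (hd.slice_some i true), ?_,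
        ?_⟩
      · refine ext_slice i ?_
        rintro (_ | _ | _)
        · rw [slice_none_bd, slice_glue_none, ← hbn]; exact (chain_add_eq_zero.1 e1).symm
        · rw [slice_some_bd, slice_glue_none, slice_glue_false, hc'b, add_comm b0, ← add_assoc,
            chain_add_self, zero_add]
        · rw [slice_some_bd]; simp [bd_zero, hb1]
      · rw [size_glue, size_zero, add_zero]
        exact key _ (by omega)

/-! ### Fillings invariant under the antipode -/

theorem IsInvariant.slice_none {M : ℕ} {b : Chain (M + 1)} (h : IsInvariant b) (i : Fin (M + 1)) :
    IsInvariant (slice i none b) := by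
  rw [isInvariant_iff] at h ⊢
  have := slice_flipAll i none b
  rw [h] at this
  exact this.symm

theorem IsInvariant.slice_true {M : ℕ} {b : Chain (M + 1)} (h : IsInvariant b) (i : Fin (M + 1)) :
    slice i (some true) b = flipAll (slice i (some false) b) := by
  rw [isInvariant_iff] at h
  have := slice_flipAll i (some true) b
  rw [h] at this
  exact this

theorem isInvariant_glue {M : ℕ} {i : Fin (M + 1)} {u w : Chain M} (hw : IsInvariant w) :
    IsInvariant (glue i u (flipAll u) w) := by
  rw [isInvariant_iff] at hw ⊢
  refine ext_slice i ?_
  rintro (_ | _ | _)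
  · rw [slice_flipAll]; simpa using hw
  · rw [slice_flipAll]; simp [flipAll_flipAll]
  · rw [slice_flipAll]; simp

/-- Every face has two facets in each of its free directions, so everything cancels modulo 2. -/
theorem sum_bd_eq_zero {M : ℕ} (u : Chain M) : ∑ f, bd u f = 0 := by
  have h : ∀ f j, (if f j = none then (0 : ZMod 2) else u (Function.update f j none)) =
      ∑ g, if (∃ x : Bool, f = Function.update g j (some x)) ∧ g j = none then u g else 0 := by
    intro f j
    split_ifs with hf
    · rw [eq_comm]
      refine sum_eq_zero fun g _ => if_neg ?_
      rintro ⟨⟨x, rfl⟩, -⟩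
      simp at hf
    · rw [sum_eq_single (Function.update f j none)]
      · rw [if_pos]
        refine ⟨?_, by simp⟩
        obtain ⟨x, hx⟩ := Option.ne_none_iff_exists.1 hf
        exact ⟨x, by simp [hx]⟩
      · intro g _ hg
        rw [if_neg]
        rintro ⟨⟨x, rfl⟩, hn⟩
        exact hg (by simp [← hn])
      · simp
  simp only [bd, h]
  rw [sum_comm]
  refine sum_eq_zero fun j _ => ?_
  rw [sum_comm]
  refine sum_eq_zero fun g _ => ?_
  by_cases hg : g j = none
  · have : ({f | (∃ x : Bool, f = Function.update g j (some x)) ∧ g j = none} : Finset (Word M)) =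
        {Function.update g j (some false), Function.update g j (some true)} := by
      ext f; simp [hg]
    rw [← sum_filter, this, sum_pair]
    · exact CharTwo.add_self_eq_zero _
    · intro h
      have := congrFun h j
      simp at this
  · simp [hg]

/-- The antipode pairs off the vertices, having no fixed vertex when there is at least one
coordinate. -/
theorem sum_invariant_eq_zero {M : ℕ} (w : Chain (M + 1)) (hw : IsInvariant w)
    (hd : HasDegree 0 w) : ∑ f, w f = 0 := by
  rw [sum_slice 0]
  have h1 : ∀ f, w ((0 : Fin (M + 1)).insertNth none f) = 0 :=
    fun f => congrFun (hd.slice_none_zero 0) f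
  have h2 : ∀ f, w ((0 : Fin (M + 1)).insertNth (some true) f) =
      flipAll (slice 0 (some false) w) f := fun f => congrFun (hw.slice_true 0) f
  simp only [h1, h2, sum_const_zero, zero_add, flipAll]
  have h3 := Equiv.sum_comp (Function.Involutive.toPerm antipode antipode_antipode_word)
    (slice 0 (some false) w)
  exact (congrArg _ h3).trans (CharTwo.add_self_eq_zero _)

/-- The part of `bd a` across a direction `i` is filled invariantly by `w`, by induction. This turns
one side of `bd a` into a cycle of a lower-dimensional cube without symmetry, which `exists_filling`
fills by `u`; the other side receives the antipode of `u`. Starting from the boundary of an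
invariant chain, rather than from any invariant cycle, avoids the homology of the projective cube.
Since the recursion for `w` is costly, `i` is chosen with few faces. -/
theorem exists_invariant_filling {M : ℕ} (k : ℕ) (a : Chain M) (ha : IsInvariant a)
    (hd : HasDegree (k + 1) a) (hk : k + 2 ≤ M) :
    ∃ c : Chain M, IsInvariant c ∧ HasDegree (k + 1) c ∧ bd c = bd a ∧
      2 * size c + (k + 1) * size (bd a) ≤ M * size (bd a) := by
  induction M generalizing k with
  | zero => omega
  | succ M ih =>
    have hbi : IsInvariant (bd a) := by
      rw [isInvariant_iff] at ha ⊢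
      rw [← bd_flipAll, ha]
    have hbd : HasDegree k (bd a) := hd.bd
    obtain ⟨i, hi⟩ := exists_slice_none_le hbd
    set b := bd a with hb
    set an := slice i none a with han
    have hbn : slice i none b = bd an := by rw [hb, slice_none_bd]
    have hb0 : slice i (some false) b = an + bd (slice i (some false) a) := by
      rw [hb, slice_some_bd]
    have hw : ∃ w : Chain M, IsInvariant w ∧ HasDegree k w ∧ bd w = slice i none b ∧
        2 * size w + k * size (slice i none b) ≤ M * size (slice i none b) ∧
        (k = 0 → w = 0) := by
      cases k with
      | zero =>
        have hz := hbd.slice_none_zero i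
        exact ⟨0, fun f => rfl, hasDegree_zero _, by rw [hz, bd_zero], by simp [size_zero],
          fun _ => rfl⟩
      | succ k =>
        obtain ⟨c, h1, h2, h3, h4⟩ := ih k an (ha.slice_none i) (hd.slice_none i) (by omega)
        rw [← hbn] at h3 h4
        exact ⟨c, h1, h2, h3, h4, by simp⟩
    obtain ⟨w, hwi, hwd, hwb, hws, hw0⟩ := hw
    have hcyc : bd (slice i (some false) b + w) = 0 := by
      have h2 : bd b = 0 → slice i none b + bd (slice i (some false) b) = 0 := by
        intro h
        rw [← slice_some_bd, h]; rfl
      rw [bd_add, hwb, hbn, hb0, bd_add]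
      rw [bd_bd, add_zero, chain_add_self]
    obtain ⟨u, hud, hub, hus⟩ := exists_filling k (slice i (some false) b + w)
      ((hbd.slice_some i false).add hwd) hcyc (by
        intro hk0
        subst hk0
        -- In degree 0 the cycle to be filled is an invariant 0-chain plus a boundary, so its sum
        -- vanishes.
        rw [hw0 rfl, add_zero, hb0]
        simp only [Pi.add_apply, sum_add_distrib]
        obtain ⟨M, rfl⟩ : ∃ M', M = M' + 1 := ⟨M - 1, by omega⟩
        rw [sum_invariant_eq_zero an (ha.slice_none i) (hd.slice_none i),
          sum_bd_eq_zero, add_zero])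
    refine ⟨glue i u (flipAll u) w, isInvariant_glue hwi, hasDegree_glue hud hud.flipAll hwd, ?_,
      ?_⟩
    · refine ext_slice i ?_
      rintro (_ | _ | _)
      · rw [slice_none_bd, slice_glue_none, hwb]
      · rw [slice_some_bd, slice_glue_none, slice_glue_false, hub, add_comm, add_assoc,
          chain_add_self, add_zero]
      · rw [slice_some_bd, slice_glue_none, slice_glue_true, bd_flipAll, hub, flipAll_add,
          isInvariant_iff.1 hwi, add_comm, add_assoc, chain_add_self, add_zero, hbi.slice_true]
    · rw [size_glue, size_flipAll]
      have hsz := size_slice i b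
      rw [hbi.slice_true i, size_flipAll] at hsz
      have hadd := size_add_le (slice i (some false) b) w
      obtain ⟨r, rfl⟩ := Nat.exists_eq_add_of_le (show k ≤ M by omega)
      generalize size (slice i (some false) b + w) = x1 at *
      generalize size (slice i (some false) b) = x2 at *
      generalize size (slice i none b) = x3 at *
      generalize size u = x4 at *
      generalize size w = x5 at *
      generalize size b = x6 at *
      have h1 : 2 * (k + 1) * x4 ≤ r * (x2 + x5) := by nlinarith
      have h2 : 2 * x5 ≤ r * x3 := by nlinarith
      have h3 : (k + r) * x3 ≤ k * x6 := by nlinarith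
      -- Multiplying by `k + 1` clears the denominator in the constant of `exists_filling`; `r` is
      -- `M - k`.
      have h4 : (k + 1) * (2 * (x5 + (x4 + x4))) ≤ (k + 1) * (r * x6) := by
        calc (k + 1) * (2 * (x5 + (x4 + x4))) = 2 * (2 * (k + 1) * x4) + 2 * (k + 1) * x5 := by ring
          _ ≤ 2 * (r * (x2 + x5)) + 2 * (k + 1) * x5 := by gcongr
          _ = r * (2 * x2) + (k + r + 1) * (2 * x5) := by ring
          _ ≤ r * (2 * x2) + (k + r + 1) * (r * x3) := by gcongr
          _ = r * (x6 + (k + r) * x3) := by rw [hsz]; ring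
          _ ≤ r * (x6 + k * x6) := by gcongr
          _ = _ := by ring
      have h5 := Nat.le_of_mul_le_mul_left h4 (by omega)
      nlinarith

/-! ### Cofillings -/

/-- The smaller side is cofilled by `c`, the other side gets `c + bn`, and nothing is placed across
the direction. The size is at most twice the smaller side plus `|bn|`, so nothing is lost. -/
theorem exists_cofilling {M : ℕ} (k : ℕ) (b : Chain M) (hd : HasDegree (k + 1) b)
    (hb : cobd b = 0) : ∃ c : Chain M, HasDegree k c ∧ cobd c = b ∧ size c ≤ size b := by
  induction M with
  | zero =>
    have := hasDegree_eq_zero hd (by omega)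
    exact ⟨0, hasDegree_zero _, by rw [cobd_zero, this], by rw [this]⟩
  | succ M ih =>
    set b0 := slice 0 (some false) b with hb0
    set b1 := slice 0 (some true) b with hb1
    set bn := slice 0 none b with hbn
    have hn : HasDegree k bn := hd.slice_none 0
    have e0 : cobd b0 = 0 := by rw [hb0, ← slice_some_cobd, hb]; rfl
    have e1 : cobd b1 = 0 := by rw [hb1, ← slice_some_cobd, hb]; rfl
    have en : b0 + b1 + cobd bn = 0 := by rw [hb0, hb1, hbn, ← slice_none_cobd, hb]; rfl
    have hsz : size b = size bn + (size b0 + size b1) := size_slice 0 b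
    have glue_deg : ∀ u v : Chain M, HasDegree k u → HasDegree k v →
        HasDegree k (glue 0 u v 0) := by
      intro u v hu hv
      cases k with
      | zero => exact hasDegree_glue_zero hu hv
      | succ k => exact hasDegree_glue hu hv (hasDegree_zero _)
    rcases le_total (size b0) (size b1) with hle | hle
    · obtain ⟨c, h1, h2, h3⟩ := ih b0 (hd.slice_some 0 false) e0
      refine ⟨glue 0 c (c + bn) 0, glue_deg _ _ h1 (h1.add hn), ?_, ?_⟩
      · refine ext_slice 0 ?_
        rintro (_ | _ | _)
        · rw [slice_none_cobd]; simp [cobd_zero, ← add_assoc, chain_add_self, hbn]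
        · rw [slice_some_cobd]; simp [h2, hb0]
        · rw [slice_some_cobd, slice_glue_true, cobd_add, h2, ← hb1]
          rw [add_right_comm] at en
          exact chain_add_eq_zero.1 en
      · rw [size_glue, size_zero]
        have := size_add_le c bn
        omega
    · obtain ⟨c, h1, h2, h3⟩ := ih b1 (hd.slice_some 0 true) e1
      refine ⟨glue 0 (c + bn) c 0, glue_deg _ _ (h1.add hn) h1, ?_, ?_⟩
      · refine ext_slice 0 ?_
        rintro (_ | _ | _)
        · rw [slice_none_cobd]
          simp [cobd_zero, add_right_comm, chain_add_self, hbn]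
        · rw [slice_some_cobd, slice_glue_false, cobd_add, h2, ← hb0]
          rw [add_assoc] at en
          exact (chain_add_eq_zero.1 en).symm
        · rw [slice_some_cobd]; simp [h2, hb1]
      · rw [size_glue, size_zero]
        have := size_add_le c bn
        omega

theorem eq_of_forall_update_eq {ι α β : Type*} [Finite ι] [DecidableEq ι] {F : (ι → α) → β}
    (h : ∀ v i x, F (Function.update v i x) = F v) (v w : ι → α) : F v = F w := by
  classical
  cases nonempty_fintype ι
  have key : ∀ s : Finset ι, F (s.piecewise v w) = F w := by
    intro s
    induction s using Finset.induction_on with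
    | empty => simp
    | insert i s _ ih => rw [Finset.piecewise_insert, h, ih]
  simpa using key univ

/-- Closed 0-cochains are constant because any two vertices are joined by a path of edges. -/
theorem eq_of_cobd_eq_zero {M : ℕ} {x : Chain M} (hx : cobd x = 0)
    (v w : Fin M → Bool) : x (fun i => some (v i)) = x (fun i => some (w i)) := by
  refine eq_of_forall_update_eq (F := fun v : Fin M → Bool => x (fun i => some (v i))) ?_ v w
  intro v i y
  have h0 : ∀ y', (fun j => some (Function.update v i y' j)) =
      Function.update (fun j => some (v j)) i (some y') := by
    intro y'; funext j
    rcases eq_or_ne j i with rfl | hj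
    · simp
    · simp [hj]
  have h1 := congrFun hx (Function.update (fun j => some (v j)) i none)
  simp only [cobd, Pi.zero_apply] at h1
  rw [Finset.sum_eq_single i] at h1
  · simp only [Function.update_self, if_true, Function.update_idem] at h1
    have h2 := CharTwo.add_eq_zero.1 h1
    have h3 : ∀ y' y'' : Bool, x (Function.update (fun j => some (v j)) i (some y')) =
        x (Function.update (fun j => some (v j)) i (some y'')) := by
      intro y' y''
      cases y' <;> cases y'' <;> simp [h2]
    have h4 := h3 y (v i)
    rw [← h0, ← h0, Function.update_eq_self] at h4
    exact h4
  · intro j _ hj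
    simp [hj]
  · simp

theorem flipAll_eq_of_cobd_eq_zero {M : ℕ} {x : Chain M} (hd : HasDegree 0 x)
    (hx : cobd x = 0) : flipAll x = x := by
  funext f
  by_cases hf : stars f = 0
  · have hn : ∀ i, f i ≠ none := by
      rw [stars_eq_card, Finset.card_eq_zero] at hf
      intro i hi
      have : i ∈ ({i | f i = none} : Finset (Fin M)) := by simpa using hi
      rw [hf] at this
      simp at this
    have : ∃ v : Fin M → Bool, f = fun i => some (v i) := by
      choose v hv using fun i => Option.ne_none_iff_exists.1 (hn i)
      exact ⟨v, funext fun i => (hv i).symm⟩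
    obtain ⟨v, rfl⟩ := this
    exact eq_of_cobd_eq_zero hx (fun i => !v i) v
  · have h1 : x f = 0 := by by_contra h; exact hf (hd f h)
    have h2 : flipAll x f = 0 := by by_contra h; exact hf (hd.flipAll f h)
    rw [h1, h2]

/-- One side is cofilled by `u` without symmetry and the other by the antipode of `u`. The defect
across direction 0 is the coboundary of an invariant cochain of one degree less, so induction on the
degree applies. Each degree adds at most one more copy of `|cobd a|`. -/
theorem exists_invariant_cofilling {M : ℕ} (k : ℕ) (a : Chain M) (ha : IsInvariant a)
    (hd : HasDegree k a) :
    ∃ c : Chain M, IsInvariant c ∧ HasDegree k c ∧ cobd c = cobd a ∧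
      size c ≤ (k + 1) * size (cobd a) := by
  induction M generalizing k with
  | zero =>
    have h : cobd a = 0 := by funext f; simp [cobd]
    exact ⟨0, fun f => rfl, hasDegree_zero _, by rw [cobd_zero, h], by simp [size_zero]⟩
  | succ M ih =>
    have hbi : IsInvariant (cobd a) := by
      rw [isInvariant_iff] at ha ⊢
      rw [← cobd_flipAll, ha]
    set b := cobd a with hb
    set a0 := slice 0 (some false) a with ha0
    have hb0 : slice 0 (some false) b = cobd a0 := by rw [hb, slice_some_cobd]
    have hbn : slice 0 none b = a0 + flipAll a0 + cobd (slice 0 none a) := by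
      rw [hb, slice_none_cobd, ha.slice_true 0]
    obtain ⟨u, hud, hub, hus⟩ := exists_cofilling k (slice 0 (some false) b)
      (hd.cobd.slice_some 0 false) (by rw [hb0]; exact cobd_cobd _)
    have hcl : cobd (a0 + u) = 0 := by rw [cobd_add, hub, hb0, chain_add_self]
    have hsz := size_slice 0 b
    rw [hbi.slice_true 0, size_flipAll] at hsz
    have hw : ∃ w : Chain M, IsInvariant w ∧ (k = 0 → w = 0) ∧
        (∀ k', k = k' + 1 → HasDegree k' w) ∧
        u + flipAll u + cobd w = slice 0 none b ∧
        size w ≤ k * (size (slice 0 none b) + 2 * size u) := by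
      cases k with
      | zero =>
        refine ⟨0, fun f => rfl, fun _ => rfl, by simp, ?_, by simp [size_zero]⟩
        -- In degree 0 the closed cochain `a0 + u` is constant, so `a0` and `u` have the same defect
        -- under the antipode.
        have h1 := flipAll_eq_of_cobd_eq_zero ((hd.slice_some 0 false).add hud) hcl
        rw [flipAll_add, ← chain_add_eq_zero] at h1
        rw [hbn, hd.slice_none_zero, cobd_zero, add_zero, add_zero, ← chain_add_eq_zero,
          ← h1]
        abel
      | succ k =>
        -- The closed cochain `a0 + u` is the coboundary of `x`; adding `x + flipAll x` to the
        -- middle slice of `a` gives an invariant cochain with the required coboundary. Its size is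
        -- irrelevant, as the bound sees only the coboundary.
        obtain ⟨x, hxd, hxb, -⟩ := exists_cofilling k (a0 + u)
          ((hd.slice_some 0 false).add hud) hcl
        have hxi : IsInvariant (slice 0 none a + (x + flipAll x)) := by
          have h1 := isInvariant_iff.1 (ha.slice_none 0)
          rw [isInvariant_iff, flipAll_add, flipAll_add, flipAll_flipAll, h1,
            add_comm (flipAll x)]
        have hxx : cobd (slice 0 none a + (x + flipAll x)) =
            slice 0 none b + (u + flipAll u) := by
          rw [cobd_add, cobd_add, cobd_flipAll, hxb, hbn, flipAll_add]
          have h2 := chain_add_self a0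
          have h3 := chain_add_self (flipAll a0)
          calc _ = (a0 + flipAll a0 + cobd (slice 0 none a)) + (u + flipAll u) := by abel
            _ = _ := rfl
        obtain ⟨w, h1, h2, h3, h4⟩ := ih k _ hxi
          ((hd.slice_none 0).add (hxd.add hxd.flipAll))
        refine ⟨w, h1, by simp, ?_, ?_, h4.trans ?_⟩
        · rintro k' hk'
          obtain rfl : k = k' := by omega
          exact h2
        · rw [h3, hxx, add_comm, add_assoc, chain_add_self, add_zero]
        · gcongr
          rw [hxx]
          have := size_add_le (slice 0 none b) (u + flipAll u)
          have := size_add_le u (flipAll u)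
          rw [size_flipAll] at this
          omega
    obtain ⟨w, hwi, hw0, hwd, hwb, hws⟩ := hw
    refine ⟨glue 0 u (flipAll u) w, isInvariant_glue hwi, ?_, ?_, ?_⟩
    · cases k with
      | zero => rw [hw0 rfl]; exact hasDegree_glue_zero hud hud.flipAll
      | succ k => exact hasDegree_glue hud hud.flipAll (hwd k rfl)
    · refine ext_slice 0 ?_
      rintro (_ | _ | _)
      · rw [slice_none_cobd]; simpa using hwb
      · rw [slice_some_cobd, slice_glue_false, hub]
      · rw [slice_some_cobd, slice_glue_true, cobd_flipAll, hub, hbi.slice_true]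
    · rw [size_glue, size_flipAll, hsz]
      nlinarith

section

/-! ### The algebra of Pauli operators -/

/-- The character `x ↦ (-1) ^ x` of `ZMod 2`. -/
def sgn (x : ZMod 2) : ℂ := (-1) ^ x.val

theorem sgn_zero : sgn 0 = 1 := by simp [sgn]

theorem sgn_one : sgn 1 = -1 := by simp [sgn, ZMod.val_one]

theorem zmod_two_cases (x : ZMod 2) : x = 0 ∨ x = 1 := by
  revert x; decide

theorem sgn_add (x y : ZMod 2) : sgn (x + y) = sgn x * sgn y := by
  have h11 : (1 + 1 : ZMod 2) = 0 := by decide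
  rcases zmod_two_cases x with rfl | rfl <;> rcases zmod_two_cases y with rfl | rfl <;>
    simp [sgn_zero, sgn_one, h11]

theorem sgn_mul_self (x : ZMod 2) : sgn x * sgn x = 1 := by
  rcases zmod_two_cases x with rfl | rfl <;> simp [sgn_zero, sgn_one]

theorem sgn_ne_zero (x : ZMod 2) : sgn x ≠ 0 := by
  rcases zmod_two_cases x with rfl | rfl <;> simp [sgn_zero, sgn_one]

theorem star_sgn (x : ZMod 2) : star (sgn x) = sgn x := by
  rcases zmod_two_cases x with rfl | rfl <;> simp [sgn_zero, sgn_one]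

theorem sgn_sum {α : Type*} (s : Finset α) (f : α → ZMod 2) :
    sgn (∑ i ∈ s, f i) = ∏ i ∈ s, sgn (f i) := by
  classical
  induction s using Finset.induction_on with
  | empty => simp [sgn_zero]
  | insert a s ha ih => rw [sum_insert ha, prod_insert ha, sgn_add, ih]


variable {ι : Type} [Fintype ι] [DecidableEq ι]

theorem sum_sgn_dotProduct (a : ι → ZMod 2) :
    ∑ y : ι → ZMod 2, sgn (a ⬝ᵥ y) = if a = 0 then 2 ^ Fintype.card ι else 0 := by
  split_ifs with h
  · subst h
    simp [sgn_zero, ZMod.card]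
  · obtain ⟨i, hi⟩ := Function.ne_iff.1 h
    have hi1 : a i = 1 := (zmod_two_cases _).resolve_left hi
    have := Equiv.sum_comp (Equiv.addRight (Pi.single i (1 : ZMod 2))) fun y : ι → ZMod 2 =>
      sgn (a ⬝ᵥ y)
    simp only [Equiv.coe_addRight, dotProduct_add, sgn_add, dotProduct_single, hi1, mul_one,
      sgn_one, mul_neg, sum_neg_distrib] at this
    exact self_eq_neg.1 this.symm

theorem pi_add_self (a : ι → ZMod 2) : a + a = 0 := by
  funext f; exact CharTwo.add_self_eq_zero _

theorem pauli_add_self (P : Pauli ι) : P + P = 0 :=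
  Prod.ext (pi_add_self _) (pi_add_self _)

theorem eq_add_iff_eq_add {a b c : ι → ZMod 2} : a = b + c ↔ b = a + c := by
  constructor
  · rintro rfl; rw [add_assoc, pi_add_self, add_zero]
  · rintro rfl; rw [add_assoc, pi_add_self, add_zero]

theorem Pauli.toOp_apply (P : Pauli ι) (x y : ι → ZMod 2) :
    P.toOp x y = if x = y + P.1 then sgn (P.2 ⬝ᵥ y) else 0 := by
  rw [Pauli.toOp]
  split_ifs with h
  · subst h
    rw [dotProduct, sgn_sum]
    exact prod_congr rfl fun q _ => if_pos rfl
  · obtain ⟨q, hq⟩ := Function.ne_iff.1 h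
    exact prod_eq_zero (mem_univ q) (if_neg hq)

theorem Pauli.toOp_mul (P Q : Pauli ι) :
    P.toOp * Q.toOp = sgn (P.2 ⬝ᵥ Q.1) • (P + Q).toOp := by
  ext x y
  rw [Matrix.mul_apply, Finset.sum_eq_single (y + Q.1)]
  · simp only [Pauli.toOp_apply, Matrix.smul_apply, Prod.fst_add, Prod.snd_add, smul_eq_mul, if_true,
      add_dotProduct, dotProduct_add, sgn_add, add_assoc, add_comm Q.1 P.1]
    split_ifs <;> ring
  · intro z _ hz
    simp [Pauli.toOp_apply Q, hz]
  · simp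

theorem Pauli.toOp_zero : (0 : Pauli ι).toOp = 1 := by
  ext x y
  simp [Pauli.toOp_apply, Matrix.one_apply, sgn_zero]

theorem Pauli.conjTranspose_toOp (P : Pauli ι) :
    P.toOpᴴ = sgn (P.2 ⬝ᵥ P.1) • P.toOp := by
  ext x y
  simp only [conjTranspose_apply, Pauli.toOp_apply, Matrix.smul_apply, smul_eq_mul]
  by_cases h : y = x + P.1
  · rw [if_pos h, if_pos (eq_add_iff_eq_add.1 h), h, star_sgn, dotProduct_add, sgn_add, mul_left_comm,
      sgn_mul_self, mul_one]
  · rw [if_neg h, if_neg (fun h' => h (eq_add_iff_eq_add.1 h'))]; simp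

theorem Pauli.conjTranspose_mul_toOp (P : Pauli ι) : P.toOpᴴ * P.toOp = 1 := by
  rw [P.conjTranspose_toOp, smul_mul_assoc, P.toOp_mul, smul_smul, sgn_mul_self, pauli_add_self,
    Pauli.toOp_zero, one_smul]

theorem Pauli.toOp_mul_conjTranspose (P : Pauli ι) : P.toOp * P.toOpᴴ = 1 :=
  mul_eq_one_comm.1 P.conjTranspose_mul_toOp

/-- The symplectic form: `1` if the Pauli operators anticommute and `0` if they commute. -/
def symp (P Q : Pauli ι) : ZMod 2 := P.1 ⬝ᵥ Q.2 + P.2 ⬝ᵥ Q.1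

theorem symp_comm (P Q : Pauli ι) : symp P Q = symp Q P := by
  rw [symp, symp, add_comm, dotProduct_comm P.2, dotProduct_comm P.1]

theorem symp_add (P Q R : Pauli ι) : symp P (Q + R) = symp P Q + symp P R := by
  simp [symp, dotProduct_add]; ring

theorem add_symp (P Q R : Pauli ι) : symp (P + Q) R = symp P R + symp Q R := by
  simp [symp, add_dotProduct]; ring

theorem symp_zero (P : Pauli ι) : symp P 0 = 0 := by simp [symp]

theorem symp_eq_sum (P Q : Pauli ι) : symp P Q = ∑ q, (P.1 q * Q.2 q + P.2 q * Q.1 q) := by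
  simp [symp, dotProduct, sum_add_distrib]

theorem Pauli.toOp_mul_comm (P Q : Pauli ι) :
    P.toOp * Q.toOp = sgn (symp P Q) • (Q.toOp * P.toOp) := by
  rw [P.toOp_mul, Q.toOp_mul, smul_smul, symp, sgn_add, dotProduct_comm Q.2, add_comm Q P]
  congr 1
  rw [mul_right_comm, sgn_mul_self, one_mul]

theorem Pauli.toOp_mul_ne_zero (P Q : Pauli ι) : P.toOp * Q.toOp ≠ 0 := by
  intro h
  have h1 : P.toOpᴴ * (P.toOp * Q.toOp) * Q.toOpᴴ = 1 := by
    rw [← mul_assoc, P.conjTranspose_mul_toOp, one_mul, Q.toOp_mul_conjTranspose]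
  rw [h] at h1
  simp at h1

theorem Pauli.commute_iff (P Q : Pauli ι) : Commute P.toOp Q.toOp ↔ symp P Q = 0 := by
  rw [commute_iff_eq, P.toOp_mul_comm]
  constructor
  · intro h
    by_contra hne
    have h1 : symp P Q = 1 := (zmod_two_cases _).resolve_left hne
    rw [h1, sgn_one, neg_one_smul] at h
    refine Q.toOp_mul_ne_zero P ((smul_eq_zero.1 ?_ : (2 : ℂ) = 0 ∨ _).resolve_left two_ne_zero)
    rw [two_smul]
    nth_rewrite 1 [← h]
    exact neg_add_cancel _
  · intro h; rw [h, sgn_zero, one_smul]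

theorem Pauli.trace_toOp (P : Pauli ι) :
    P.toOp.trace = if P = 0 then 2 ^ Fintype.card ι else 0 := by
  simp only [trace, diag_apply, Pauli.toOp_apply, left_eq_add]
  by_cases h1 : P.1 = 0
  · simp only [h1, if_true, sum_sgn_dotProduct]
    congr 1
    rw [Prod.ext_iff]
    simp [h1]
  · simp only [h1, if_false, sum_const_zero]
    rw [if_neg]
    rintro rfl
    exact h1 rfl

theorem sum_sgn_symp (P : Pauli ι) :
    ∑ Q : Pauli ι, sgn (symp P Q) = if P = 0 then 4 ^ Fintype.card ι else 0 := by
  simp only [symp, sgn_add]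
  rw [Fintype.sum_prod_type]
  simp only [← sum_mul, ← mul_sum, sum_sgn_dotProduct, Prod.ext_iff, 
    Prod.fst_zero, Prod.snd_zero]
  by_cases h1 : P.1 = 0 <;> by_cases h2 : P.2 = 0 <;> simp [h1, h2, ← mul_pow]
  norm_num

/-! ### Supports of operators -/

/-- `P` is the identity on the qubits of `T`. -/
def Pauli.VanishesOn (P : Pauli ι) (T : Set ι) : Prop := ∀ i ∈ T, P.1 i = 0 ∧ P.2 i = 0

/-- The operator `M` acts non-trivially only on `T`: it commutes with all Pauli operators outside
of `T`. -/
def SuppOn (T : Set ι) (M : Op ι) : Prop :=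
  ∀ P : Pauli ι, P.VanishesOn T → Commute P.toOp M

theorem SuppOn.mono {T T' : Set ι} {M : Op ι} (h : SuppOn T M) (hT : T ⊆ T') : SuppOn T' M :=
  fun P hP => h P fun i hi => hP i (hT hi)

theorem SuppOn.mul {T : Set ι} {M N : Op ι} (hM : SuppOn T M) (hN : SuppOn T N) :
    SuppOn T (M * N) := fun P hP => (hM P hP).mul_right (hN P hP)

theorem SuppOn.add {T : Set ι} {M N : Op ι} (hM : SuppOn T M) (hN : SuppOn T N) :
    SuppOn T (M + N) := fun P hP => (hM P hP).add_right (hN P hP)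

theorem SuppOn.sub {T : Set ι} {M N : Op ι} (hM : SuppOn T M) (hN : SuppOn T N) :
    SuppOn T (M - N) := fun P hP => (hM P hP).sub_right (hN P hP)

theorem SuppOn.smul {T : Set ι} {M : Op ι} (hM : SuppOn T M) (c : ℂ) :
    SuppOn T (c • M) := fun P hP => (hM P hP).smul_right c

theorem suppOn_one (T : Set ι) : SuppOn T (1 : Op ι) := fun _ _ => Commute.one_right _

theorem SuppOn.list_prod {T : Set ι} {l : List (Op ι)} (h : ∀ M ∈ l, SuppOn T M) :
    SuppOn T l.prod := by
  induction l with
  | nil => exact suppOn_one T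
  | cons a l ih =>
    rw [List.prod_cons]
    exact (h a (by simp)).mul (ih fun M hM => h M (by simp [hM]))

theorem SuppOn.conjTranspose {T : Set ι} {M : Op ι} (hM : SuppOn T M) : SuppOn T Mᴴ := by
  intro P hP
  have h := congrArg Matrix.conjTranspose (hM P hP).eq
  rw [conjTranspose_mul, conjTranspose_mul, P.conjTranspose_toOp, mul_smul_comm,
    smul_mul_assoc] at h
  exact ((smul_right_injective (Op ι) (sgn_ne_zero (P.2 ⬝ᵥ P.1))) h).symm

theorem suppOn_toOp {T : Set ι} (P : Pauli ι) (h : P.VanishesOn Tᶜ) : SuppOn T P.toOp := by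
  intro Q hQ
  rw [Pauli.commute_iff, symp_eq_sum]
  refine sum_eq_zero fun q _ => ?_
  by_cases hq : q ∈ T
  · simp [hQ q hq]
  · simp [h q hq]

/-- Commuting with `Z` on a qubit outside `T` makes the matrix diagonal in that qubit; commuting
with `X` makes it independent of the qubit's value. -/
theorem suppOn_iff {T : Set ι} {M : Op ι} : SuppOn T M ↔
    (∀ x y, M x y ≠ 0 → ∀ i ∉ T, x i = y i) ∧
      ∀ x y u : ι → ZMod 2, (∀ i ∈ T, u i = 0) → M (x + u) (y + u) = M x y := by
  constructor
  · intro h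
    constructor
    · intro x y hxy i hi
      have h1 := h (0, Pi.single i 1) fun j hj => ⟨rfl, by
        change (Pi.single i 1 : ι → ZMod 2) j = 0
        rw [Pi.single_apply, if_neg]; rintro rfl; exact hi hj⟩
      have h2 := congrFun (congrFun h1.eq x) y
      rw [Matrix.mul_apply, Matrix.mul_apply, Finset.sum_eq_single x, Finset.sum_eq_single y] at h2
      · simp only [Pauli.toOp_apply, add_zero, if_true, single_one_dotProduct] at h2
        rw [mul_comm] at h2
        have h3 := mul_left_cancel₀ hxy h2
        rcases zmod_two_cases (x i) with h | h <;> rcases zmod_two_cases (y i) with h' | h' <;>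
          rw [h, h'] at h3 ⊢ <;> rw [sgn_zero, sgn_one] at h3 <;> norm_num at h3
      · intro z _ hz; simp [Pauli.toOp_apply, hz]
      · simp
      · intro z _ hz; simp [Pauli.toOp_apply, hz.symm]
      · simp
    · intro x y u hu
      have h1 := h (u, 0) fun j hj => ⟨hu j hj, rfl⟩
      have h2 := congrFun (congrFun h1.eq (x + u)) y
      rw [Matrix.mul_apply, Matrix.mul_apply, Finset.sum_eq_single x,
        Finset.sum_eq_single (y + u)] at h2
      · simpa [Pauli.toOp_apply, sgn_zero] using h2.symm
      · intro z _ hz; simp [Pauli.toOp_apply, hz]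
      · simp
      · intro z _ hz; simp [Pauli.toOp_apply, hz.symm]
      · simp
  · rintro ⟨h1, h2⟩ P hP
    ext x y
    rw [Matrix.mul_apply, Matrix.mul_apply, Finset.sum_eq_single (x + P.1),
      Finset.sum_eq_single (y + P.1)]
    · have h3 := h2 (x + P.1) y P.1 fun i hi => (hP i hi).1
      rw [add_assoc, pi_add_self, add_zero] at h3
      simp only [Pauli.toOp_apply, if_true, add_assoc, pi_add_self, add_zero]
      rw [h3]
      by_cases hM : M (x + P.1) y = 0
      · simp [hM]
      · have h4 := h1 _ _ hM
        rw [mul_comm]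
        congr 2
        refine sum_congr rfl fun i _ => ?_
        by_cases hi : i ∈ T
        · simp [hP i hi]
        · rw [h4 i hi]
    · intro z _ hz; simp [Pauli.toOp_apply, hz]
    · simp
    · intro z _ hz
      rw [Pauli.toOp_apply, if_neg, zero_mul]
      intro h; exact hz (eq_add_iff_eq_add.1 h)
    · simp

theorem SuppOn.commute {T T' : Set ι} {M N : Op ι} (hM : SuppOn T M) (hN : SuppOn T' N)
    (hd : Disjoint T T') : Commute M N := by
  classical
  obtain ⟨m1, m2⟩ := suppOn_iff.1 hM
  obtain ⟨n1, n2⟩ := suppOn_iff.1 hN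
  ext x y
  -- Only the intermediate words `z` and `z'` can contribute to the entries of `M * N` and `N * M`
  -- at `(x, y)`.
  set z : ι → ZMod 2 := fun i => if i ∈ T then y i else x i with hz
  set z' : ι → ZMod 2 := fun i => if i ∈ T then x i else y i with hz'
  rw [Matrix.mul_apply, Matrix.mul_apply]
  by_cases hxy : ∀ i, i ∉ T → i ∉ T' → x i = y i
  · rw [Finset.sum_eq_single z, Finset.sum_eq_single z']
    · have hu1 : M x z = M z' y := by
        have := m2 x z (fun i => if i ∈ T then 0 else x i + y i) (fun i hi => by simp [hi])
        rw [← this]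
        congr 1 <;> funext i <;> by_cases hi : i ∈ T <;>
          simp [hz, hz', hi, ← add_assoc, CharTwo.add_self_eq_zero]
      have hu2 : N z y = N x z' := by
        have := n2 z y (fun i => if i ∈ T then x i + y i else 0) (fun i hi => by
          have : i ∉ T := fun h => Set.disjoint_left.1 hd h hi
          simp [this])
        rw [← this]
        have h3 : ∀ a b : ZMod 2, a + (b + a) = b := by decide
        congr 1 <;> funext i <;> by_cases hi : i ∈ T <;>
          simp [hz, hz', hi, h3]
      rw [hu1, hu2, mul_comm]
    · intro w _ hw
      by_contra hne
      refine hw (funext fun i => ?_)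
      by_cases hi : i ∈ T
      · simp only [hz', hi, if_true]
        exact (n1 _ _ (left_ne_zero_of_mul hne) i (Set.disjoint_left.1 hd hi)).symm
      · simp only [hz', hi, if_false]
        exact m1 _ _ (right_ne_zero_of_mul hne) i hi
    · simp
    · intro w _ hw
      by_contra hne
      refine hw (funext fun i => ?_)
      by_cases hi : i ∈ T
      · simp only [hz, hi, if_true]
        exact n1 _ _ (right_ne_zero_of_mul hne) i (Set.disjoint_left.1 hd hi)
      · simp only [hz, hi, if_false]
        exact (m1 _ _ (left_ne_zero_of_mul hne) i hi).symm
    · simp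
  · push Not at hxy
    obtain ⟨i, hi, hi', hne⟩ := hxy
    rw [Finset.sum_eq_zero, Finset.sum_eq_zero]
    · intro w _
      by_contra h
      exact hne ((n1 _ _ (left_ne_zero_of_mul h) i hi').trans
        (m1 _ _ (right_ne_zero_of_mul h) i hi))
    · intro w _
      by_contra h
      exact hne ((m1 _ _ (left_ne_zero_of_mul h) i hi).trans
        (n1 _ _ (right_ne_zero_of_mul h) i hi'))

theorem SuppOn.actsOn {T : Finset ι} {M : Op ι} (h : SuppOn (T : Set ι) M) : ActsOn T M := by
  obtain ⟨h1, h2⟩ := suppOn_iff.1 h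
  let ext : (T → ZMod 2) → ι → ZMod 2 := fun x i => if hi : i ∈ T then x ⟨i, hi⟩ else 0
  refine ⟨fun x y => M (ext x) (ext y), ?_⟩
  ext x y
  unfold extendOp
  split_ifs with hxy
  · have := h2 (ext fun i => x i) (ext fun i => y i) (fun i => if i ∈ T then 0 else x i)
      (fun i hi => by simp [Finset.mem_coe.1 hi])
    refine Eq.trans ?_ this
    congr 1 <;> funext i <;> by_cases hi : i ∈ T <;> simp [ext, hi]
    exact (hxy i hi).symm
  · by_contra hne
    exact hxy fun i hi => h1 x y hne i (by simpa using hi)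

end

section

variable {ι Q : Type} [Fintype ι] [DecidableEq ι] [Fintype Q] [DecidableEq Q]

/-! ### Operators on a subset of the qubits -/

open Classical in
/-- The operator `A` on the qubits in the image of `S`, tensored with the identity. -/
def liftOp (S : Q ↪ ι) (A : Op Q) : Op ι := fun x y =>
  if ∀ i, i ∉ Set.range S → x i = y i then A (fun q => x (S q)) (fun q => y (S q)) else 0

open Classical in
/-- The word that is `a` on the image of `S` and `x` elsewhere. -/
def graft (S : Q ↪ ι) (x : ι → ZMod 2) (a : Q → ZMod 2) : ι → ZMod 2 := fun i =>
  if h : i ∈ Set.range S then a h.choose else x i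

theorem graft_apply (S : Q ↪ ι) (x : ι → ZMod 2) (a : Q → ZMod 2) (q : Q) :
    graft S x a (S q) = a q := by
  have h : S q ∈ Set.range S := ⟨q, rfl⟩
  rw [graft, dif_pos h]
  exact congrArg a (S.injective h.choose_spec)

theorem graft_apply_of_notMem (S : Q ↪ ι) (x : ι → ZMod 2) (a : Q → ZMod 2) {i : ι}
    (h : i ∉ Set.range S) : graft S x a i = x i := dif_neg h

open Classical in
theorem sum_graft (S : Q ↪ ι) (x : ι → ZMod 2) (F : (ι → ZMod 2) → ℂ) :
    ∑ z, (if ∀ i, i ∉ Set.range S → x i = z i then F z else 0) = ∑ a, F (graft S x a) := by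
  rw [← sum_filter]
  symm
  refine sum_bij (fun a _ => graft S x a) ?_ ?_ ?_ ?_
  · intro a _
    simp only [mem_filter, mem_univ, true_and]
    intro i hi
    rw [graft_apply_of_notMem S x a hi]
  · intro a _ b _ h
    funext q
    have := congrFun h (S q)
    rwa [graft_apply, graft_apply] at this
  · intro z hz
    simp only [mem_filter, mem_univ, true_and] at hz
    refine ⟨fun q => z (S q), mem_univ _, ?_⟩
    funext i
    by_cases hi : i ∈ Set.range S
    · obtain ⟨q, rfl⟩ := hi
      rw [graft_apply]
    · rw [graft_apply_of_notMem S x _ hi, hz i hi]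
  · intros; rfl

theorem liftOp_mul (S : Q ↪ ι) (A B : Op Q) : liftOp S A * liftOp S B = liftOp S (A * B) := by
  classical
  ext x y
  rw [Matrix.mul_apply]
  have h : ∀ z, liftOp S A x z * liftOp S B z y =
      if ∀ i, i ∉ Set.range S → x i = z i then
        A (fun q => x (S q)) (fun q => z (S q)) * liftOp S B z y else 0 := by
    intro z
    rw [liftOp]; split_ifs <;> simp
  simp only [h]
  rw [sum_graft S x]
  simp only [liftOp, graft_apply]
  have h2 : ∀ a, (∀ i, i ∉ Set.range S → graft S x a i = y i) ↔
      ∀ i, i ∉ Set.range S → x i = y i := by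
    intro a
    refine forall₂_congr fun i hi => ?_
    rw [graft_apply_of_notMem S x a hi]
  simp only [h2]
  split_ifs
  · rw [Matrix.mul_apply]
  · simp

theorem liftOp_sub (S : Q ↪ ι) (A B : Op Q) : liftOp S (A - B) = liftOp S A - liftOp S B := by
  ext x y
  simp only [liftOp, Matrix.sub_apply]
  split_ifs <;> simp

theorem liftOp_smul (S : Q ↪ ι) (c : ℂ) (A : Op Q) : liftOp S (c • A) = c • liftOp S A := by
  ext x y
  simp only [liftOp, Matrix.smul_apply]
  split_ifs <;> simp

theorem liftOp_one (S : Q ↪ ι) : liftOp S (1 : Op Q) = 1 := by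
  ext x y
  simp only [liftOp, Matrix.one_apply]
  by_cases h : x = y
  · subst h; simp
  · rw [if_neg h]
    split_ifs with h1 h2
    · refine absurd (funext fun i => ?_) h
      by_cases hi : i ∈ Set.range S
      · obtain ⟨q, rfl⟩ := hi
        exact congrFun h2 q
      · exact h1 i hi
    · rfl
    · rfl

theorem conjTranspose_liftOp (S : Q ↪ ι) (A : Op Q) : (liftOp S A)ᴴ = liftOp S Aᴴ := by
  ext x y
  simp only [liftOp, Matrix.conjTranspose_apply, eq_comm (a := x _)]
  split_ifs <;> simp

/-- The partial trace is adjoint to tensoring with the identity. -/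
theorem trace_reducedOp_mul (S : Q ↪ ι) (M : Op ι) (A : Op Q) :
    (reducedOp S M * A).trace = (M * liftOp S A).trace := by
  classical
  have h1 : ∀ x y : Q → ZMod 2, reducedOp S M x y * A y x =
      ∑ u, ∑ v, if (∀ i, i ∉ Set.range S → u i = v i) then
        (if (fun q => u (S q)) = x then (if (fun q => v (S q)) = y then M u v * A y x else 0)
          else 0) else 0 := by
    intro x y
    rw [reducedOp, sum_mul]
    refine sum_congr rfl fun u _ => ?_
    rw [sum_mul]
    refine sum_congr rfl fun v _ => ?_
    simp only [funext_iff]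
    split_ifs <;> simp_all
  simp only [Matrix.trace, Matrix.diag_apply, Matrix.mul_apply, h1]
  have h2 : ∀ x : Q → ZMod 2, (∑ y : Q → ZMod 2, ∑ u, ∑ v,
      if (∀ i, i ∉ Set.range S → u i = v i) then
        (if (fun q => u (S q)) = x then (if (fun q => v (S q)) = y then M u v * A y x else 0)
          else 0) else 0) = ∑ u, ∑ v, if (fun q => u (S q)) = x then
          (if (∀ i, i ∉ Set.range S → u i = v i) then M u v * A (fun q => v (S q)) x else 0)
          else 0 := by
    intro x
    rw [sum_comm]
    refine sum_congr rfl fun u _ => ?_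
    rw [sum_comm]
    refine sum_congr rfl fun v _ => ?_
    split_ifs <;> simp
  simp only [h2]
  rw [sum_comm]
  refine sum_congr rfl fun u _ => ?_
  rw [sum_comm]
  refine sum_congr rfl fun v _ => ?_
  simp only [sum_ite_eq, mem_univ, if_true, liftOp, eq_comm (a := v _)]
  split_ifs <;> simp

theorem SuppOn.liftOp {T : Set Q} {A : Op Q} (h : SuppOn T A) (S : Q ↪ ι) :
    SuppOn (S '' T) (liftOp S A) := by
  classical
  rw [suppOn_iff] at h ⊢
  obtain ⟨h1, h2⟩ := h
  constructor
  · intro x y hxy i hi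
    unfold ThermalTQO.liftOp at hxy
    split_ifs at hxy with hc
    · by_cases hr : i ∈ Set.range S
      · obtain ⟨q, rfl⟩ := hr
        exact h1 _ _ hxy q fun hq => hi ⟨q, hq, rfl⟩
      · exact hc i hr
    · exact absurd rfl hxy
  · intro x y u hu
    unfold ThermalTQO.liftOp
    simp only [Pi.add_apply, add_left_inj]
    split_ifs with hc
    · exact h2 (fun q => x (S q)) (fun q => y (S q)) (fun q => u (S q))
        fun q hq => hu _ ⟨q, hq, rfl⟩
    · rfl

theorem suppOn_univ (A : Op ι) : SuppOn Set.univ A := by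
  intro P hP
  have : P = 0 := Prod.ext (funext fun i => (hP i trivial).1) (funext fun i => (hP i trivial).2)
  rw [this, Pauli.toOp_zero]
  exact Commute.one_left A

theorem suppOn_extendOp (T : Finset ι) (A : Op T) : SuppOn (T : Set ι) (extendOp T A) := by
  have h : extendOp T A = liftOp (Function.Embedding.subtype (· ∈ T)) A := by
    ext x y
    unfold extendOp liftOp
    simp
  rw [h]
  refine ((suppOn_univ A).liftOp _).mono ?_
  rintro _ ⟨⟨i, hi⟩, -, rfl⟩
  exact hi

theorem extendOp_eq_liftOp (T : Finset ι) (A : Op T) :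
    extendOp T A = liftOp (Function.Embedding.subtype (· ∈ T)) A := by
  ext x y
  unfold extendOp liftOp
  simp

/-! ### Light cones of circuits -/

theorem Gate.conjTranspose_mul (g : Gate ι) :
    (extendOp g.wires g.op)ᴴ * extendOp g.wires g.op = 1 := by
  rw [extendOp_eq_liftOp, conjTranspose_liftOp, liftOp_mul]
  have := Matrix.mem_unitaryGroup_iff'.1 g.unitary
  rw [Matrix.star_eq_conjTranspose] at this
  rw [this, liftOp_one]

open Classical in
/-- The qubits that share a gate of the layer with `i`. -/
def Layer.cell (l : Layer ι) (i : ι) : Finset ι :=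
  if h : ∃ g ∈ l.gates, i ∈ g.wires then h.choose.wires else {i}

theorem Layer.cell_eq (l : Layer ι) {g : Gate ι} (hg : g ∈ l.gates) {i : ι} (hi : i ∈ g.wires) :
    l.cell i = g.wires := by
  have h : ∃ g ∈ l.gates, i ∈ g.wires := ⟨g, hg, hi⟩
  rw [Layer.cell, dif_pos h]
  by_contra hne
  have hne' : h.choose ≠ g := fun h' => hne (by rw [h'])
  have hsymm : Std.Symm fun g h : Gate ι => Disjoint g.wires h.wires := ⟨fun _ _ h => h.symm⟩
  have := l.disjoint.forall h.choose_spec.1 hg hne'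
  exact Finset.disjoint_left.1 this h.choose_spec.2 hi

theorem Layer.cell_eq_singleton (l : Layer ι) {i : ι} (h : ¬ ∃ g ∈ l.gates, i ∈ g.wires) :
    l.cell i = {i} := dif_neg h

theorem Layer.card_cell_le (l : Layer ι) (i : ι) : (l.cell i).card ≤ 2 := by
  by_cases h : ∃ g ∈ l.gates, i ∈ g.wires
  · obtain ⟨g, hg, hi⟩ := h
    rw [l.cell_eq hg hi]
    exact g.card_wires
  · rw [l.cell_eq_singleton h]; simp

theorem Layer.self_mem_cell (l : Layer ι) (i : ι) : i ∈ l.cell i := by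
  by_cases h : ∃ g ∈ l.gates, i ∈ g.wires
  · obtain ⟨g, hg, hi⟩ := h
    rwa [l.cell_eq hg hi]
  · rw [l.cell_eq_singleton h]; simp

theorem Layer.cell_eq_of_mem (l : Layer ι) {i j : ι} (h : j ∈ l.cell i) : l.cell j = l.cell i := by
  by_cases h' : ∃ g ∈ l.gates, i ∈ g.wires
  · obtain ⟨g, hg, hi⟩ := h'
    rw [l.cell_eq hg hi] at h ⊢
    exact l.cell_eq hg h
  · rw [l.cell_eq_singleton h', mem_singleton] at h
    rw [h]

theorem Layer.mem_cell_comm (l : Layer ι) {i j : ι} : j ∈ l.cell i ↔ i ∈ l.cell j :=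
  ⟨fun h => by rw [l.cell_eq_of_mem h]; exact l.self_mem_cell i,
    fun h => by rw [l.cell_eq_of_mem h]; exact l.self_mem_cell j⟩

theorem list_prod_unitary {L : List (Op ι)} (h : ∀ A ∈ L, Aᴴ * A = 1) : L.prodᴴ * L.prod = 1 := by
  induction L with
  | nil => simp
  | cons a L ih =>
    have ha := h a (by simp)
    have hL := ih fun A hA => h A (by simp [hA])
    rw [List.prod_cons, conjTranspose_mul, mul_assoc, ← mul_assoc aᴴ, ha, one_mul, hL]

theorem Layer.conjTranspose_mul (l : Layer ι) : l.toOpᴴ * l.toOp = 1 :=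
  list_prod_unitary fun A hA => by
    obtain ⟨g, -, rfl⟩ := List.mem_map.1 hA
    exact g.conjTranspose_mul

theorem Circuit.conjTranspose_mul (U : Circuit ι) : (Circuit.toOp U)ᴴ * Circuit.toOp U = 1 :=
  list_prod_unitary fun A hA => by
    obtain ⟨l, -, rfl⟩ := List.mem_map.1 hA
    exact l.conjTranspose_mul

/-- The cells of a layer partition the qubits, so a gate lies either inside the enlarged support or
entirely outside it. -/
theorem Layer.suppOn_conj (l : Layer ι) {T : Finset ι} {A : Op ι} (hA : SuppOn (T : Set ι) A) :
    SuppOn (T.biUnion l.cell : Set ι) (l.toOp * A * l.toOpᴴ) := by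
  have hsub : (T : Set ι) ⊆ (T.biUnion l.cell : Finset ι) := by
    intro i hi
    exact mem_coe.2 (mem_biUnion.2 ⟨i, hi, l.self_mem_cell i⟩)
  have key : ∀ L : List (Gate ι), (∀ g ∈ L, g ∈ l.gates) →
      SuppOn ((T.biUnion l.cell : Finset ι) : Set ι)
        ((L.map fun g => extendOp g.wires g.op).prod * A *
          ((L.map fun g => extendOp g.wires g.op).prod)ᴴ) := by
    intro L
    induction L with
    | nil => intro _; simpa using hA.mono hsub
    | cons g L ih =>
      intro hL
      have h1 := ih fun g hg => hL g (by simp [hg])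
      set B := (L.map fun g => extendOp g.wires g.op).prod with hB
      have h2 : ((g :: L).map fun g => extendOp g.wires g.op).prod * A *
          (((g :: L).map fun g => extendOp g.wires g.op).prod)ᴴ =
          extendOp g.wires g.op * (B * A * Bᴴ) * (extendOp g.wires g.op)ᴴ := by
        rw [List.map_cons, List.prod_cons, Matrix.conjTranspose_mul]
        simp only [mul_assoc, hB]
      rw [h2]
      have hg := suppOn_extendOp g.wires g.op
      -- A gate off the support commutes through and cancels its adjoint.
      by_cases hd : Disjoint g.wires (T.biUnion l.cell)
      · have hc := hg.commute h1 (by exact_mod_cast hd)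
        rw [hc.eq, mul_assoc, mul_eq_one_comm.1 g.conjTranspose_mul, mul_one]
        exact h1
      · have hs : (g.wires : Set ι) ⊆ ((T.biUnion l.cell : Finset ι) : Set ι) := by
          rw [Finset.not_disjoint_iff] at hd
          obtain ⟨j, hj, hj'⟩ := hd
          obtain ⟨i, hi, hij⟩ := mem_biUnion.1 hj'
          have h3 := l.cell_eq_of_mem hij
          rw [l.cell_eq (hL g (by simp)) hj] at h3
          intro k hk
          exact mem_coe.2 (mem_biUnion.2 ⟨i, hi, by rw [← h3]; exact hk⟩)
        exact ((hg.mono hs).mul h1).mul (hg.mono hs).conjTranspose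
  have := key l.gates fun g hg => hg
  simpa [Layer.toOp] using this

/-- The qubits that can influence the evolution of the observable at `i`. -/
def lightCone : Circuit ι → ι → Finset ι
  | [], i => {i}
  | l :: U, i => (lightCone U i).biUnion l.cell

theorem card_lightCone_le (U : Circuit ι) (i : ι) : (lightCone U i).card ≤ 2 ^ U.depth := by
  induction U with
  | nil => simp [lightCone, Circuit.depth]
  | cons l U ih =>
    have := card_biUnion_le_card_mul (lightCone U i) l.cell 2 fun j _ => l.card_cell_le j
    rw [lightCone]
    refine this.trans ?_
    rw [Circuit.depth, List.length_cons, pow_succ]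
    exact Nat.mul_le_mul_right _ ih

/-- Membership in cells is symmetric, so light cones can be traced backwards with the same growth.
-/
theorem card_lightCone_mem_le (U : Circuit ι) (j : ι) :
    #{i | j ∈ lightCone U i} ≤ 2 ^ U.depth := by
  induction U generalizing j with
  | nil => simp [lightCone, Circuit.depth, filter_eq]
  | cons l U ih =>
    have h : ({i | j ∈ lightCone (l :: U) i} : Finset ι) ⊆
        (l.cell j).biUnion fun k => {i | k ∈ lightCone U i} := by
      intro i hi
      simp only [lightCone, mem_filter, mem_univ, true_and, mem_biUnion] at hi ⊢
      obtain ⟨k, hk, hjk⟩ := hi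
      exact ⟨k, l.mem_cell_comm.1 hjk, hk⟩
    refine (card_le_card h).trans ((card_biUnion_le_card_mul _ _ _ fun k _ => ih k).trans ?_)
    have hd : Circuit.depth (l :: U) = Circuit.depth U + 1 := rfl
    rw [hd, pow_succ, mul_comm (2 ^ _)]
    exact Nat.mul_le_mul_right _ (l.card_cell_le j)

theorem Circuit.suppOn_conj (U : Circuit ι) {i : ι} {A : Op ι} (hA : SuppOn {i} A) :
    SuppOn (lightCone U i : Set ι) (Circuit.toOp U * A * (Circuit.toOp U)ᴴ) := by
  induction U with
  | nil => simpa [Circuit.toOp, lightCone] using hA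
  | cons l U ih =>
    have := l.suppOn_conj ih
    rw [lightCone]
    convert this using 1
    change (l.toOp * Circuit.toOp U) * A * (l.toOp * Circuit.toOp U)ᴴ = _
    rw [Matrix.conjTranspose_mul]
    simp only [mul_assoc]

end

section

variable {ι Q : Type} [Fintype ι] [DecidableEq ι] [Fintype Q] [DecidableEq Q]

/-! ### States prepared by shallow circuits -/

/-- The squared norm of a vector. -/
def nsq {α : Type*} [Fintype α] (v : α → ℂ) : ℝ := ∑ x, Complex.normSq (v x)

theorem nsq_nonneg {α : Type*} [Fintype α] (v : α → ℂ) : 0 ≤ nsq v :=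
  sum_nonneg fun _ _ => Complex.normSq_nonneg _

theorem nsq_eq {α : Type*} [Fintype α] (v : α → ℂ) : (nsq v : ℂ) = star v ⬝ᵥ v := by
  simp only [nsq, dotProduct, Pi.star_apply, RCLike.star_def, Complex.ofReal_sum,
    Complex.normSq_eq_conj_mul_self]

theorem nsq_mulVec (A : Op ι) (v : (ι → ZMod 2) → ℂ) :
    (nsq (A *ᵥ v) : ℂ) = star v ⬝ᵥ ((Aᴴ * A) *ᵥ v) := by
  rw [nsq_eq, star_mulVec, ← dotProduct_mulVec, mulVec_mulVec]

theorem nsq_mulVec_of_isometry {A : Op ι} (hA : Aᴴ * A = 1) (v : (ι → ZMod 2) → ℂ) :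
    nsq (A *ᵥ v) = nsq v := by
  have : (nsq (A *ᵥ v) : ℂ) = nsq v := by
    rw [nsq_mulVec, hA, one_mulVec, nsq_eq]
  exact_mod_cast this

theorem nsq_sub_le {α : Type*} [Fintype α] (v w : α → ℂ) :
    nsq (v - w) ≤ 2 * nsq v + 2 * nsq w := by
  simp only [nsq, mul_sum, ← sum_add_distrib]
  refine sum_le_sum fun x _ => ?_
  simp only [Pi.sub_apply, Complex.normSq_apply, Complex.sub_re, Complex.sub_im]
  nlinarith [sq_nonneg ((v x).re + (w x).re), sq_nonneg ((v x).im + (w x).im)]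

/-- The projection on the states whose qubit `i` is `1`. -/
def oneProj (i : ι) : Op ι := Matrix.diagonal fun x => if x i = 1 then 1 else 0

theorem suppOn_oneProj (i : ι) : SuppOn {i} (oneProj i) := by
  rw [suppOn_iff]
  constructor
  · intro x y hxy j _
    by_contra hne
    refine hxy ?_
    rw [oneProj, diagonal_apply_ne]
    rintro rfl
    exact hne rfl
  · intro x y u hu
    have hu : u i = 0 := hu i rfl
    simp only [oneProj, diagonal_apply, add_left_inj, Pi.add_apply, hu, add_zero]

theorem nsq_oneProj_mulVec (i : ι) (v : (ι → ZMod 2) → ℂ) :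
    nsq (oneProj i *ᵥ v) = ∑ x, if x i = 1 then Complex.normSq (v x) else 0 := by
  rw [nsq, oneProj]
  refine sum_congr rfl fun x _ => ?_
  rw [mulVec_diagonal]
  split_ifs <;> simp

theorem nsq_oneProj_le (i : ι) (v : (ι → ZMod 2) → ℂ) : nsq (oneProj i *ᵥ v) ≤ nsq v := by
  rw [nsq_oneProj_mulVec]
  refine sum_le_sum fun x _ => ?_
  split_ifs
  · exact le_rfl
  · exact Complex.normSq_nonneg _

/-- The union bound for the event that all qubits are `0`. -/
theorem nsq_sub_sum_le_normSq (v : (ι → ZMod 2) → ℂ) :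
    nsq v - ∑ i, nsq (oneProj i *ᵥ v) ≤ Complex.normSq (v 0) := by
  simp only [nsq_oneProj_mulVec]
  rw [sum_comm, sub_le_iff_le_add, nsq]
  have h : Complex.normSq (v 0) = ∑ x, if x = 0 then Complex.normSq (v x) else 0 := by simp
  rw [h, ← sum_add_distrib]
  refine sum_le_sum fun x _ => ?_
  by_cases hx : x = 0
  · rw [if_pos hx]
    exact le_add_of_nonneg_right (sum_nonneg fun i _ => by
      split_ifs; exacts [Complex.normSq_nonneg _, le_rfl])
  · rw [if_neg hx, zero_add]
    obtain ⟨i, hi⟩ := Function.ne_iff.1 hx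
    have hi1 : x i = 1 := (zmod_two_cases _).resolve_left hi
    have := single_le_sum (f := fun i => if x i = 1 then Complex.normSq (v x) else 0)
      (fun i _ => by split_ifs; exacts [Complex.normSq_nonneg _, le_rfl]) (mem_univ i)
    simpa [hi1] using this

/-- Two anticommuting unitaries cannot both almost fix the same basis state. -/
theorem half_le_of_anticommute {A B : Op ι} (hA : Aᴴ * A = 1) (hB : Bᴴ * B = 1)
    (hAB : A * B = -(B * A)) {δ : ℝ} (h1 : 1 - δ ≤ Complex.normSq (A 0 0))
    (h2 : 1 - δ ≤ Complex.normSq (B 0 0)) : 1 / 2 ≤ δ := by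
  -- Columns and rows of a unitary have norm 1, so the entries off the corner in its row and column
  -- have total squared size at most `δ`.
  have col : ∀ A : Op ι, Aᴴ * A = 1 → ∑ z ∈ univ.erase 0, Complex.normSq (A z 0) =
      1 - Complex.normSq (A 0 0) := by
    intro A hA
    have h := congrFun (congrFun hA 0) 0
    rw [mul_apply, one_apply_eq] at h
    simp only [conjTranspose_apply, RCLike.star_def, ← Complex.normSq_eq_conj_mul_self] at h
    have h' : ∑ z, Complex.normSq (A z 0) = 1 := by exact_mod_cast h
    rw [← h', ← add_sum_erase _ _ (mem_univ (0 : ι → ZMod 2))]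
    ring
  have row : ∀ A : Op ι, Aᴴ * A = 1 → ∑ z ∈ univ.erase 0, Complex.normSq (A 0 z) =
      1 - Complex.normSq (A 0 0) := by
    intro A hA
    have h := col Aᴴ (by rw [conjTranspose_conjTranspose]; exact mul_eq_one_comm.1 hA)
    simpa [conjTranspose_apply] using h
  -- The corner of a product is the product of the corners up to `δ`. Anticommutation then forces
  -- the product of the corners to be at most `δ`, although its modulus is at least `1 - δ`.
  have prod : ∀ A B : Op ι, Aᴴ * A = 1 → Bᴴ * B = 1 → 1 - δ ≤ Complex.normSq (A 0 0) →
      1 - δ ≤ Complex.normSq (B 0 0) → ‖(A * B) 0 0 - A 0 0 * B 0 0‖ ≤ δ := by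
    intro A B hA hB h1 h2
    rw [mul_apply, ← add_sum_erase _ _ (mem_univ (0 : ι → ZMod 2)), add_sub_cancel_left]
    have ha := row A hA
    have hb := col B hB
    have hδ : ∀ x : ℂ, Complex.normSq x = ‖x‖ ^ 2 := Complex.normSq_eq_norm_sq
    calc ‖∑ z ∈ univ.erase 0, A 0 z * B z 0‖ ≤ ∑ z ∈ univ.erase 0, ‖A 0 z * B z 0‖ :=
          norm_sum_le _ _
      _ ≤ ∑ z ∈ univ.erase 0, (Complex.normSq (A 0 z) + Complex.normSq (B z 0)) / 2 := by
          refine sum_le_sum fun z _ => ?_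
          rw [norm_mul, hδ, hδ]
          nlinarith [sq_nonneg (‖A 0 z‖ - ‖B z 0‖)]
      _ = (∑ z ∈ univ.erase 0, Complex.normSq (A 0 z) +
            ∑ z ∈ univ.erase 0, Complex.normSq (B z 0)) / 2 := by
          rw [← sum_add_distrib, sum_div]
      _ ≤ δ := by rw [ha, hb]; linarith
  have p1 := prod A B hA hB h1 h2
  have p2 := prod B A hB hA h2 h1
  have e : (A * B) 0 0 = -((B * A) 0 0) := by rw [hAB]; rfl
  have h3 : ‖2 * (A 0 0 * B 0 0)‖ ≤ 2 * δ := by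
    have : 2 * (A 0 0 * B 0 0) = -(((A * B) 0 0 - A 0 0 * B 0 0) +
        ((B * A) 0 0 - B 0 0 * A 0 0)) := by rw [e]; ring
    rw [this, norm_neg]
    exact (norm_add_le _ _).trans (by linarith)
  rw [norm_mul, norm_mul, RCLike.norm_ofNat] at h3
  by_contra! hlt
  have hδ : 0 ≤ δ := by linarith [norm_nonneg (A 0 0 * B 0 0), norm_mul (A 0 0) (B 0 0)]
  rw [Complex.normSq_eq_norm_sq] at h1 h2
  have h4 : (1 - δ) ^ 2 ≤ (‖A 0 0‖ * ‖B 0 0‖) ^ 2 := by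
    rw [mul_pow, sq (1 - δ)]
    exact mul_le_mul h1 h2 (by linarith) (by positivity)
  have h5 : 1 - δ ≤ ‖A 0 0‖ * ‖B 0 0‖ :=
    le_of_sq_le_sq h4 (by positivity)
  linarith

theorem trace_output_mul (U : Circuit ι) (A : Op ι) :
    (U.output * A).trace = star (Circuit.toOp U *ᵥ Pi.single 0 1) ⬝ᵥ
      (A *ᵥ (Circuit.toOp U *ᵥ Pi.single 0 1)) := by
  have h : zeroState = vecMulVec (Pi.single 0 1) (star (Pi.single (0 : ι → ZMod 2) (1 : ℂ))) := by
    ext x y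
    simp only [zeroState, vecMulVec_apply, Pi.star_apply, single_apply, Pi.single_apply]
    by_cases hx : x = 0 <;> by_cases hy : y = 0 <;> simp [hx, hy, eq_comm]
  rw [Circuit.output, h, mul_vecMulVec, vecMulVec_mul, ← star_mulVec, vecMulVec_mul,
    trace_vecMulVec, dotProduct_comm, ← dotProduct_mulVec]

/-- A state that locally looks as if two anticommuting unitaries `X`, `Z` could be moved away from
every small set, except for a small error measured by the projection `B`, is not prepared by a
shallow circuit. -/
theorem half_le_of_local_unitaries (U : Circuit ι) (S : Q ↪ ι) {X Z B : Op Q} {η : ℝ}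
    (hX : Xᴴ * X = 1) (hZ : Zᴴ * Z = 1) (hXZ : X * Z = -(Z * X)) (hB : Bᴴ = B) (hBB : B * B = B)
    (hη : (reducedOp S U.output * B).trace.re ≤ η)
    (hloc : ∀ L, L = X ∨ L = Z → ∀ M : Finset Q, M.card ≤ 2 ^ U.depth →
      ∃ L' : Op Q, L'ᴴ * L' = 1 ∧ SuppOn ((M : Set Q)ᶜ) L' ∧ L * (1 - B) = L' * (1 - B)) :
    1 / 2 ≤ Fintype.card Q * 2 ^ U.depth * (4 * η) := by
  classical
  set V := Circuit.toOp U with hV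
  have hVu : Vᴴ * V = 1 := U.conjTranspose_mul
  have hVu' : V * Vᴴ = 1 := mul_eq_one_comm.1 hVu
  set φ : (ι → ZMod 2) → ℂ := V *ᵥ Pi.single 0 1 with hφ
  have hφ1 : nsq (liftOp S B *ᵥ φ) ≤ η := by
    rw [trace_reducedOp_mul, trace_output_mul, ← hV, ← hφ] at hη
    have h : star φ ⬝ᵥ (liftOp S B *ᵥ φ) = (nsq (liftOp S B *ᵥ φ) : ℂ) := by
      rw [nsq_mulVec, conjTranspose_liftOp, hB, liftOp_mul, hBB]
    rw [h] at hη
    simpa using hη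
  have hη0 : 0 ≤ η := (nsq_nonneg _).trans hφ1
  -- Only qubits of `I` can be disturbed by an operator on the chosen qubits. Counting `I` instead
  -- of all qubits keeps the bound independent of the number of ancillas.
  set I : Finset ι := {i | ∃ q, S q ∈ lightCone U i} with hI
  have hIcard : I.card ≤ Fintype.card Q * 2 ^ U.depth := by
    have : I ⊆ univ.biUnion fun q : Q => {i | S q ∈ lightCone U i} := by
      intro i hi
      simpa [hI] using hi
    exact (card_le_card this).trans
      (card_biUnion_le_card_mul _ _ _ fun q _ => card_lightCone_mem_le U (S q))
  have main : ∀ L, L = X ∨ L = Z → Lᴴ * L = 1 →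
      1 - I.card * (4 * η) ≤ Complex.normSq ((Vᴴ * liftOp S L * V) 0 0) := by
    intro L hL hLu
    have hLl : (liftOp S L)ᴴ * liftOp S L = 1 := by
      rw [conjTranspose_liftOp, liftOp_mul, hLu, liftOp_one]
    set ψ := (Vᴴ * liftOp S L * V) *ᵥ Pi.single 0 1 with hψ
    have hψ0 : ψ 0 = (Vᴴ * liftOp S L * V) 0 0 := by simp [hψ]
    have hiso : (Vᴴ * liftOp S L * V)ᴴ * (Vᴴ * liftOp S L * V) = 1 := by
      rw [Matrix.conjTranspose_mul, Matrix.conjTranspose_mul, conjTranspose_conjTranspose]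
      calc Vᴴ * ((liftOp S L)ᴴ * V) * (Vᴴ * liftOp S L * V)
          = Vᴴ * ((liftOp S L)ᴴ * (V * Vᴴ) * liftOp S L) * V := by simp only [mul_assoc]
        _ = 1 := by rw [hVu', mul_one, hLl, mul_one, hVu]
    have hψ1 : nsq ψ = 1 := by
      rw [hψ, nsq_mulVec_of_isometry hiso]
      simp [nsq, Pi.single_apply, apply_ite]
    -- The test whether qubit `i` is `1`, carried through the circuit, meets the chosen qubits only
    -- in `M`. Replacing `L` by an `L'` that avoids `M` makes the test fail with certainty. The
    -- replacement costs at most `4 η`, since `L` and `L'` differ only through `B`.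
    have hbound : ∀ i, nsq (oneProj i *ᵥ ψ) ≤ if i ∈ I then 4 * η else 0 := by
      intro i
      set M : Finset Q := {q | S q ∈ lightCone U i} with hM
      have hMcard : M.card ≤ 2 ^ U.depth := by
        rw [← card_map S]
        refine (card_le_card ?_).trans (card_lightCone_le U i)
        intro j hj
        obtain ⟨q, hq, rfl⟩ := mem_map.1 hj
        simpa [hM] using hq
      have hP := U.suppOn_conj (suppOn_oneProj i)
      rw [← hV] at hP
      have hcomm : ∀ L', SuppOn ((M : Set Q)ᶜ) L' →
          oneProj i *ᵥ ((Vᴴ * liftOp S L' * V) *ᵥ Pi.single 0 1) = 0 := by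
        intro L' hL'
        have hc : Commute (V * oneProj i * Vᴴ) (liftOp S L') := by
          refine hP.commute (hL'.liftOp S) ?_
          rw [Set.disjoint_left]
          rintro _ hj ⟨q, hq, rfl⟩
          exact hq (by simpa [hM] using hj)
        have h0 : oneProj i *ᵥ (Pi.single (0 : ι → ZMod 2) (1 : ℂ)) = 0 := by
          funext x
          rw [oneProj, mulVec_diagonal, Pi.single_apply]
          by_cases hx : x = 0 <;> simp [hx]
        have h1 : oneProj i * (Vᴴ * liftOp S L' * V) = Vᴴ * liftOp S L' * V * oneProj i := by
          calc oneProj i * (Vᴴ * liftOp S L' * V)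
              = (Vᴴ * V) * oneProj i * (Vᴴ * liftOp S L' * V) := by rw [hVu, one_mul]
            _ = Vᴴ * ((V * oneProj i * Vᴴ) * liftOp S L') * V := by simp only [mul_assoc]
            _ = Vᴴ * (liftOp S L' * (V * oneProj i * Vᴴ)) * V := by rw [hc.eq]
            _ = Vᴴ * liftOp S L' * V * oneProj i * (Vᴴ * V) := by simp only [mul_assoc]
            _ = _ := by rw [hVu, mul_one]
        rw [mulVec_mulVec, h1, ← mulVec_mulVec, h0, mulVec_zero]
      split_ifs with hi
      · obtain ⟨L', hL'u, hL's, hL'B⟩ := hloc L hL M hMcard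
        have hL'l : (liftOp S L')ᴴ * liftOp S L' = 1 := by
          rw [conjTranspose_liftOp, liftOp_mul, hL'u, liftOp_one]
        have hdiff : L - L' = (L - L') * B := by
          have : (L - L') * (1 - B) = 0 := by rw [sub_mul, hL'B, sub_self]
          rw [mul_sub, mul_one, sub_eq_zero] at this
          exact this
        set w := liftOp S B *ᵥ φ with hw
        have hsplit : ψ = (Vᴴ * liftOp S L' * V) *ᵥ Pi.single 0 1 +
            Vᴴ *ᵥ (liftOp S L *ᵥ w - liftOp S L' *ᵥ w) := by
          have h1 : liftOp S L = liftOp S L' + (liftOp S L - liftOp S L') * liftOp S B := by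
            rw [← liftOp_sub, liftOp_mul, ← hdiff, liftOp_sub]; abel
          rw [hψ, ← sub_mulVec, hw, hφ]
          nth_rewrite 1 [h1]
          rw [mul_add, add_mul, add_mulVec]
          simp only [mulVec_mulVec, mul_assoc]
        rw [hsplit, mulVec_add, hcomm L' hL's, zero_add]
        refine (nsq_oneProj_le _ _).trans ?_
        rw [nsq_mulVec_of_isometry (by rw [conjTranspose_conjTranspose]; exact hVu')]
        refine (nsq_sub_le _ _).trans ?_
        rw [nsq_mulVec_of_isometry hLl, nsq_mulVec_of_isometry hL'l]
        linarith
      · have hME : M = ∅ := by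
          rw [Finset.eq_empty_iff_forall_notMem]
          intro q hq
          exact hi (by simp only [hI, mem_filter, mem_univ, true_and]; exact ⟨q, by simpa [hM] using hq⟩)
        have h0 := hcomm L (by rw [hME]; simpa using suppOn_univ L)
        rw [← hψ] at h0
        rw [h0]
        simp [nsq]
    have h1 := nsq_sub_sum_le_normSq ψ
    rw [hψ1, hψ0] at h1
    refine le_trans ?_ h1
    have h2 := sum_le_sum fun i (_ : i ∈ (univ : Finset ι)) => hbound i
    rw [← sum_filter, sum_const, nsmul_eq_mul] at h2
    have h3 : ({i ∈ (univ : Finset ι) | i ∈ I}) = I := by ext; simp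
    rw [h3] at h2
    linarith
  have hXl : ∀ L : Op Q, Lᴴ * L = 1 → (Vᴴ * liftOp S L * V)ᴴ * (Vᴴ * liftOp S L * V) = 1 := by
    intro L hL
    rw [Matrix.conjTranspose_mul, Matrix.conjTranspose_mul, conjTranspose_conjTranspose]
    calc Vᴴ * ((liftOp S L)ᴴ * V) * (Vᴴ * liftOp S L * V)
        = Vᴴ * ((liftOp S L)ᴴ * (V * Vᴴ) * liftOp S L) * V := by simp only [mul_assoc]
      _ = 1 := by
          rw [hVu', mul_one, conjTranspose_liftOp, liftOp_mul, hL, liftOp_one, mul_one, hVu]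
  have hprod : ∀ L L' : Op Q, (Vᴴ * liftOp S L * V) * (Vᴴ * liftOp S L' * V) =
      Vᴴ * liftOp S (L * L') * V := by
    intro L L'
    calc (Vᴴ * liftOp S L * V) * (Vᴴ * liftOp S L' * V)
        = Vᴴ * liftOp S L * (V * Vᴴ) * liftOp S L' * V := by simp only [mul_assoc]
      _ = _ := by rw [hVu', mul_one, mul_assoc Vᴴ, liftOp_mul]
  have hanti : (Vᴴ * liftOp S X * V) * (Vᴴ * liftOp S Z * V) =
      -((Vᴴ * liftOp S Z * V) * (Vᴴ * liftOp S X * V)) := by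
    rw [hprod, hprod, hXZ, ← neg_one_smul ℂ (Z * X), liftOp_smul, mul_smul_comm, smul_mul_assoc,
      neg_one_smul]
  have hfin := half_le_of_anticommute (hXl X hX) (hXl Z hZ) hanti (main X (.inl rfl) hX)
    (main Z (.inr rfl) hZ)
  refine hfin.trans ?_
  have : (I.card : ℝ) ≤ Fintype.card Q * 2 ^ U.depth := by exact_mod_cast hIcard
  gcongr

end

section

variable {Q I κ : Type} [Fintype Q] [DecidableEq Q] [Fintype I] [DecidableEq I] [Fintype κ]

/-! ### Functions of the syndrome of a stabilizer code -/

/-- The product of the checks `C i` with `T i = 1`. -/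
def comb (C : I → Pauli Q) (T : I → ZMod 2) : Pauli Q := ∑ i, T i • C i

/-- The syndrome of a Pauli error. -/
def syn (C : I → Pauli Q) (P : Pauli Q) : I → ZMod 2 := fun i => symp (C i) P

theorem comb_add (C : I → Pauli Q) (T T' : I → ZMod 2) :
    comb C (T + T') = comb C T + comb C T' := by
  simp [comb, add_smul, sum_add_distrib]

theorem comb_single (C : I → Pauli Q) (i : I) : comb C (Pi.single i 1) = C i := by
  rw [comb, sum_eq_single i]
  · simp
  · intro j _ hj; simp [hj]
  · simp

theorem comb_fst (C : I → Pauli Q) (T : I → ZMod 2) : (comb C T).1 = ∑ i, T i • (C i).1 := by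
  simp [comb, Prod.fst_sum]

theorem comb_snd (C : I → Pauli Q) (T : I → ZMod 2) : (comb C T).2 = ∑ i, T i • (C i).2 := by
  simp [comb, Prod.snd_sum]

theorem symp_comb (C : I → Pauli Q) (T : I → ZMod 2) (P : Pauli Q) :
    symp (comb C T) P = T ⬝ᵥ syn C P := by
  rw [symp, comb_fst, comb_snd, sum_dotProduct, sum_dotProduct, ← sum_add_distrib]
  refine sum_congr rfl fun i _ => ?_
  rw [smul_dotProduct, smul_dotProduct, syn, symp, smul_eq_mul, smul_eq_mul, mul_add]

theorem syn_add (C : I → Pauli Q) (P P' : Pauli Q) : syn C (P + P') = syn C P + syn C P' := by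
  funext i; exact symp_add _ _ _

theorem syn_zero (C : I → Pauli Q) : syn C 0 = 0 := by
  funext i; exact symp_zero _

/-- The checks are products `X ^ a * Z ^ b` that commute without phases, as for a code with
checks of types `X` and `Z` only. -/
def Compatible (C : I → Pauli Q) : Prop := ∀ i j, (C i).2 ⬝ᵥ (C j).1 = 0

variable {C : I → Pauli Q}

theorem Compatible.comb (hC : Compatible C) (T T' : I → ZMod 2) :
    (comb C T).2 ⬝ᵥ (comb C T').1 = 0 := by
  rw [comb_fst, comb_snd, sum_dotProduct]
  refine sum_eq_zero fun i _ => ?_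
  rw [dotProduct_sum]
  refine sum_eq_zero fun j _ => ?_
  rw [smul_dotProduct, dotProduct_smul, hC i j, smul_zero, smul_zero]

theorem Compatible.comb_mul (hC : Compatible C) (T T' : I → ZMod 2) :
    (ThermalTQO.comb C T).toOp * (ThermalTQO.comb C T').toOp =
      (ThermalTQO.comb C (T + T')).toOp := by
  rw [Pauli.toOp_mul, hC.comb, sgn_zero, one_smul, comb_add]

/-- The projection on the states with syndrome `s`. -/
def synProj (C : I → Pauli Q) (s : I → ZMod 2) : Op Q :=
  ((2 : ℂ) ^ Fintype.card I)⁻¹ • ∑ T : I → ZMod 2, sgn (s ⬝ᵥ T) • (comb C T).toOp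

theorem Compatible.synProj_mul_comb (hC : Compatible C) (s T : I → ZMod 2) :
    synProj C s * (ThermalTQO.comb C T).toOp = sgn (s ⬝ᵥ T) • synProj C s := by
  rw [synProj, smul_mul_assoc, smul_comm (sgn _), sum_mul]
  congr 1
  rw [smul_sum]
  rw [← Equiv.sum_comp (Equiv.addRight T)
    (fun T' => sgn (s ⬝ᵥ T') • (ThermalTQO.comb C T').toOp * (ThermalTQO.comb C T).toOp)]
  refine sum_congr rfl fun T' _ => ?_
  simp only [Equiv.coe_addRight]
  rw [smul_mul_assoc, hC.comb_mul, add_assoc, pi_add_self, add_zero, dotProduct_add, sgn_add,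
    smul_smul, mul_comm]

theorem sum_synProj (C : I → Pauli Q) : ∑ s, synProj C s = 1 := by
  have h2 : ((2 : ℂ) ^ Fintype.card I) ≠ 0 := pow_ne_zero _ two_ne_zero
  simp only [synProj]
  rw [← smul_sum, sum_comm]
  simp only [← sum_smul, dotProduct_comm (_ : I → ZMod 2), sum_sgn_dotProduct, ite_smul, zero_smul,
    sum_ite_eq', mem_univ, if_true, smul_smul]
  simp [comb, Pauli.toOp_zero, h2]

theorem Compatible.synProj_mul (hC : Compatible C) (s s' : I → ZMod 2) :
    synProj C s * synProj C s' = if s = s' then synProj C s else 0 := by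
  have h2 : ((2 : ℂ) ^ Fintype.card I) ≠ 0 := pow_ne_zero _ two_ne_zero
  nth_rewrite 2 [synProj]
  rw [mul_smul_comm, mul_sum]
  simp only [mul_smul_comm, hC.synProj_mul_comb, smul_smul, ← sgn_add, ← add_dotProduct]
  rw [← sum_smul, sum_sgn_dotProduct, smul_smul]
  have h : s' + s = 0 ↔ s = s' := by
    constructor
    · intro h
      funext i
      exact (CharTwo.add_eq_zero.1 (congrFun h i)).symm
    · rintro rfl; exact pi_add_self _
  simp only [h]
  split_ifs <;> simp [h2]

/-- The algebra homomorphism that sends a function of the syndrome to the corresponding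
operator. -/
def fc (hC : Compatible C) : ((I → ZMod 2) → ℂ) →ₐ[ℂ] Op Q :=
  AlgHom.ofLinearMap
    { toFun := fun f => ∑ s, f s • synProj C s
      map_add' := fun f g => by simp [add_smul, sum_add_distrib]
      map_smul' := fun c f => by simp [smul_sum, smul_smul] }
    (by simpa using sum_synProj C)
    (fun f g => by
      simp only [LinearMap.coe_mk, AddHom.coe_mk, Pi.mul_apply]
      rw [sum_mul_sum]
      refine sum_congr rfl fun s _ => ?_
      simp [hC.synProj_mul, smul_smul, mul_comm (g s)])

variable (hC : Compatible C)

theorem fc_apply (f : (I → ZMod 2) → ℂ) : fc hC f = ∑ s, f s • synProj C s := rfl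

theorem fc_comb (T : I → ZMod 2) : fc hC (fun s => sgn (s ⬝ᵥ T)) = (comb C T).toOp := by
  rw [fc_apply]
  simp only [← hC.synProj_mul_comb]
  rw [← sum_mul, sum_synProj, one_mul]

theorem fc_check (i : I) : fc hC (fun s => sgn (s i)) = (C i).toOp := by
  rw [← comb_single C i, ← fc_comb hC]
  simp

theorem conjTranspose_fc (f : (I → ZMod 2) → ℂ) : (fc hC f)ᴴ = fc hC (star f) := by
  have h : ∀ s, (synProj C s)ᴴ = synProj C s := by
    intro s
    rw [synProj, conjTranspose_smul, conjTranspose_sum]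
    congr 1
    · simp
    · refine sum_congr rfl fun T _ => ?_
      rw [conjTranspose_smul, Pauli.conjTranspose_toOp, hC.comb, sgn_zero, one_smul, star_sgn]
  rw [fc_apply, fc_apply, conjTranspose_sum]
  refine sum_congr rfl fun s _ => ?_
  rw [conjTranspose_smul, h]; rfl

/-- A Pauli error translates every syndrome sector by its own syndrome. -/
theorem toOp_mul_synProj (P : Pauli Q) (s : I → ZMod 2) :
    P.toOp * synProj C s = synProj C (s + syn C P) * P.toOp := by
  rw [synProj, synProj, mul_smul_comm, smul_mul_assoc, mul_sum, sum_mul]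
  congr 1
  refine sum_congr rfl fun T _ => ?_
  rw [mul_smul_comm, smul_mul_assoc, Pauli.toOp_mul_comm, smul_smul, symp_comm, symp_comb,
    add_dotProduct, sgn_add, dotProduct_comm T]

theorem toOp_mul_fc (P : Pauli Q) (f : (I → ZMod 2) → ℂ) :
    P.toOp * fc hC f = fc hC (fun s => f (s + syn C P)) * P.toOp := by
  rw [fc_apply, fc_apply, mul_sum, sum_mul,
    ← Equiv.sum_comp (Equiv.addRight (syn C P)) (fun s => P.toOp * f s • synProj C s)]
  refine sum_congr rfl fun s _ => ?_
  simp only [Equiv.coe_addRight]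
  rw [mul_smul_comm, toOp_mul_synProj, smul_mul_assoc, add_assoc, pi_add_self, add_zero]

/-- In the maximally mixed state the syndrome is distributed as that of a uniformly random Pauli
error. Both sides are character sums: only combinations of checks equal to the identity survive.
Expectations in Gibbs states thereby become classical sums over errors. -/
theorem trace_fc (f : (I → ZMod 2) → ℂ) :
    (fc hC f).trace = ((2 : ℂ) ^ Fintype.card Q)⁻¹ * ∑ P, f (syn C P) := by
  have h2 : ∀ k : ℕ, ((2 : ℂ) ^ k) ≠ 0 := fun k => pow_ne_zero _ two_ne_zero
  have key : ∀ s, (synProj C s).trace =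
      ((2 : ℂ) ^ Fintype.card Q)⁻¹ * ∑ P, if s = syn C P then 1 else 0 := by
    intro s
    have h3 : ∀ P, (if s = syn C P then (1 : ℂ) else 0) =
        ((2 : ℂ) ^ Fintype.card I)⁻¹ * ∑ T, sgn ((s + syn C P) ⬝ᵥ T) := by
      intro P
      rw [sum_sgn_dotProduct]
      have h : s + syn C P = 0 ↔ s = syn C P := by
        constructor
        · intro h
          funext i
          exact CharTwo.add_eq_zero.1 (congrFun h i)
        · rintro rfl; exact pi_add_self _
      simp only [h]
      split_ifs <;> simp [h2]
    simp only [h3]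
    rw [← mul_sum, sum_comm, synProj, trace_smul, trace_sum, smul_eq_mul, mul_left_comm]
    congr 1
    rw [mul_sum]
    refine sum_congr rfl fun T _ => ?_
    simp only [add_dotProduct, sgn_add, dotProduct_comm (syn C _), ← symp_comb]
    rw [← mul_sum, sum_sgn_symp, trace_smul, Pauli.trace_toOp, smul_eq_mul]
    split_ifs
    · have : (4 : ℂ) = 2 * 2 := by norm_num
      rw [this, mul_pow]
      field_simp [h2]
    · simp
  rw [fc_apply, trace_sum]
  simp only [trace_smul, key, smul_eq_mul, mul_left_comm (f _)]
  rw [← mul_sum]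
  congr 1
  simp only [mul_sum]
  rw [sum_comm]
  simp

/-- A function that does not depend on the checks touching `M` gives an operator supported away
from `M`. -/
theorem suppOn_fc {M : Set Q} {f : (I → ZMod 2) → ℂ}
    (hf : ∀ s s', (∀ i, (C i).VanishesOn M → s i = s' i) → f s = f s') :
    SuppOn Mᶜ (fc hC f) := by
  intro P hP
  rw [commute_iff_eq, toOp_mul_fc]
  congr 2
  funext s
  refine hf _ _ fun i hi => ?_
  have : syn C P i = 0 := by
    rw [syn, symp_eq_sum]
    refine sum_eq_zero fun q _ => ?_
    by_cases hq : q ∈ M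
    · simp [hi q hq]
    · simp [hP q hq]
  rw [Pi.add_apply, this, add_zero]

open scoped Norms.Operator in
theorem exp_fc (f : (I → ZMod 2) → ℂ) :
    NormedSpace.exp (fc hC f) = fc hC (fun s => Complex.exp (f s)) := by
  have h := NormedSpace.map_exp (fc hC)
    (LinearMap.continuous_of_finiteDimensional (fc hC).toLinearMap) f
  refine h.symm.trans ?_
  rw [Pi.exp_def]
  simp only [Complex.exp_eq_exp_ℂ]

/-! ### Thermal states of Hamiltonians whose terms are functions of the syndrome -/

theorem hamiltonian_fc {h : κ → Op Q} {g : κ → (I → ZMod 2) → ℝ}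
    (hg : ∀ t, h t = fc hC (fun s => (g t s : ℂ))) :
    hamiltonian h = fc hC (fun s => ((∑ t, g t s : ℝ) : ℂ)) := by
  rw [hamiltonian]
  simp only [hg, ← map_sum]
  congr 1
  funext s
  simp

/-- The Gibbs expectation of a function of the syndrome. -/
theorem trace_gibbsState_mul_fc {h : κ → Op Q} {g : κ → (I → ZMod 2) → ℝ}
    (hg : ∀ t, h t = fc hC (fun s => (g t s : ℂ))) (β : ℝ) (f : (I → ZMod 2) → ℝ) :
    (gibbsState h β * fc hC (fun s => (f s : ℂ))).trace =
      (((∑ P, Real.exp (-(β * ((Fintype.card κ / Fintype.card Q : ℝ)⁻¹ *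
          ∑ t, g t (syn C P)))) * f (syn C P)) /
        ∑ P, Real.exp (-(β * ((Fintype.card κ / Fintype.card Q : ℝ)⁻¹ *
          ∑ t, g t (syn C P)))) : ℝ) : ℂ) := by
  set μ : ℝ := (Fintype.card κ / Fintype.card Q : ℝ)⁻¹ with hμ
  have h1 : -(β • scaledHamiltonian h) =
      fc hC (fun s => ((-(β * (μ * ∑ t, g t s)) : ℝ) : ℂ)) := by
    rw [scaledHamiltonian, hamiltonian_fc hC hg, ← hμ]
    have h2 : ∀ (r : ℝ) (A : Op Q), r • A = (r : ℂ) • A := fun r A => by ext; simp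
    rw [h2, h2, ← map_smul, ← map_smul, ← map_neg]
    congr 1
    funext s
    simp
  rw [gibbsState, h1, exp_fc, smul_mul_assoc, ← map_mul, trace_smul, trace_fc, trace_fc,
    smul_eq_mul]
  have h2 : ((2 : ℂ) ^ Fintype.card Q) ≠ 0 := pow_ne_zero _ two_ne_zero
  rw [mul_inv, inv_inv, mul_mul_mul_comm, mul_inv_cancel₀ h2, one_mul]
  simp only [Pi.mul_apply, ← Complex.ofReal_exp, ← Complex.ofReal_mul, ← Complex.ofReal_sum]
  rw [← Complex.ofReal_inv, ← Complex.ofReal_mul, inv_mul_eq_div]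

/-- A function that vanishes wherever the energy does is a multiple of the energy, and the
Hamiltonian annihilates `ρ`. -/
theorem trace_groundState_mul_fc {h : κ → Op Q} {g : κ → (I → ZMod 2) → ℝ}
    (hg : ∀ t, h t = fc hC (fun s => (g t s : ℂ))) {ρ : Op Q} (hρ : hamiltonian h * ρ = 0)
    {f : (I → ZMod 2) → ℝ} (hf : ∀ s, ∑ t, g t s = 0 → f s = 0) :
    (ρ * fc hC (fun s => (f s : ℂ))).trace = 0 := by
  have h1 : fc hC (fun s => (f s : ℂ)) =
      fc hC (fun s => ((f s / ∑ t, g t s : ℝ) : ℂ)) * hamiltonian h := by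
    rw [hamiltonian_fc hC hg, ← map_mul]
    congr 1
    funext s
    simp only [Pi.mul_apply, ← Complex.ofReal_mul]
    congr 1
    by_cases h0 : ∑ t, g t s = 0
    · rw [h0, hf s h0]; simp
    · field_simp
  rw [trace_mul_comm, h1, mul_assoc, hρ, mul_zero, trace_zero]

/-! ### The trace norm -/

theorem norm_dotProduct_le {α : Type*} [Fintype α] (v w : α → ℂ) :
    ‖star v ⬝ᵥ w‖ ≤ Real.sqrt (nsq v) * Real.sqrt (nsq w) := by
  simp only [dotProduct, nsq, Complex.normSq_eq_norm_sq]
  refine (norm_sum_le _ _).trans ?_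
  simp only [norm_mul, Pi.star_apply, norm_star]
  exact Real.sum_mul_le_sqrt_mul_sqrt _ _ _

/-- In an orthonormal eigenbasis of `Mᴴ * M` the vectors `M v` have the singular values as norms,
while the projection `B` does not lengthen `v`; Cauchy–Schwarz is applied to each basis vector. -/
theorem norm_trace_mul_le_traceNorm (M : Op Q) {B : Op Q} (hB : Bᴴ = B) (hBB : B * B = B) :
    ‖(M * B).trace‖ ≤ traceNorm M := by
  set hM := isHermitian_conjTranspose_mul_self M with hhM
  set V : Op Q := (hM.eigenvectorUnitary : Op Q) with hV
  have hVV : Vᴴ * V = 1 := Unitary.coe_star_mul_self hM.eigenvectorUnitary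
  have hVV' : V * Vᴴ = 1 := mul_eq_one_comm.1 hVV
  have h1 : (M * B).trace = ∑ x, star (B *ᵥ (V *ᵥ Pi.single x 1)) ⬝ᵥ
      (M *ᵥ (V *ᵥ Pi.single x 1)) := by
    have h2 : (M * B).trace = (Vᴴ * (B * M) * V).trace := by
      rw [trace_mul_comm, trace_mul_comm (Vᴴ * (B * M)), ← mul_assoc, hVV', one_mul]
    rw [h2, trace]
    refine sum_congr rfl fun x _ => ?_
    rw [star_mulVec, star_mulVec, ← dotProduct_mulVec, ← dotProduct_mulVec, hB]
    rw [mulVec_mulVec, mulVec_mulVec, mulVec_mulVec]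
    simp [mul_assoc]
  rw [h1, traceNorm]
  refine (norm_sum_le _ _).trans (sum_le_sum fun x _ => ?_)
  have h3 : nsq (M *ᵥ (V *ᵥ Pi.single x 1)) = hM.eigenvalues x := by
    have h4 : (nsq (M *ᵥ (V *ᵥ Pi.single x 1)) : ℂ) = hM.eigenvalues x := by
      rw [nsq_mulVec, star_mulVec, ← dotProduct_mulVec, mulVec_mulVec, mulVec_mulVec]
      have h5 := hM.conjStarAlgAut_star_eigenvectorUnitary
      rw [Unitary.conjStarAlgAut_star_apply] at h5
      have h6 : Vᴴ * (Mᴴ * M) * V = diagonal (RCLike.ofReal ∘ hM.eigenvalues) := h5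
      rw [h6]
      simp
    exact_mod_cast h4
  have h7 : nsq (B *ᵥ (V *ᵥ Pi.single x 1)) ≤ 1 := by
    have h8 : nsq (V *ᵥ Pi.single x 1) = 1 := by
      rw [nsq_mulVec_of_isometry hVV]
      simp [nsq, Pi.single_apply, apply_ite]
    set u := V *ᵥ Pi.single x (1 : ℂ)
    have h9 : (nsq (B *ᵥ u) : ℂ) + nsq ((1 - B) *ᵥ u) = nsq u := by
      rw [nsq_mulVec, nsq_mulVec, nsq_eq, ← dotProduct_add, ← add_mulVec, conjTranspose_sub,
        conjTranspose_one, hB, hBB]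
      have : B + (1 - B) * (1 - B) = 1 := by
        rw [sub_mul, mul_sub, mul_sub, hBB]; simp
      rw [this, one_mulVec]
    have h10 : nsq (B *ᵥ u) + nsq ((1 - B) *ᵥ u) = nsq u := by exact_mod_cast h9
    linarith [nsq_nonneg ((1 - B) *ᵥ u)]
  refine (norm_dotProduct_le _ _).trans ?_
  rw [h3]
  have : Real.sqrt (nsq (B *ᵥ (V *ᵥ Pi.single x 1))) ≤ 1 := by
    rw [Real.sqrt_le_one]; exact h7
  exact mul_le_of_le_one_left (Real.sqrt_nonneg _) this

theorem re_trace_mul_le {ρ σ B : Op Q} (hB : Bᴴ = B) (hBB : B * B = B) :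
    (ρ * B).trace.re ≤ (σ * B).trace.re + 2 * traceDist ρ σ := by
  have h := norm_trace_mul_le_traceNorm (ρ - σ) hB hBB
  rw [sub_mul, trace_sub] at h
  have h2 := (Complex.re_le_norm _).trans h
  rw [Complex.sub_re] at h2
  rw [traceDist]
  linarith

end

section

variable {Q I κ : Type} [Fintype Q] [DecidableEq Q] [Fintype I] [DecidableEq I] [Fintype κ]

/-! ### Clusters of errors -/

/-- The qubits on which a Pauli operator is not the identity. -/
def pauliSupp (P : Pauli Q) : Finset Q := {q | P.1 q ≠ 0 ∨ P.2 q ≠ 0}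

theorem mem_pauliSupp {P : Pauli Q} {q : Q} : q ∈ pauliSupp P ↔ P.1 q ≠ 0 ∨ P.2 q ≠ 0 := by
  simp [pauliSupp]

theorem notMem_pauliSupp {P : Pauli Q} {q : Q} : q ∉ pauliSupp P ↔ P.1 q = 0 ∧ P.2 q = 0 := by
  rw [mem_pauliSupp]; push Not; rfl

theorem weight_eq (P : Pauli Q) : P.weight = (pauliSupp P).card := by
  rw [Pauli.weight, Set.ncard_eq_toFinset_card']; congr 1; ext; simp [pauliSupp]

def restrict (P : Pauli Q) (J : Finset Q) : Pauli Q :=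
  (fun q => if q ∈ J then P.1 q else 0, fun q => if q ∈ J then P.2 q else 0)

theorem pauliSupp_restrict (P : Pauli Q) (J : Finset Q) :
    pauliSupp (restrict P J) = J ∩ pauliSupp P := by
  ext q
  simp only [mem_pauliSupp, restrict, mem_inter]
  by_cases h : q ∈ J <;> simp [h]

theorem restrict_add_restrict_compl (P : Pauli Q) (J : Finset Q) :
    restrict P J + restrict P Jᶜ = P := by
  refine Prod.ext (funext fun q => ?_) (funext fun q => ?_) <;>
  · simp only [restrict, Prod.fst_add, Prod.snd_add, Pi.add_apply, mem_compl]
    by_cases h : q ∈ J <;> simp [h]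

theorem card_pauliSupp_restrict (P : Pauli Q) (J : Finset Q) :
    (pauliSupp (restrict P J)).card + (pauliSupp (restrict P Jᶜ)).card = (pauliSupp P).card := by
  rw [pauliSupp_restrict, pauliSupp_restrict, ← card_inter_add_card_sdiff (pauliSupp P) J,
    inter_comm, inter_comm Jᶜ, ← sdiff_eq_inter_compl]

theorem card_pauliSupp_add_le (P P' : Pauli Q) :
    (pauliSupp (P + P')).card ≤ (pauliSupp P).card + (pauliSupp P').card := by
  refine (card_le_card ?_).trans (card_union_le _ _)
  intro q
  contrapose!
  rw [mem_union, not_or, notMem_pauliSupp, notMem_pauliSupp, notMem_pauliSupp]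
  rintro ⟨⟨h1, h2⟩, h3, h4⟩
  simp [h1, h2, h3, h4]

theorem symp_restrict (L P : Pauli Q) (J : Finset Q) :
    symp L (restrict P J) = ∑ q ∈ J, (L.1 q * P.2 q + L.2 q * P.1 q) := by
  rw [symp_eq_sum, ← sum_filter_add_sum_filter_not univ (· ∈ J)]
  rw [sum_eq_zero (s := univ.filter fun q => q ∉ J), add_zero]
  · rw [filter_mem_eq_inter, univ_inter]
    exact sum_congr rfl fun q hq => by simp [restrict, hq]
  · intro q hq
    have : q ∉ J := by simpa using hq
    simp [restrict, this]

/-- Two qubits are linked if they are equal or act in a common term; the term `t` is built from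
the checks in `K t`. -/
def Linked (C : I → Pauli Q) (K : κ → Finset I) (q q' : Q) : Prop :=
  q = q' ∨ ∃ t, ∃ i ∈ K t, ∃ i' ∈ K t, q ∈ pauliSupp (C i) ∧ q' ∈ pauliSupp (C i')

theorem Linked.symm {C : I → Pauli Q} {K : κ → Finset I} {q q' : Q} (h : Linked C K q q') :
    Linked C K q' q := by
  rcases h with h | ⟨t, i, hi, i', hi', h, h'⟩
  · exact Or.inl h.symm
  · exact Or.inr ⟨t, i', hi', i, hi, h', h⟩

open Classical in
/-- The number of violated terms. -/
def energy (K : κ → Finset I) (s : I → ZMod 2) : ℝ := ∑ t, if ∃ i ∈ K t, s i ≠ 0 then 1 else 0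

variable {C : I → Pauli Q} {K : κ → Finset I}

theorem mem_pauliSupp_of_syn_ne_zero {i : I} {P : Pauli Q} (h : syn C P i ≠ 0) :
    ∃ q ∈ pauliSupp P, q ∈ pauliSupp (C i) := by
  rw [syn, symp_eq_sum] at h
  obtain ⟨q, -, hq⟩ := exists_ne_zero_of_sum_ne_zero h
  refine ⟨q, ?_, ?_⟩ <;>
  · by_contra hn
    rw [notMem_pauliSupp] at hn
    exact hq (by simp [hn.1, hn.2])

/-- A term violated by both errors would link a qubit of one to a qubit of the other. -/
theorem energy_add {e r : Pauli Q}
    (h : ∀ q ∈ pauliSupp e, ∀ q' ∈ pauliSupp r, ¬ Linked C K q q') :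
    energy K (syn C (e + r)) = energy K (syn C e) + energy K (syn C r) := by
  rw [energy, energy, energy, ← sum_add_distrib]
  refine sum_congr rfl fun t _ => ?_
  rw [syn_add]
  by_cases he : ∃ i ∈ K t, syn C e i ≠ 0
  · have hr : ∀ i ∈ K t, syn C r i = 0 := by
      intro i hi
      by_contra hne
      obtain ⟨i', hi', hne'⟩ := he
      obtain ⟨q, h1, h2⟩ := mem_pauliSupp_of_syn_ne_zero hne'
      obtain ⟨q', h3, h4⟩ := mem_pauliSupp_of_syn_ne_zero hne
      exact h q h1 q' h3 (Or.inr ⟨t, i', hi', i, hi, h2, h4⟩)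
    have hr' : ¬ ∃ i ∈ K t, syn C r i ≠ 0 := by push Not; exact hr
    have her : ∃ i ∈ K t, (syn C e + syn C r) i ≠ 0 := by
      obtain ⟨i', hi', hne'⟩ := he
      exact ⟨i', hi', by rw [Pi.add_apply, hr i' hi', add_zero]; exact hne'⟩
    rw [if_pos her, if_pos he, if_neg hr', add_zero]
  · have he' : ∀ i ∈ K t, syn C e i = 0 := by push Not at he; exact he
    rw [if_neg he, zero_add]
    have : (∃ i ∈ K t, (syn C e + syn C r) i ≠ 0) ↔ ∃ i ∈ K t, syn C r i ≠ 0 := by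
      refine exists_congr fun i => and_congr_right fun hi => ?_
      rw [Pi.add_apply, he' i hi, zero_add]
    simp only [this]

/-! ### Minimal errors and their connected components -/

/-- An error of minimal weight among those with the same syndrome. -/
def IsMin (C : I → Pauli Q) (E : Pauli Q) : Prop :=
  ∀ E', syn C E' = syn C E → (pauliSupp E).card ≤ (pauliSupp E').card

theorem exists_isMin (C : I → Pauli Q) (P : Pauli Q) : ∃ E, syn C E = syn C P ∧ IsMin C E := by
  obtain ⟨E, hE, h⟩ := exists_min_image ({E | syn C E = syn C P} : Finset (Pauli Q))
    (fun E => (pauliSupp E).card) ⟨P, by simp⟩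
  simp only [mem_filter, mem_univ, true_and] at hE h
  exact ⟨E, hE, fun E' hE' => h E' (hE'.trans hE)⟩

open Classical in
/-- A minimal error with the given syndrome. -/
def dec (C : I → Pauli Q) (s : I → ZMod 2) : Pauli Q :=
  if h : ∃ E, syn C E = s ∧ IsMin C E then h.choose else 0

theorem dec_spec (C : I → Pauli Q) (P : Pauli Q) :
    syn C (dec C (syn C P)) = syn C P ∧ IsMin C (dec C (syn C P)) := by
  rw [dec, dif_pos (exists_isMin C P)]
  exact (exists_isMin C P).choose_spec

/-- A cheaper error with the syndrome of the piece could be substituted for it in `E`. -/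
theorem IsMin.restrict {E : Pauli Q} (h : IsMin C E) (J : Finset Q) : IsMin C (restrict E J) := by
  intro E' hE'
  have h1 := h (E' + ThermalTQO.restrict E Jᶜ) (by
    rw [syn_add, hE', ← syn_add, restrict_add_restrict_compl])
  have h2 := card_pauliSupp_add_le E' (ThermalTQO.restrict E Jᶜ)
  have h3 := card_pauliSupp_restrict E J
  omega

/-- There is a connected set of at least `w` qubits that is at least half covered by an isolated
part of the error. The connected set is given as the range of a walk. -/
def IsBad (C : I → Pauli Q) (K : κ → Finset I) (w : ℕ) (E : Pauli Q) : Prop :=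
  ∃ l : List Q, l.IsChain (Linked C K) ∧ w ≤ l.toFinset.card ∧
    l.length + 1 = 2 * l.toFinset.card ∧ l.toFinset.card ≤ 2 * (l.toFinset ∩ pauliSupp E).card ∧
    ∀ q ∈ l.toFinset ∩ pauliSupp E, ∀ q' ∈ pauliSupp E \ l.toFinset, ¬ Linked C K q q'

open Classical in
def nbr (C : I → Pauli Q) (K : κ → Finset I) (q : Q) : Finset Q := {q' | Linked C K q q'}

theorem mem_nbr {q q' : Q} : q' ∈ nbr C K q ↔ Linked C K q q' := by simp [nbr]

/-- The closed neighbourhood of a set of qubits. -/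
def nbhd (C : I → Pauli Q) (K : κ → Finset I) (A : Finset Q) : Finset Q := A.biUnion (nbr C K)

theorem subset_nbhd (A : Finset Q) : A ⊆ nbhd C K A := fun q hq =>
  mem_biUnion.2 ⟨q, hq, mem_nbr.2 (Or.inl rfl)⟩

theorem subset_iterate_nbhd (k : ℕ) (A : Finset Q) : A ⊆ (nbhd C K)^[k] A := by
  induction k with
  | zero => exact subset_rfl
  | succ k ih => rw [Function.iterate_succ_apply']; exact ih.trans (subset_nbhd _)

theorem iterate_nbhd_mono {k k' : ℕ} (h : k ≤ k') (A : Finset Q) :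
    (nbhd C K)^[k] A ⊆ (nbhd C K)^[k'] A := by
  obtain ⟨r, rfl⟩ := Nat.exists_eq_add_of_le h
  rw [add_comm, Function.iterate_add_apply]
  exact subset_iterate_nbhd r _

theorem card_iterate_nbhd_le {D : ℕ} (hD : ∀ q, (nbr C K q).card ≤ D) (k : ℕ) (A : Finset Q) :
    ((nbhd C K)^[k] A).card ≤ D ^ k * A.card := by
  induction k with
  | zero => simp
  | succ k ih =>
    rw [Function.iterate_succ_apply']
    refine (card_biUnion_le_card_mul _ _ D fun q _ => hD q).trans ?_
    calc _ ≤ D ^ k * A.card * D := Nat.mul_le_mul_right _ ih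
      _ = _ := by ring

theorem mem_iterate_nbhd_of_isChain {l : List Q} {a : Q} (h : (a :: l).IsChain (Linked C K))
    {A : Finset Q} (ha : a ∈ A) : ∀ b ∈ a :: l, b ∈ (nbhd C K)^[l.length] A := by
  induction l generalizing a A with
  | nil => intro b hb; simp at hb; simpa [hb]
  | cons c l ih =>
    rw [List.isChain_cons_cons] at h
    intro b hb
    rcases List.mem_cons.1 hb with rfl | hb
    · exact subset_iterate_nbhd _ _ ha
    · exact ih h.2 (mem_biUnion.2 ⟨a, ha, mem_nbr.2 h.1⟩) b hb

open Classical in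
/-- The connected component of `q` in `V`. -/
def component (C : I → Pauli Q) (K : κ → Finset I) (V : Finset Q) (q : Q) : Finset Q :=
  {q' ∈ V | Relation.ReflTransGen (fun a b => a ∈ V ∧ b ∈ V ∧ Linked C K a b) q q'}

theorem mem_component {V : Finset Q} {q q' : Q} : q' ∈ component C K V q ↔
    q' ∈ V ∧ Relation.ReflTransGen (fun a b => a ∈ V ∧ b ∈ V ∧ Linked C K a b) q q' := by
  simp [component]

theorem self_mem_component {V : Finset Q} {q : Q} (h : q ∈ V) : q ∈ component C K V q :=
  mem_component.2 ⟨h, .refl⟩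

theorem component_subset (V : Finset Q) (q : Q) : component C K V q ⊆ V :=
  fun _ h => (mem_component.1 h).1

theorem component_closed {V : Finset Q} {q a b : Q} (ha : a ∈ component C K V q) (hb : b ∈ V)
    (h : Linked C K a b) : b ∈ component C K V q := by
  rw [mem_component] at ha ⊢
  exact ⟨hb, ha.2.tail ⟨ha.1, hb, h⟩⟩

theorem component_eq {V : Finset Q} {q q' : Q} (h : q' ∈ component C K V q) :
    component C K V q' = component C K V q := by
  have hs : Std.Symm (fun a b => a ∈ V ∧ b ∈ V ∧ Linked C K a b) :=
    ⟨fun a b h => ⟨h.2.1, h.1, h.2.2.symm⟩⟩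
  rw [mem_component] at h
  have h2 : Relation.ReflTransGen (fun a b => a ∈ V ∧ b ∈ V ∧ Linked C K a b) q' q := by
    have := h.2
    induction this with
    | refl => exact .refl
    | tail _ hab ih => exact .head (hs.symm _ _ hab) (ih ⟨hab.1, by assumption⟩)
  ext x
  rw [mem_component, mem_component]
  exact and_congr_right fun _ => ⟨fun hx => h.2.trans hx, fun hx => h2.trans hx⟩

/-- The walk goes around a spanning tree, so a component of `j` qubits needs `2 j - 1` positions.
Clusters can therefore be counted by counting walks. -/
theorem exists_isChain_component {V : Finset Q} {q : Q} (hq : q ∈ V) :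
    ∃ l : List Q, (q :: l).IsChain (Linked C K) ∧ (q :: l).toFinset = component C K V q ∧
      (q :: l).length + 1 = 2 * (q :: l).toFinset.card := by
  classical
  set G : Finset (Finset Q) := {J | ∃ l : List Q, (q :: l).IsChain (Linked C K) ∧
    (q :: l).toFinset = J ∧ J ⊆ component C K V q ∧ (q :: l).length + 1 = 2 * J.card} with hG
  have hne : G.Nonempty := ⟨{q}, by
    simp only [hG, mem_filter, mem_univ, true_and]
    exact ⟨[], by simp, by simp, by simpa using self_mem_component hq, by simp⟩⟩
  obtain ⟨J, hJ, hmax⟩ := exists_max_image G card hne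
  simp only [hG, mem_filter, mem_univ, true_and] at hJ
  obtain ⟨l, hl, rfl, hsub, hlen⟩ := hJ
  refine ⟨l, hl, ?_, hlen⟩
  refine subset_antisymm hsub fun x hx => ?_
  by_contra hxn
  have step : ∃ u ∈ (q :: l).toFinset, ∃ v ∈ V, v ∉ (q :: l).toFinset ∧ Linked C K u v := by
    rw [mem_component] at hx
    have h1 := hx.2
    clear hx
    by_contra! hno
    refine hxn ?_
    clear hxn
    induction h1 with
    | refl => simp
    | tail _ hab ih =>
      by_contra hn
      exact hno _ ih _ hab.2.1 hn hab.2.2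
  obtain ⟨u, hu, v, hv, hvn, huv⟩ := step
  rw [List.mem_toFinset] at hu
  obtain ⟨A, B, hAB⟩ := List.append_of_mem hu
  -- The detour from `u` to a new vertex `v` and back adds two positions and one vertex, against the
  -- maximality of the range.
  have hchain : (A ++ u :: v :: u :: B).IsChain (Linked C K) := by
    rw [hAB] at hl
    rw [List.isChain_append] at hl ⊢
    refine ⟨hl.1, ?_, ?_⟩
    · rw [List.isChain_cons_cons, List.isChain_cons_cons]
      exact ⟨huv, huv.symm, hl.2.1⟩
    · simpa using hl.2.2
  have hhead : ∃ l', A ++ u :: v :: u :: B = q :: l' := by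
    cases A with
    | nil =>
      simp only [List.nil_append, List.cons.injEq] at hAB ⊢
      exact ⟨_, hAB.1.symm, rfl⟩
    | cons a A =>
      simp only [List.cons_append, List.cons.injEq] at hAB ⊢
      exact ⟨_, hAB.1.symm, rfl⟩
  obtain ⟨l', hl'⟩ := hhead
  have hfin : (q :: l').toFinset = insert v (q :: l).toFinset := by
    rw [← hl', hAB]
    ext y
    simp only [List.mem_toFinset, List.mem_append, List.mem_cons, mem_insert]
    tauto
  have hmem : insert v (q :: l).toFinset ∈ G := by
    simp only [hG, mem_filter, mem_univ, true_and]
    refine ⟨l', hl' ▸ hchain, hfin, ?_, ?_⟩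
    · rw [insert_subset_iff]
      exact ⟨component_closed (hsub (List.mem_toFinset.2 hu)) hv huv, hsub⟩
    · rw [card_insert_of_notMem hvn, ← hl']
      rw [hAB] at hlen
      simp only [List.length_append, List.length_cons] at hlen ⊢
      rw [hAB]
      omega
  have := hmax _ hmem
  rw [card_insert_of_notMem hvn] at this
  omega

/-- Locality of decoding: two errors without large clusters whose syndromes agree away from `M`
cannot be told apart by an operator that vanishes in a neighbourhood of `M`. -/
theorem symp_eq_of_agree {w : ℕ} {M : Finset Q} {E E' L : Pauli Q} (hK : ∀ i, ∃ t, i ∈ K t)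
    (hE : ¬ IsBad C K w E) (hE' : ¬ IsBad C K w E')
    (hagree : ∀ i, (C i).VanishesOn M → syn C E i = syn C E' i)
    (hL : L.VanishesOn ((nbhd C K)^[2 * w + 1] M))
    (hdist : ∀ z, syn C z = 0 → (pauliSupp z).card < w → symp L z = 0) :
    symp L E = symp L E' := by
  set V := pauliSupp E ∪ pauliSupp E' with hV
  set Δ := E + E' with hΔ
  have hΔV : pauliSupp Δ ⊆ V := by
    intro q
    contrapose!
    rw [hV, mem_union, not_or, notMem_pauliSupp, notMem_pauliSupp, notMem_pauliSupp]
    rintro ⟨⟨h1, h2⟩, h3, h4⟩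
    simp [hΔ, h1, h2, h3, h4]
  rw [← CharTwo.add_eq_zero, ← symp_add, ← hΔ]
  -- A component of the union of the two supports is at least half covered by one of them, and that
  -- part is isolated. So a component with `w` or more qubits would make `E` or `E'` bad.
  have hsmall : ∀ q ∈ V, ∃ l : List Q, (q :: l).IsChain (Linked C K) ∧
      (q :: l).toFinset = component C K V q ∧ (q :: l).length + 1 = 2 * (q :: l).toFinset.card ∧
      (component C K V q).card < w := by
    intro q hq
    obtain ⟨l, h1, h2, h3⟩ := exists_isChain_component (C := C) (K := K) hq
    refine ⟨l, h1, h2, h3, ?_⟩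
    by_contra! hw
    have hhalf : (component C K V q).card ≤ 2 * (component C K V q ∩ pauliSupp E).card ∨
        (component C K V q).card ≤ 2 * (component C K V q ∩ pauliSupp E').card := by
      have h4 : component C K V q =
          (component C K V q ∩ pauliSupp E) ∪ (component C K V q ∩ pauliSupp E') := by
        rw [← inter_union_distrib_left, ← hV, inter_eq_left.2 (component_subset V q)]
      have h5 := card_union_le (component C K V q ∩ pauliSupp E)
        (component C K V q ∩ pauliSupp E')
      rw [← h4] at h5
      omega
    have hiso : ∀ F : Pauli Q, pauliSupp F ⊆ V → ∀ a ∈ component C K V q ∩ pauliSupp F,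
        ∀ b ∈ pauliSupp F \ component C K V q, ¬ Linked C K a b := by
      intro F hF a ha b hb hab
      rw [mem_inter] at ha
      rw [mem_sdiff] at hb
      exact hb.2 (component_closed ha.1 (hF hb.1) hab)
    rcases hhalf with h | h
    · exact hE ⟨q :: l, h1, by rw [h2]; exact hw, h3, by rw [h2]; exact h,
        by rw [h2]; exact hiso E subset_union_left⟩
    · exact hE' ⟨q :: l, h1, by rw [h2]; exact hw, h3, by rw [h2]; exact h,
        by rw [h2]; exact hiso E' subset_union_right⟩
  have hcomp : ∀ q ∈ V, symp L (restrict Δ (component C K V q)) = 0 := by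
    intro q hq
    -- A component that meets the neighbourhood of `M` lies within `2 * w + 1` links of `M`, where
    -- `L` is trivial. Any other one touches only checks on which the syndromes agree, so it has
    -- zero syndrome, and it is too light for `L` to detect.
    by_cases hnear : ∃ a ∈ component C K V q, a ∈ nbhd C K M
    · obtain ⟨a, ha, haM⟩ := hnear
      have haV := component_subset V q ha
      obtain ⟨l, h1, h2, h3, h4⟩ := hsmall a haV
      rw [component_eq ha] at h2 h4
      rw [symp_restrict]
      refine sum_eq_zero fun b hb => ?_
      have h5 : b ∈ a :: l := by rw [← List.mem_toFinset, h2]; exact hb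
      have h6 := mem_iterate_nbhd_of_isChain h1 haM b h5
      rw [← Function.iterate_succ_apply] at h6
      have h7 : l.length + 1 ≤ 2 * w + 1 := by
        rw [h2, List.length_cons] at h3
        omega
      have h8 := hL b (iterate_nbhd_mono h7 M h6)
      rw [h8.1, h8.2]; simp
    · push Not at hnear
      refine hdist _ (funext fun i => ?_) ?_
      · by_contra hne
        obtain ⟨a, ha, hai⟩ := mem_pauliSupp_of_syn_ne_zero hne
        rw [pauliSupp_restrict, mem_inter] at ha
        obtain ⟨t, ht⟩ := hK i
        have hfar : (C i).VanishesOn M := by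
          intro m hm
          rw [← notMem_pauliSupp]
          intro hmi
          exact hnear a ha.1 (mem_biUnion.2 ⟨m, hm, mem_nbr.2
            (Or.inr ⟨t, i, ht, i, ht, hmi, hai⟩)⟩)
        have h1 : syn C Δ i = 0 := by
          rw [hΔ, syn_add, Pi.add_apply, hagree i hfar]
          exact CharTwo.add_self_eq_zero _
        have h2 : syn C (restrict Δ (component C K V q)ᶜ) i = 0 := by
          by_contra hne'
          obtain ⟨b, hb, hbi⟩ := mem_pauliSupp_of_syn_ne_zero hne'
          rw [pauliSupp_restrict, mem_inter, mem_compl] at hb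
          exact hb.1 (component_closed ha.1 (hΔV hb.2)
            (Or.inr ⟨t, i, ht, i, ht, hai, hbi⟩))
        have h3 := congrFun (syn_add C (restrict Δ (component C K V q))
          (restrict Δ (component C K V q)ᶜ)) i
        rw [restrict_add_restrict_compl, h1, Pi.add_apply, h2, add_zero] at h3
        exact hne h3.symm
      · rw [pauliSupp_restrict]
        obtain ⟨-, -, -, -, h4⟩ := hsmall q hq
        exact (card_le_card inter_subset_left).trans_lt h4
  have h1 : symp L Δ = symp L (restrict Δ V) := by
    congr 1
    refine Prod.ext (funext fun q => ?_) (funext fun q => ?_) <;>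
    · simp only [restrict]
      split_ifs with h
      · rfl
      · have := notMem_pauliSupp.1 fun h' => h (hΔV h')
        simp [this.1, this.2]
  -- The symplectic form is a sum over qubits, hence over the components.
  rw [h1, symp_restrict, ← sum_fiberwise_of_maps_to (t := V.image (component C K V))
    (fun q hq => mem_image_of_mem _ hq)]
  refine sum_eq_zero fun J hJ => ?_
  obtain ⟨q, hq, rfl⟩ := mem_image.1 hJ
  have h2 : {q' ∈ V | component C K V q' = component C K V q} = component C K V q := by
    ext q'
    rw [mem_filter]
    constructor
    · rintro ⟨h3, h4⟩
      rw [← h4]; exact self_mem_component h3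
    · intro h
      exact ⟨component_subset V q h, component_eq h⟩
  rw [h2, ← symp_restrict]
  exact hcomp q hq

end

section

variable {Q I κ : Type} [Fintype Q] [DecidableEq Q] [Fintype I] [DecidableEq I] [Fintype κ]
variable {C : I → Pauli Q} {K : κ → Finset I}

/-! ### Large clusters are unlikely in thermal states -/

open Classical in
-- The union bound for a nonnegative weight.
theorem sum_filter_le_sum_sum {α β : Type*} [Fintype α] {s : Finset β} {p : α → Prop}
    {r : β → α → Prop} {μ : α → ℝ} (hμ : ∀ a, 0 ≤ μ a) (h : ∀ a, p a → ∃ b ∈ s, r b a) :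
    ∑ a with p a, μ a ≤ ∑ b ∈ s, ∑ a with r b a, μ a := by
  simp only [sum_filter]
  rw [sum_comm]
  refine sum_le_sum fun a _ => ?_
  have h0 : ∀ b ∈ s, 0 ≤ (if r b a then μ a else 0) := fun b _ => by
    split_ifs; exacts [hμ a, le_rfl]
  split_ifs with hp
  · obtain ⟨b, hb, hr⟩ := h a hp
    refine le_trans ?_ (single_le_sum h0 hb)
    rw [if_pos hr]
  · exact sum_nonneg h0

/-- The walks of length `k` that start in `q`. -/
def walks (C : I → Pauli Q) (K : κ → Finset I) : ℕ → Q → Finset (List Q)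
  | 0, q => {[q]}
  | k + 1, q => (nbr C K q).biUnion fun q' => (walks C K k q').image (q :: ·)

theorem card_walks_le {D : ℕ} (hD : ∀ q, (nbr C K q).card ≤ D) (k : ℕ) (q : Q) :
    (walks C K k q).card ≤ D ^ k := by
  induction k generalizing q with
  | zero => simp [walks]
  | succ k ih =>
    rw [walks]
    refine (card_biUnion_le_card_mul _ _ (D ^ k) fun q' _ => card_image_le.trans (ih q')).trans ?_
    rw [pow_succ, mul_comm]
    exact Nat.mul_le_mul_left _ (hD q)

theorem mem_walks {l : List Q} {q : Q} (h : (q :: l).IsChain (Linked C K)) :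
    q :: l ∈ walks C K l.length q := by
  induction l generalizing q with
  | nil => simp [walks]
  | cons a l ih =>
    rw [List.isChain_cons_cons] at h
    rw [List.length_cons, walks, mem_biUnion]
    exact ⟨a, mem_nbr.2 h.1, mem_image_of_mem _ (ih h.2)⟩

/-- The Pauli operators that are the identity outside of `J`. -/
def paulisOn (J : Finset Q) : Finset (Pauli Q) :=
  Fintype.piFinset (fun q => if q ∈ J then univ else {0}) ×ˢ
    Fintype.piFinset (fun q => if q ∈ J then univ else {0})

theorem card_paulisOn (J : Finset Q) : (paulisOn J).card = 4 ^ J.card := by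
  have h : ∏ q, (if q ∈ J then (univ : Finset (ZMod 2)) else {0}).card = 2 ^ J.card := by
    simp only [apply_ite Finset.card, card_univ, ZMod.card, card_singleton]
    rw [prod_ite]
    simp
  rw [paulisOn, card_product, Fintype.card_piFinset, h, ← mul_pow]
  norm_num

theorem restrict_mem_paulisOn (P : Pauli Q) (J : Finset Q) : restrict P J ∈ paulisOn J := by
  simp only [paulisOn, mem_product, Fintype.mem_piFinset, restrict]
  constructor <;>
  · intro q
    split_ifs <;> simp

/-- The Boltzmann weight of an error. -/
def boltz (C : I → Pauli Q) (K : κ → Finset I) (b : ℝ) (P : Pauli Q) : ℝ :=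
  Real.exp (-(b * energy K (syn C P)))

theorem boltz_pos (b : ℝ) (P : Pauli Q) : 0 < boltz C K b P := Real.exp_pos _

/-- The minimal error `dec` of the syndrome of `P` restricts on `J` to `e`, which is isolated and
covers at least half of `J`. -/
def HasPart (C : I → Pauli Q) (K : κ → Finset I) (J : Finset Q) (e P : Pauli Q) : Prop :=
  restrict (dec C (syn C P)) J = e ∧ J.card ≤ 2 * (pauliSupp e).card ∧
    ∀ q ∈ J ∩ pauliSupp (dec C (syn C P)), ∀ q' ∈ pauliSupp (dec C (syn C P)) \ J,
      ¬ Linked C K q q'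

open Classical in
/-- A Peierls argument: the weight of the errors that contain a given isolated part `e`. -/
theorem sum_boltz_hasPart_le {b κ₀ : ℝ} (hb : 0 ≤ b) (hκ : 0 ≤ κ₀)
    (hsound : ∀ e, IsMin C e → κ₀ * (pauliSupp e).card ≤ energy K (syn C e)) (J : Finset Q)
    (e : Pauli Q) :
    ∑ P with HasPart C K J e P, boltz C K b P ≤
      Real.exp (-(b * κ₀ / 2)) ^ J.card * ∑ P, boltz C K b P := by
  -- Removing the part, `P ↦ P + e`, is a bijection of all errors. It lowers the energy by that of
  -- `e`, which soundness bounds below by half of `κ₀` times the size of `J`.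
  rw [← Equiv.sum_comp (Equiv.addRight e) (boltz C K b), mul_sum, sum_filter]
  refine sum_le_sum fun P _ => ?_
  split_ifs with h
  · obtain ⟨rfl, hcard, hiso⟩ := h
    obtain ⟨hs, hmin⟩ := dec_spec C P
    set E := dec C (syn C P) with hE
    have h1 : syn C (P + restrict E J) = syn C (restrict E Jᶜ) := by
      have h2 := syn_add C (restrict E J) (restrict E Jᶜ)
      rw [restrict_add_restrict_compl, hs] at h2
      rw [syn_add, h2, add_comm, ← add_assoc, pi_add_self, zero_add]
    -- Isolation of the part makes the energy additive.
    have h2 : energy K (syn C P) =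
        energy K (syn C (restrict E J)) + energy K (syn C (restrict E Jᶜ)) := by
      rw [← energy_add, restrict_add_restrict_compl, hs]
      intro q hq q' hq'
      rw [pauliSupp_restrict] at hq hq'
      refine hiso q hq q' ?_
      rw [mem_inter, mem_compl] at hq'
      exact mem_sdiff.2 ⟨hq'.2, hq'.1⟩
    have h3 := hsound _ (hmin.restrict J)
    simp only [Equiv.coe_addRight, boltz]
    rw [h1, h2, ← Real.exp_nat_mul, ← Real.exp_add, Real.exp_le_exp]
    have h4 : (J.card : ℝ) ≤ 2 * (pauliSupp (restrict E J)).card := by exact_mod_cast hcard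
    have h5 : κ₀ / 2 * J.card ≤ energy K (syn C (restrict E J)) := by
      refine le_trans ?_ h3
      nlinarith
    have h6 := mul_le_mul_of_nonneg_left h5 hb
    linarith
  · exact mul_nonneg (pow_nonneg (Real.exp_pos _).le _) (boltz_pos _ _).le

/-- The range of the walk `l` has `j` elements and contains such a part. -/
def WalkHasPart (C : I → Pauli Q) (K : κ → Finset I) (j : ℕ) (l : List Q) (P : Pauli Q) : Prop :=
  l.toFinset.card = j ∧ ∃ e ∈ paulisOn l.toFinset, HasPart C K l.toFinset e P

/-- Some walk through `2 * j - 1` qubits from `q` has this property. -/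
def WalkFromHasPart (C : I → Pauli Q) (K : κ → Finset I) (j : ℕ) (q : Q) (P : Pauli Q) : Prop :=
  ∃ l ∈ walks C K (2 * j - 2) q, WalkHasPart C K j l P

/-- Some walk through `2 * j - 1` qubits has this property. -/
def SomeWalkHasPart (C : I → Pauli Q) (K : κ → Finset I) (j : ℕ) (P : Pauli Q) : Prop :=
  ∃ q, WalkFromHasPart C K j q P

open Classical in
theorem sum_boltz_walkHasPart_le {b κ₀ : ℝ} (hb : 0 ≤ b) (hκ : 0 ≤ κ₀)
    (hsound : ∀ e, IsMin C e → κ₀ * (pauliSupp e).card ≤ energy K (syn C e)) (j : ℕ)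
    (l : List Q) :
    ∑ P with WalkHasPart C K j l P, boltz C K b P ≤
      4 ^ j * (Real.exp (-(b * κ₀ / 2)) ^ j * ∑ P, boltz C K b P) := by
  have hZ0 : 0 ≤ ∑ P, boltz C K b P := sum_nonneg fun P _ => (boltz_pos b P).le
  by_cases hlj : l.toFinset.card = j
  · have h1 := sum_filter_le_sum_sum (s := paulisOn l.toFinset) (p := WalkHasPart C K j l)
      (r := HasPart C K l.toFinset) (μ := boltz C K b) (fun P => (boltz_pos b P).le)
      (fun P hP => hP.2)
    refine h1.trans ?_
    refine (sum_le_sum fun e _ => sum_boltz_hasPart_le hb hκ hsound l.toFinset e).trans ?_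
    rw [sum_const, card_paulisOn, hlj, nsmul_eq_mul]
    push_cast
    exact le_rfl
  · rw [sum_eq_zero]
    · exact mul_nonneg (by positivity) (mul_nonneg (pow_nonneg (Real.exp_pos _).le _) hZ0)
    · intro P hP
      rw [mem_filter] at hP
      exact absurd hP.2.1 hlj

open Classical in
-- Entropy against energy: at most `D ^ (2 j)` walks start at a qubit, and `4 ^ j` Pauli operators
-- live on the range of each.
theorem sum_boltz_exists_walk_le {b κ₀ : ℝ} {D : ℕ} (hb : 0 ≤ b) (hκ : 0 ≤ κ₀) (hD1 : 1 ≤ D)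
    (hsound : ∀ e, IsMin C e → κ₀ * (pauliSupp e).card ≤ energy K (syn C e))
    (hD : ∀ q, (nbr C K q).card ≤ D) (j : ℕ) :
    ∑ P with SomeWalkHasPart C K j P, boltz C K b P ≤
      Fintype.card Q * ((4 * (D : ℝ) ^ 2 * Real.exp (-(b * κ₀ / 2))) ^ j *
        ∑ P, boltz C K b P) := by
  have hZ0 : 0 ≤ ∑ P, boltz C K b P := sum_nonneg fun P _ => (boltz_pos b P).le
  set Z := ∑ P, boltz C K b P
  have hx : 0 ≤ Real.exp (-(b * κ₀ / 2)) := (Real.exp_pos _).le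
  set x := Real.exp (-(b * κ₀ / 2)) with hxdef
  have h0 : 0 ≤ (4 : ℝ) ^ j * (x ^ j * Z) := by positivity
  have hq : ∀ q, ∑ P with WalkFromHasPart C K j q P, boltz C K b P ≤
      (4 * (D : ℝ) ^ 2 * x) ^ j * Z := by
    intro q
    have h1 := sum_filter_le_sum_sum (s := walks C K (2 * j - 2) q)
      (p := WalkFromHasPart C K j q)
      (r := WalkHasPart C K j) (μ := boltz C K b) (fun P => (boltz_pos b P).le) (fun P hP => hP)
    refine h1.trans ?_
    refine (sum_le_sum fun l _ => sum_boltz_walkHasPart_le hb hκ hsound j l).trans ?_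
    rw [sum_const, nsmul_eq_mul]
    have h2 := (card_walks_le hD (2 * j - 2) q).trans
      (Nat.pow_le_pow_right hD1 (show 2 * j - 2 ≤ 2 * j by omega))
    calc ((walks C K (2 * j - 2) q).card : ℝ) * (4 ^ j * (x ^ j * Z))
        ≤ (D : ℝ) ^ (2 * j) * (4 ^ j * (x ^ j * Z)) :=
          mul_le_mul_of_nonneg_right (by exact_mod_cast h2) h0
      _ = _ := by rw [pow_mul, mul_pow, mul_pow]; ring
  have h1 := sum_filter_le_sum_sum (s := (univ : Finset Q))
    (p := SomeWalkHasPart C K j)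
    (r := WalkFromHasPart C K j) (μ := boltz C K b)
    (fun P => (boltz_pos b P).le) (fun P ⟨q, hP⟩ => ⟨q, mem_univ q, hP⟩)
  refine h1.trans ((sum_le_sum fun q _ => hq q).trans ?_)
  rw [sum_const, card_univ, nsmul_eq_mul]

theorem IsBad.exists_walk {w : ℕ} {P : Pauli Q} (h : IsBad C K w (dec C (syn C P))) :
    ∃ j ∈ Ico w (Fintype.card Q + 1), SomeWalkHasPart C K j P := by
  obtain ⟨l, h1, h2, h3, h4, h5⟩ := h
  have h6 : l.toFinset.card ≤ Fintype.card Q := card_le_univ _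
  refine ⟨l.toFinset.card, mem_Ico.2 ⟨h2, by omega⟩, ?_⟩
  cases l with
  | nil => simp at h3
  | cons q l =>
    refine ⟨q, q :: l, ?_, rfl, restrict (dec C (syn C P)) (q :: l).toFinset,
      restrict_mem_paulisOn _ _, rfl, ?_, h5⟩
    · have h7 := mem_walks h1
      rw [List.length_cons] at h3
      have h8 : 2 * (q :: l).toFinset.card - 2 = l.length := by omega
      rw [h8]
      exact h7
    · rw [pauliSupp_restrict]; exact h4

open Classical in
-- With ratio `r` at most `1 / 2`, the sum over cluster sizes from `w` on is at most twice its first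
-- term.
theorem sum_boltz_isBad_le {b κ₀ r : ℝ} {w D : ℕ} (hb : 0 ≤ b) (hκ : 0 ≤ κ₀) (hD1 : 1 ≤ D)
    (hsound : ∀ e, IsMin C e → κ₀ * (pauliSupp e).card ≤ energy K (syn C e))
    (hD : ∀ q, (nbr C K q).card ≤ D)
    (hr : 4 * (D : ℝ) ^ 2 * Real.exp (-(b * κ₀ / 2)) ≤ r) (hr2 : r ≤ 1 / 2) :
    ∑ P with IsBad C K w (dec C (syn C P)), boltz C K b P ≤
      2 * Fintype.card Q * r ^ w * ∑ P, boltz C K b P := by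
  have hZ0 : 0 ≤ ∑ P, boltz C K b P := sum_nonneg fun P _ => (boltz_pos b P).le
  have hr0 : 0 ≤ r := le_trans (by positivity) hr
  have h1 := sum_filter_le_sum_sum (s := Ico w (Fintype.card Q + 1))
    (p := fun P => IsBad C K w (dec C (syn C P)))
    (r := SomeWalkHasPart C K)
    (μ := boltz C K b) (fun P => (boltz_pos b P).le) (fun P hP => hP.exists_walk)
  refine h1.trans ((sum_le_sum fun j _ => sum_boltz_exists_walk_le hb hκ hD1 hsound hD j).trans ?_)
  set Z := ∑ P, boltz C K b P
  have hgeom : ∀ m, ∑ j ∈ Ico w m, r ^ j ≤ 2 * r ^ w := by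
    intro m
    rcases le_or_gt w m with hwm | hwm
    · have hr1 : r ≠ 1 := by linarith
      rw [geom_sum_Ico' hr1 hwm, div_le_iff₀ (by linarith)]
      have h1 : 0 ≤ r ^ w := pow_nonneg hr0 w
      have h2 : 0 ≤ r ^ m := pow_nonneg hr0 m
      nlinarith
    · rw [Ico_eq_empty_of_le hwm.le, sum_empty]; positivity
  rw [← mul_sum, ← sum_mul, ← mul_assoc]
  refine mul_le_mul_of_nonneg_right ?_ hZ0
  calc (Fintype.card Q : ℝ) * ∑ j ∈ Ico w (Fintype.card Q + 1),
        (4 * (D : ℝ) ^ 2 * Real.exp (-(b * κ₀ / 2))) ^ j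
      ≤ Fintype.card Q * ∑ j ∈ Ico w (Fintype.card Q + 1), r ^ j := by
        gcongr
    _ ≤ Fintype.card Q * (2 * r ^ w) := by
        gcongr
        exact hgeom _
    _ = _ := by ring

end

section

variable {Q I κ : Type} [Fintype Q] [DecidableEq Q] [Fintype I] [DecidableEq I] [Fintype κ]
variable {C : I → Pauli Q} {K : κ → Finset I}

/-! ### Logical operators and the depth of circuits for thermal states -/

/-- The symplectic form is nondegenerate, so it represents every linear functional. -/
theorem apply_eq_symp (f : Pauli Q →ₗ[ZMod 2] ZMod 2) (P : Pauli Q) :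
    f P = symp P (fun q => f (0, Pi.single q 1), fun q => f (Pi.single q 1, 0)) := by
  have h : P = ∑ q, (P.1 q • ((Pi.single q 1, 0) : Pauli Q) +
      P.2 q • ((0, Pi.single q 1) : Pauli Q)) := by
    refine Prod.ext (funext fun q => ?_) (funext fun q => ?_)
    · simp [Prod.fst_sum, Finset.sum_apply, Pi.single_apply]
    · simp [Prod.snd_sum, Finset.sum_apply, Pi.single_apply]
  nth_rewrite 1 [h]
  rw [map_sum, symp_eq_sum]
  refine sum_congr rfl fun q _ => ?_
  rw [map_add, map_smul, map_smul, smul_eq_mul, smul_eq_mul]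

theorem symp_restrict_left (L P : Pauli Q) (J : Finset Q) :
    symp (restrict L J) P = symp L (restrict P J) := by
  rw [symp_comm, symp_restrict, symp_restrict]
  exact sum_congr rfl fun q _ => by ring

/-- The cleaning lemma. -/
theorem exists_clean {L : Pauli Q} (A : Finset Q)
    (hdist : ∀ z, syn C z = 0 → (pauliSupp z).card ≤ A.card → symp L z = 0) :
    ∃ T, (L + comb C T).VanishesOn A := by
  let r : (I → ZMod 2) →ₗ[ZMod 2] Pauli Q :=
    { toFun := fun T => restrict (comb C T) A
      map_add' := fun T T' => by
        rw [comb_add]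
        refine Prod.ext (funext fun q => ?_) (funext fun q => ?_) <;>
        · simp only [restrict, Prod.fst_add, Prod.snd_add, Pi.add_apply]
          split_ifs <;> simp
      map_smul' := fun c T => by
        have : comb C (c • T) = c • comb C T := by simp [comb, smul_sum, smul_smul]
        rw [this]
        refine Prod.ext (funext fun q => ?_) (funext fun q => ?_) <;>
        · simp only [restrict, Prod.smul_fst, Prod.smul_snd, Pi.smul_apply, RingHom.id_apply]
          split_ifs <;> simp }
  by_cases hL : restrict L A ∈ LinearMap.range r
  · obtain ⟨T, hT⟩ := hL
    have hT : restrict (comb C T) A = restrict L A := hT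
    refine ⟨T, fun q hq => ?_⟩
    have hq' : q ∈ A := hq
    have h1 := congrFun (congrArg Prod.fst hT) q
    have h2 := congrFun (congrArg Prod.snd hT) q
    simp only [restrict, hq', if_true] at h1 h2
    simp only [Prod.fst_add, Prod.snd_add, Pi.add_apply, h1, h2]
    exact ⟨CharTwo.add_self_eq_zero _, CharTwo.add_self_eq_zero _⟩
  · exfalso
    -- A functional separating `L` on `A` from the checks on `A` is the symplectic form with an
    -- error supported in `A`. That error commutes with all checks but not with `L`, contradicting
    -- `hdist`.
    obtain ⟨f, hf, hfr⟩ := Submodule.exists_le_ker_of_notMem hL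
    set z' : Pauli Q := (fun q => f (0, Pi.single q 1), fun q => f (Pi.single q 1, 0))
    have hz : ∀ P, symp P (restrict z' A) = f (restrict P A) := by
      intro P
      rw [← symp_restrict_left, ← apply_eq_symp]
    have h1 : syn C (restrict z' A) = 0 := by
      funext i
      rw [syn, hz]
      have : restrict (C i) A ∈ LinearMap.range r := ⟨Pi.single i 1, by
        change restrict (comb C (Pi.single i 1)) A = _
        rw [comb_single]⟩
      exact hfr this
    have h2 := hdist _ h1 (by
      rw [pauliSupp_restrict]; exact card_le_card inter_subset_left)
    rw [hz] at h2
    exact hf h2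

variable (hC : Compatible C)

/-- The logical operator `L`, corrected by the minimal error of the syndrome. -/
def dressed (L : Pauli Q) : Op Q := L.toOp * fc hC (fun s => sgn (symp L (dec C s)))

theorem conjTranspose_fc_sgn_mul (σ : (I → ZMod 2) → ZMod 2) :
    (fc hC fun s => sgn (σ s))ᴴ * (fc hC fun s => sgn (σ s)) = 1 := by
  rw [conjTranspose_fc, ← map_mul, ← map_one (fc hC)]
  congr 1
  funext s
  simp only [Pi.mul_apply, Pi.star_apply, star_sgn, sgn_mul_self, Pi.one_apply]

theorem conjTranspose_toOp_mul_fc_sgn (L : Pauli Q) (σ : (I → ZMod 2) → ZMod 2) :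
    (L.toOp * fc hC fun s => sgn (σ s))ᴴ * (L.toOp * fc hC fun s => sgn (σ s)) = 1 := by
  rw [conjTranspose_mul, mul_assoc, ← mul_assoc L.toOpᴴ, L.conjTranspose_mul_toOp, one_mul,
    conjTranspose_fc_sgn_mul]

/-- Logical operators commute with functions of the syndrome, so the corrections do not affect the
sign. The relation is exact and holds on all states, good or bad. -/
theorem dressed_anticommute {X Z : Pauli Q} (hX : syn C X = 0) (hZ : syn C Z = 0)
    (h : symp X Z = 1) : dressed hC X * dressed hC Z = -(dressed hC Z * dressed hC X) := by
  have hcomm : ∀ L : Pauli Q, syn C L = 0 → ∀ f, fc hC f * L.toOp = L.toOp * fc hC f := by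
    intro L hL f
    rw [toOp_mul_fc, hL]; simp
  have hprod : ∀ L L' : Pauli Q, syn C L' = 0 → ∀ f g,
      (L.toOp * fc hC f) * (L'.toOp * fc hC g) = L.toOp * L'.toOp * fc hC (f * g) := by
    intro L L' hL' f g
    calc _ = L.toOp * (fc hC f * L'.toOp) * fc hC g := by simp only [mul_assoc]
      _ = _ := by rw [hcomm L' hL', map_mul]; simp only [mul_assoc]
  rw [dressed, dressed, hprod X Z hZ, hprod Z X hX, Pauli.toOp_mul_comm X Z, h, sgn_one,
    neg_one_smul, neg_mul, mul_comm (fun s => sgn (symp X (dec C s)))]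

/-- The syndromes of errors without large clusters. -/
def IsGood (C : I → Pauli Q) (K : κ → Finset I) (w : ℕ) (s : I → ZMod 2) : Prop :=
  (∃ E, syn C E = s) ∧ ¬ IsBad C K w (dec C s)

open Classical in
/-- The projection on the syndromes of errors with large clusters. -/
def badProj (K : κ → Finset I) (w : ℕ) : Op Q :=
  fc hC fun s => ((if IsGood C K w s then 0 else 1 : ℝ) : ℂ)

theorem conjTranspose_badProj (w : ℕ) : (badProj hC K w)ᴴ = badProj hC K w := by
  rw [badProj, conjTranspose_fc]
  congr 1
  funext s
  simp

theorem badProj_mul_badProj (w : ℕ) : badProj hC K w * badProj hC K w = badProj hC K w := by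
  rw [badProj, ← map_mul]
  congr 1
  funext s
  simp only [Pi.mul_apply]
  split_ifs <;> simp

theorem syn_dec {s : I → ZMod 2} (h : ∃ E, syn C E = s) : syn C (dec C s) = s := by
  obtain ⟨E, rfl⟩ := h
  exact (dec_spec C E).1

open Classical in
/-- On states without large clusters, a dressed logical operator can be moved away from every
small set of qubits. -/
theorem exists_dressed_eq {L : Pauli Q} {w D d : ℕ} {M : Finset Q} (hK : ∀ i, ∃ t, i ∈ K t)
    (hD : ∀ q, (nbr C K q).card ≤ D)
    (hdist : ∀ z, syn C z = 0 → (pauliSupp z).card < d → symp L z = 0) (hw : w ≤ d)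
    (hM : D ^ (2 * w + 1) * M.card < d) :
    ∃ L' : Op Q, L'ᴴ * L' = 1 ∧ SuppOn ((M : Set Q)ᶜ) L' ∧
      dressed hC L * (1 - badProj hC K w) = L' * (1 - badProj hC K w) := by
  set A := (nbhd C K)^[2 * w + 1] M with hA
  have hAcard : A.card < d := (card_iterate_nbhd_le hD _ M).trans_lt hM
  obtain ⟨T, hT⟩ := exists_clean (C := C) (L := L) A
    fun z hz hzA => hdist z hz (hzA.trans_lt hAcard)
  set Λ := L + comb C T with hΛ
  set c := sgn (L.2 ⬝ᵥ (comb C T).1) with hc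
  have hcc : star c * c = 1 := by rw [hc, star_sgn, sgn_mul_self]
  -- `σ` guesses the correction from the part of the syndrome away from `M`, by completing it to
  -- some good syndrome if one exists. Its default value 0 keeps `L'` unitary everywhere; for good
  -- syndromes, locality makes the choice of the completion irrelevant.
  let cand : (I → ZMod 2) → (I → ZMod 2) → Prop := fun s s' =>
    IsGood C K w s' ∧ ∀ i, (C i).VanishesOn M → s' i = s i
  let σ : (I → ZMod 2) → ZMod 2 := fun s =>
    if h : ∃ s', cand s s' then symp Λ (dec C h.choose) else 0
  have hσ : ∀ s s', (∀ i, (C i).VanishesOn M → s i = s' i) → σ s = σ s' := by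
    intro s s' hss
    have : cand s = cand s' := by
      funext x
      refine propext (and_congr_right fun _ => forall₂_congr fun i hi => ?_)
      rw [hss i hi]
    simp only [σ, this]
  have hcomb : ∀ z, syn C z = 0 → symp (comb C T) z = 0 := by
    intro z hz
    rw [symp_comb, hz, dotProduct_zero]
  have hgood : ∀ s, IsGood C K w s → σ s = symp Λ (dec C s) := by
    intro s hs
    have h : ∃ s', cand s s' := ⟨s, hs, fun _ _ => rfl⟩
    have hσs : σ s = symp Λ (dec C h.choose) := dif_pos h
    rw [hσs]
    obtain ⟨h1, h2⟩ := h.choose_spec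
    refine symp_eq_of_agree hK h1.2 hs.2 ?_ hT ?_
    · intro i hi
      rw [syn_dec h1.1, syn_dec hs.1]
      exact h2 i hi
    · intro z hz hzw
      rw [hΛ, add_symp, hdist z hz (hzw.trans_le hw), hcomb z hz, add_zero]
  refine ⟨c • (Λ.toOp * fc hC fun s => sgn (σ s)), ?_, ?_, ?_⟩
  · rw [conjTranspose_smul, smul_mul_assoc, mul_smul_comm, smul_smul, hcc, one_smul,
      conjTranspose_toOp_mul_fc_sgn]
  · refine ((suppOn_toOp Λ ?_).mul (suppOn_fc hC ?_)).smul c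
    · intro q hq
      rw [compl_compl] at hq
      exact hT q (subset_iterate_nbhd _ M hq)
    · intro s s' hss
      rw [hσ s s' hss]
  · have h1 : 1 - badProj hC K w = fc hC (fun s => if IsGood C K w s then 1 else 0) := by
      rw [badProj, ← map_one (fc hC), ← map_sub]
      congr 1
      funext s
      simp only [Pi.sub_apply, Pi.one_apply]
      split_ifs <;> simp
    -- Cleaning multiplies `L` by the product of checks selected by `T`; this product is itself a
    -- function of the syndrome and is absorbed into the correction, up to the phase `c`.
    have h2 : L.toOp = c • (Λ.toOp * fc hC fun s => sgn (s ⬝ᵥ T)) := by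
      rw [fc_comb, ← smul_mul_assoc, hc, hΛ, ← Pauli.toOp_mul, mul_assoc, hC.comb_mul, pi_add_self]
      simp [comb, Pauli.toOp_zero]
    rw [h1, dressed, h2, smul_mul_assoc, smul_mul_assoc, smul_mul_assoc, mul_assoc, mul_assoc,
      mul_assoc, ← map_mul, ← map_mul, ← map_mul]
    congr 3
    funext s
    simp only [Pi.mul_apply]
    split_ifs with hs
    · rw [hgood s hs, hΛ, add_symp, symp_comb, syn_dec hs.1, sgn_add, dotProduct_comm T]
      ring
    · simp

theorem dec_zero : dec C 0 = 0 := by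
  have h := dec_spec C 0
  rw [syn_zero] at h
  have h2 := h.2 0 (by rw [h.1, syn_zero])
  have h3 : (pauliSupp (0 : Pauli Q)).card = 0 := by simp [pauliSupp]
  rw [h3, Nat.le_zero, card_eq_zero, eq_empty_iff_forall_notMem] at h2
  exact Prod.ext (funext fun q => (notMem_pauliSupp.1 (h2 q)).1)
    (funext fun q => (notMem_pauliSupp.1 (h2 q)).2)

theorem not_isBad_zero {w : ℕ} (hw : 1 ≤ w) : ¬ IsBad C K w 0 := by
  rintro ⟨l, -, h1, -, h2, -⟩
  have h3 : pauliSupp (0 : Pauli Q) = ∅ := by simp [pauliSupp]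
  rw [h3, inter_empty, card_empty] at h2
  omega

open Classical in
theorem energy_eq_sum (s : I → ZMod 2) :
    energy K s = ∑ t, if ∃ i ∈ K t, s i ≠ 0 then (1 : ℝ) else 0 := rfl

open Classical in
/-- Thermal states rarely have large clusters of errors. -/
theorem re_trace_thermal_mul_badProj_le {h : κ → Op Q}
    (hh : ∀ t, h t = fc hC (fun s => ((if ∃ i ∈ K t, s i ≠ 0 then 1 else 0 : ℝ) : ℂ)))
    (hK : ∀ i, ∃ t, i ∈ K t) {β₀ κ₀ r : ℝ} {w D : ℕ} (hw : 1 ≤ w)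
    (hβ : 0 ≤ β₀) (hκ : 0 ≤ κ₀) (hD1 : 1 ≤ D)
    (hsound : ∀ e, IsMin C e → κ₀ * (pauliSupp e).card ≤ energy K (syn C e))
    (hD : ∀ q, (nbr C K q).card ≤ D)
    (hr : 4 * (D : ℝ) ^ 2 *
      Real.exp (-(β₀ * (Fintype.card κ / Fintype.card Q : ℝ)⁻¹ * κ₀ / 2)) ≤ r)
    (hr2 : r ≤ 1 / 2) {ρ : Op Q} (hρ : IsThermalState h β₀ ρ) :
    (ρ * badProj hC K w).trace.re ≤ 2 * Fintype.card Q * r ^ w := by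
  have hr0 : 0 ≤ r := le_trans (by positivity) hr
  rcases hρ with ⟨β, hββ, rfl⟩ | ⟨-, -, hρ⟩
  · rw [badProj, trace_gibbsState_mul_fc hC hh, Complex.ofReal_re]
    set μ := (Fintype.card κ / Fintype.card Q : ℝ)⁻¹ with hμ
    have hμ0 : 0 ≤ μ := by rw [hμ]; positivity
    have hb : ∀ P, Real.exp (-(β * (μ * ∑ t, if ∃ i ∈ K t, syn C P i ≠ 0 then (1 : ℝ) else 0))) =
        boltz C K (β * μ) P := by
      intro P
      rw [boltz, energy_eq_sum, mul_assoc]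
    simp only [hb]
    have hZ : 0 < ∑ P, boltz C K (β * μ) P :=
      sum_pos (fun P _ => boltz_pos _ P) univ_nonempty
    rw [div_le_iff₀ hZ]
    have hr' : 4 * (D : ℝ) ^ 2 * Real.exp (-(β * μ * κ₀ / 2)) ≤ r := by
      refine le_trans ?_ hr
      gcongr
    refine le_trans ?_ (sum_boltz_isBad_le (w := w) (mul_nonneg (hβ.trans hββ) hμ0) hκ hD1 hsound
      hD hr' hr2)
    rw [sum_filter]
    refine sum_le_sum fun P _ => ?_
    by_cases hbad : IsBad C K w (dec C (syn C P))
    · rw [if_pos hbad]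
      have := (boltz_pos (C := C) (K := K) (β * μ) P).le
      split_ifs <;> simp [this]
    · have hg : IsGood C K w (syn C P) := ⟨⟨P, rfl⟩, hbad⟩
      rw [if_neg hbad, if_pos hg, mul_zero]
  · rw [badProj, trace_groundState_mul_fc hC hh hρ]
    · simp only [Complex.zero_re]
      positivity
    · intro s hs
      -- Every check occurs in some term, so zero energy forces the zero syndrome, which is good.
      have h0 : s = 0 := by
        rw [sum_eq_zero_iff_of_nonneg (fun t _ => by split_ifs <;> norm_num)] at hs
        funext i
        obtain ⟨t, ht⟩ := hK i
        by_contra hne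
        have := hs t (mem_univ t)
        rw [if_pos ⟨i, ht, hne⟩] at this
        norm_num at this
      rw [if_pos]
      subst h0
      exact ⟨⟨0, syn_zero C⟩, by rw [dec_zero]; exact not_isBad_zero hw⟩

open Classical in
/-- The depth bound for thermal states of a stabilizer code with many-body interactions. -/
theorem half_le_of_thermal {ι : Type} [Fintype ι] [DecidableEq ι] {h : κ → Op Q}
    (hh : ∀ t, h t = fc hC (fun s => ((if ∃ i ∈ K t, s i ≠ 0 then 1 else 0 : ℝ) : ℂ)))
    (hK : ∀ i, ∃ t, i ∈ K t) {β₀ κ₀ r : ℝ} {w D d : ℕ} (hw : 1 ≤ w)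
    (hβ : 0 ≤ β₀) (hκ : 0 ≤ κ₀) (hD1 : 1 ≤ D)
    (hsound : ∀ e, IsMin C e → κ₀ * (pauliSupp e).card ≤ energy K (syn C e))
    (hD : ∀ q, (nbr C K q).card ≤ D)
    (hr : 4 * (D : ℝ) ^ 2 *
      Real.exp (-(β₀ * (Fintype.card κ / Fintype.card Q : ℝ)⁻¹ * κ₀ / 2)) ≤ r)
    (hr2 : r ≤ 1 / 2) {X Z : Pauli Q} (hX : syn C X = 0) (hZ : syn C Z = 0) (hXZ : symp X Z = 1)
    (hdist : ∀ z, syn C z = 0 → (pauliSupp z).card < d → symp X z = 0 ∧ symp Z z = 0)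
    (hwd : w ≤ d) {ρ : Op Q} (hρ : IsThermalState h β₀ ρ) (U : Circuit ι) (S : Q ↪ ι)
    (hU : D ^ (2 * w + 1) * 2 ^ U.depth < d) :
    1 / 2 ≤ Fintype.card Q * 2 ^ U.depth *
      (4 * (2 * Fintype.card Q * r ^ w + 2 * traceDist (reducedOp S U.output) ρ)) := by
  refine half_le_of_local_unitaries U S (conjTranspose_toOp_mul_fc_sgn hC X _)
    (conjTranspose_toOp_mul_fc_sgn hC Z _) (dressed_anticommute hC hX hZ hXZ)
    (conjTranspose_badProj hC (K := K) w) (badProj_mul_badProj hC w) ?_ ?_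
  · refine (re_trace_mul_le (σ := ρ) (conjTranspose_badProj hC w) (badProj_mul_badProj hC w)).trans
      ?_
    gcongr
    exact re_trace_thermal_mul_badProj_le hC hh hK hw hβ hκ hD1 hsound hD hr hr2 hρ
  · intro L hL M hM
    have hMd : D ^ (2 * w + 1) * M.card < d :=
      (Nat.mul_le_mul_left _ hM).trans_lt hU
    rcases hL with rfl | rfl
    · exact exists_dressed_eq hC hK hD (fun z h1 h2 => (hdist z h1 h2).1) hwd hMd
    · exact exists_dressed_eq hC hK hD (fun z h1 h2 => (hdist z h1 h2).2) hwd hMd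

end

/-! ### Faces of the projective cube and invariant chains -/

section Proj

variable {N k l : ℕ}

def cls (w : Word N) (h : stars w = k) : ProjFace N k := Quotient.mk _ ⟨w, h⟩

theorem cls_eq_cls {w w' : Word N} {h : stars w = k} {h' : stars w' = k} :
    cls w h = cls w' h' ↔ w = w' ∨ w = antipode w' :=
  Quotient.eq (r := faceSetoid N k)

theorem cls_antipode (w : Word N) (h : stars w = k) :
    cls (antipode w) ((stars_antipode w).trans h) = cls w h :=
  cls_eq_cls.2 (Or.inr rfl)

def rep (q : ProjFace N k) : Word N := (Quotient.out q).1

theorem stars_rep (q : ProjFace N k) : stars (rep q) = k := (Quotient.out q).2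

theorem cls_rep (q : ProjFace N k) : cls (rep q) (stars_rep q) = q := Quotient.out_eq q

/-- Together with `proj`, this identifies functions on projective faces with invariant chains of
degree `k`, so that the estimates in the cube apply. -/
def lift (a : ProjFace N k → ZMod 2) : Chain N := fun w =>
  if h : stars w = k then a (cls w h) else 0

def proj (k : ℕ) (b : Chain N) : ProjFace N k → ZMod 2 := fun q => b (rep q)

theorem lift_of_stars (a : ProjFace N k → ZMod 2) {w : Word N} (h : stars w = k) :
    lift a w = a (cls w h) := dif_pos h

theorem lift_rep (a : ProjFace N k → ZMod 2) (q : ProjFace N k) : lift a (rep q) = a q := by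
  rw [lift_of_stars a (stars_rep q), cls_rep]

theorem isInvariant_lift (a : ProjFace N k → ZMod 2) : IsInvariant (lift a) := by
  intro w
  by_cases h : stars w = k
  · rw [lift_of_stars a h, lift_of_stars a ((stars_antipode w).trans h), cls_antipode]
  · rw [lift, lift, dif_neg h, dif_neg (by rwa [stars_antipode])]

theorem hasDegree_lift (a : ProjFace N k → ZMod 2) : HasDegree k (lift a) := by
  intro w hw
  by_contra h
  exact hw (dif_neg h)

theorem proj_cls {b : Chain N} (hb : IsInvariant b) (w : Word N) (h : stars w = k) :
    proj k b (cls w h) = b w := by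
  rcases cls_eq_cls.1 (cls_rep (cls w h)) with h' | h'
  · rw [proj, h']
  · rw [proj, h', hb]

theorem lift_proj_of_stars {b : Chain N} (hb : IsInvariant b) {w : Word N} (h : stars w = k) :
    lift (proj k b) w = b w := by
  rw [lift_of_stars _ h, proj_cls hb]

theorem lift_proj {b : Chain N} (hb : IsInvariant b) (hd : HasDegree k b) :
    lift (proj k b) = b := by
  funext w
  by_cases h : stars w = k
  · exact lift_proj_of_stars hb h
  · rw [lift, dif_neg h]
    by_contra h'
    exact h (hd w (Ne.symm h'))

theorem antipode_ne {w : Word N} (h : stars w < N) : antipode w ≠ w := by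
  intro h'
  have hall : ∀ i, w i = none := by
    intro i
    have := congrFun h' i
    cases hi : w i with
    | none => rfl
    | some b => simp [antipode, hi] at this
  rw [stars_eq_card] at h
  simp [hall] at h

/-- Below the top degree no face is its own antipode, so every class has exactly two members. -/
theorem sum_rep_add_antipode {A : Type*} [AddCommMonoid A] (hk : k < N) (F : Word N → A) :
    ∑ q : ProjFace N k, (F (rep q) + F (antipode (rep q))) =
      ∑ w : Word N with stars w = k, F w := by
  classical
  have hmem : ∀ w : Word N, w ∈ ({w : Word N | stars w = k} : Finset _) → stars w = k := by simp
  conv_rhs => rw [← Finset.sum_attach]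
  rw [← Finset.sum_fiberwise (s := Finset.attach _) (g := fun w : {w // w ∈ ({w : Word N | stars w = k} :
    Finset (Word N))} => (cls w.1 (hmem _ w.2) : ProjFace N k))
    (f := fun w => F w.1)]
  refine Finset.sum_congr rfl fun q _ => ?_
  have hr := stars_rep q
  have hne : antipode (rep q) ≠ rep q := antipode_ne (by omega)
  have : ({w : {w // w ∈ ({w : Word N | stars w = k} : Finset (Word N))} |
      (cls w.1 (hmem _ w.2) : ProjFace N k) = q} : Finset _) =
      {⟨rep q, by simp [hr]⟩, ⟨antipode (rep q), by simp [hr, stars_antipode]⟩} := by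
    ext ⟨w, hw⟩
    simp only [mem_filter, mem_univ, true_and, mem_insert, mem_singleton, Subtype.mk.injEq]
    conv_lhs => rw [← cls_rep q]
    exact cls_eq_cls
  rw [← Finset.univ_eq_attach, this, Finset.sum_pair]
  simpa using hne.symm

theorem size_lift (hk : k < N) (a : ProjFace N k → ZMod 2) :
    size (lift a) = 2 * #{q | a q ≠ 0} := by
  rw [size_eq_sum, Finset.card_filter, Finset.mul_sum]
  have h := sum_rep_add_antipode hk (fun w => if lift a w ≠ 0 then 1 else 0)
  simp only [isInvariant_lift a _, lift_rep] at h
  rw [Finset.sum_filter] at h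
  rw [← (h.trans (Finset.sum_congr rfl fun w _ => ?_))]
  · exact Finset.sum_congr rfl fun q _ => by ring
  · split_ifs with h1 h2 h2 <;> first | rfl | exact absurd (hasDegree_lift a w h2) h1

/-! Incidences -/

theorem isFacet_iff {v w : Word N} :
    IsFacet v w ↔ ∃ i, v i ≠ none ∧ w = Function.update v i none := by
  constructor
  · rintro ⟨i, h1, h2, h3⟩
    refine ⟨i, h2, ?_⟩
    funext j
    by_cases hj : j = i
    · subst hj; simp [h1]
    · simp [hj, h3 j hj]
  · rintro ⟨i, h1, rfl⟩
    exact ⟨i, by simp, h1, fun j hj => by simp [hj]⟩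

theorem isFacet_iff' {v w : Word N} :
    IsFacet v w ↔ ∃ i, w i = none ∧ ∃ x : Bool, v = Function.update w i (some x) := by
  constructor
  · rintro ⟨i, h1, h2, h3⟩
    obtain ⟨x, hx⟩ := Option.ne_none_iff_exists'.1 h2
    refine ⟨i, h1, x, ?_⟩
    funext j
    by_cases hj : j = i
    · subst hj; simp [hx]
    · simp [hj, h3 j hj]
  · rintro ⟨i, h1, x, rfl⟩
    exact ⟨i, h1, by simp, fun j hj => by simp [hj]⟩

theorem IsFacet.antipode {v w : Word N} (h : IsFacet v w) :
    IsFacet (antipode v) (antipode w) := by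
  obtain ⟨i, h1, h2, h3⟩ := h
  refine ⟨i, antipode_eq_none.2 h1, fun h => h2 (antipode_eq_none.1 h), fun j hj => ?_⟩
  simp [ThermalTQO.antipode, h3 j hj]

theorem inBoundary_cls_left {v : Word N} {hv : stars v = k} {q : ProjFace N l} :
    InBoundary (cls v hv) q ↔ ∃ (w : Word N) (hw : stars w = l), cls w hw = q ∧ IsFacet v w := by
  constructor
  · rintro ⟨v', w, h1, h2, h3⟩
    rcases cls_eq_cls.1 (show cls v'.1 v'.2 = cls v hv from h1) with h | h
    · exact ⟨w.1, w.2, h2, h ▸ h3⟩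
    · refine ⟨antipode w.1, (stars_antipode _).trans w.2, (cls_antipode _ w.2).trans h2, ?_⟩
      have := h3.antipode
      rwa [h, antipode_antipode_word] at this
  · rintro ⟨w, hw, h1, h2⟩
    exact ⟨⟨v, hv⟩, ⟨w, hw⟩, rfl, h1, h2⟩

theorem inBoundary_cls_right {w : Word N} {hw : stars w = l} {f : ProjFace N k} :
    InBoundary f (cls w hw) ↔ ∃ (v : Word N) (hv : stars v = k), cls v hv = f ∧ IsFacet v w := by
  constructor
  · rintro ⟨v, w', h1, h2, h3⟩
    rcases cls_eq_cls.1 (show cls w'.1 w'.2 = cls w hw from h2) with h | h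
    · exact ⟨v.1, v.2, h1, h ▸ h3⟩
    · refine ⟨antipode v.1, (stars_antipode _).trans v.2, (cls_antipode _ v.2).trans h1, ?_⟩
      have := h3.antipode
      rwa [h, antipode_antipode_word] at this
  · rintro ⟨v, hv, h1, h2⟩
    exact ⟨⟨v, hv⟩, ⟨w, hw⟩, h1, rfl, h2⟩

theorem update_none_injOn {v : Word N} {i j : Fin N} (hi : v i ≠ none)
    (h : Function.update v i none = Function.update v j none ∨
      Function.update v i none = antipode (Function.update v j none)) : i = j := by
  by_contra hij
  rcases h with h | h <;> have := congrFun h i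
  · simp [hij] at this; exact hi this.symm
  · simp only [Function.update_self] at this
    have := antipode_eq_none.1 this.symm
    simp [hij] at this; exact hi this

open Classical in
theorem sum_inBoundary_up {A : Type*} [AddCommMonoid A] (hkl : k + 1 = l) (a : ProjFace N l → A)
    {v : Word N} (hv : stars v = k) :
    ∑ q, (if InBoundary (cls v hv) q then a q else 0) =
      ∑ i, if h : v i ≠ none then a (cls (Function.update v i none)
        ((stars_update_none h).trans (by omega))) else 0 := by
  subst hkl
  rw [← Finset.sum_filter]
  symm
  rw [Finset.sum_dite, Finset.sum_const_zero, add_zero]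
  refine Finset.sum_bij (fun i _ => cls (Function.update v i.1 none)
    ((stars_update_none ((Finset.mem_filter.1 i.2).2)).trans (by omega))) ?_ ?_ ?_ ?_
  · intro i _
    simp only [mem_filter, mem_univ, true_and]
    exact inBoundary_cls_left.2 ⟨_, _, rfl, isFacet_iff.2 ⟨i.1, (Finset.mem_filter.1 i.2).2, rfl⟩⟩
  · intro i _ j _ h
    exact Subtype.ext (update_none_injOn ((Finset.mem_filter.1 i.2).2) (cls_eq_cls.1 h))
  · intro q hq
    simp only [mem_filter, mem_univ, true_and] at hq
    obtain ⟨w, hw, rfl, hf⟩ := inBoundary_cls_left.1 hq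
    obtain ⟨i, hi, rfl⟩ := isFacet_iff.1 hf
    exact ⟨⟨i, by simpa using hi⟩, mem_univ _, rfl⟩
  · intro i _
    rfl

open Classical in
theorem sum_inBoundary_bd (hkl : k + 1 = l) (a : ProjFace N l → ZMod 2) (f : ProjFace N k) :
    ∑ q, (if InBoundary f q then a q else 0) = bd (lift a) (rep f) := by
  have h := sum_inBoundary_up hkl a (stars_rep f)
  rw [cls_rep] at h
  rw [h, bd]
  refine Finset.sum_congr rfl fun i _ => ?_
  by_cases hi : rep f i = none
  · simp [hi]
  · rw [dif_pos hi, if_neg hi, lift_of_stars]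

/-- Opposite facets of the full cube are antipodal to each other; `hN` excludes this coincidence. -/
theorem update_some_eq {w : Word N} {i j : Fin N} {x y : Bool} (hN : stars w < N) (hi : w i = none)
    (hj : w j = none)
    (h : Function.update w i (some x) = Function.update w j (some y) ∨
      Function.update w i (some x) = antipode (Function.update w j (some y))) : i = j ∧ x = y := by
  have hij : i = j := by
    by_contra hij
    rcases h with h | h <;> have := congrFun h i
    · simp [hij, hi] at this
    · simp [antipode, hij, hi] at this
  subst hij
  refine ⟨rfl, ?_⟩
  rcases h with h | h
  · simpa using congrFun h i
  · exfalso
    rw [antipode_update] at h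
    refine antipode_ne hN ?_
    funext j
    by_cases hj : j = i
    · subst hj; rw [hi]; exact antipode_eq_none.2 hi
    · simpa [hj] using (congrFun h j).symm

open Classical in
theorem sum_inBoundary_down {A : Type*} [AddCommMonoid A] (hkl : k + 1 = l) (hl : l < N)
    (a : ProjFace N k → A) {w : Word N} (hw : stars w = l) :
    ∑ q, (if InBoundary q (cls w hw) then a q else 0) =
      ∑ i, if h : w i = none then ∑ x : Bool, a (cls (Function.update w i (some x))
        (by have := stars_update_some h x; omega)) else 0 := by
  subst hkl
  rw [← Finset.sum_filter]
  symm
  rw [Finset.sum_dite, Finset.sum_const_zero, add_zero, Finset.sum_sigma']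
  refine Finset.sum_bij (fun i _ => cls (Function.update w i.1.1 (some i.2))
    (by have := stars_update_some (f := w) (Finset.mem_filter.1 i.1.2).2 i.2; omega)) ?_ ?_ ?_ ?_
  · intro i _
    simp only [mem_filter, mem_univ, true_and]
    exact inBoundary_cls_right.2
      ⟨_, _, rfl, isFacet_iff'.2 ⟨i.1.1, (Finset.mem_filter.1 i.1.2).2, i.2, rfl⟩⟩
  · rintro ⟨⟨i, hi⟩, x⟩ _ ⟨⟨j, hj⟩, y⟩ _ h
    obtain ⟨rfl, rfl⟩ := update_some_eq (by omega) (by simpa using hi) (by simpa using hj)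
      (cls_eq_cls.1 h)
    rfl
  · intro q hq
    simp only [mem_filter, mem_univ, true_and] at hq
    obtain ⟨v, hv, rfl, hf⟩ := inBoundary_cls_right.1 hq
    obtain ⟨i, hi, x, rfl⟩ := isFacet_iff'.1 hf
    exact ⟨⟨⟨i, by simpa using hi⟩, x⟩, by simp, rfl⟩
  · intro i _
    rfl

open Classical in
theorem sum_inBoundary_cobd (hkl : k + 1 = l) (hl : l < N) (a : ProjFace N k → ZMod 2)
    (g : ProjFace N l) :
    ∑ q, (if InBoundary q g then a q else 0) = cobd (lift a) (rep g) := by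
  have h := sum_inBoundary_down hkl hl a (stars_rep g)
  rw [cls_rep] at h
  rw [h, cobd]
  refine Finset.sum_congr rfl fun i _ => ?_
  by_cases hi : rep g i = none
  · have h1 := stars_update_some hi false
    have h2 := stars_update_some hi true
    rw [stars_rep] at h1 h2
    rw [dif_pos hi, if_pos hi, lift_of_stars (k := k) _ (by omega),
      lift_of_stars (k := k) _ (by omega), Fintype.sum_bool, add_comm]
  · simp [hi]

/-! ### Numbers of incidences and of faces -/

open Classical in
theorem card_inBoundary_up (hkl : k + 1 = l) (f : ProjFace N k) :
    #{q : ProjFace N l | InBoundary f q} = N - k := by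
  have h := sum_inBoundary_up (N := N) hkl (fun _ => 1) (stars_rep f)
  rw [cls_rep] at h
  rw [Finset.card_filter, h]
  simp only [dite_eq_ite]
  have := Finset.card_filter_add_card_filter_not (s := (univ : Finset (Fin N)))
    (fun i => rep f i = none)
  rw [← Finset.card_filter]
  rw [← stars_eq_card, stars_rep, Finset.card_univ, Fintype.card_fin] at this
  simp only [ne_eq]
  omega

open Classical in
theorem card_inBoundary_down (hkl : k + 1 = l) (hl : l < N) (g : ProjFace N l) :
    #{q : ProjFace N k | InBoundary q g} = 2 * l := by
  have h := sum_inBoundary_down (N := N) hkl hl (fun _ => 1) (stars_rep g)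
  rw [cls_rep] at h
  rw [Finset.card_filter, h]
  simp only [dite_eq_ite, sum_const, card_univ, Fintype.card_bool, smul_eq_mul]
  rw [← Finset.sum_filter, Finset.sum_const, ← stars_eq_card, stars_rep]
  simp [mul_comm]

theorem card_stars (M k : ℕ) : #{w : Word M | stars w = k} = M.choose k * 2 ^ (M - k) := by
  induction M generalizing k with
  | zero =>
    have : ∀ w : Word 0, stars w = 0 := fun w => by simp [stars_eq_card]
    cases k with
    | zero => simp [this]
    | succ k => simp [this]
  | succ M ih =>
    rw [Finset.card_filter, sum_slice 0]
    simp only [stars_insertNth, if_true, reduceCtorEq, if_false, zero_add]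
    simp only [← Finset.card_filter, ih]
    cases k with
    | zero => simp [pow_succ, mul_two]
    | succ k =>
      simp only [add_comm 1, Nat.add_right_cancel_iff, ih]
      rw [Nat.choose_succ_succ, Nat.add_sub_add_right]
      rcases Nat.lt_or_ge k M with h | h
      · obtain ⟨j, rfl⟩ := Nat.exists_eq_add_of_lt h
        have e1 : k + j + 1 - (k + 1) = j := by omega
        have e2 : k + j + 1 - k = j + 1 := by omega
        rw [e1, e2, pow_succ]; ring
      · rw [Nat.choose_eq_zero_of_lt (by omega : M < k + 1)]; simp

theorem two_mul_card_projFace (hk : k < N) :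
    2 * Fintype.card (ProjFace N k) = N.choose k * 2 ^ (N - k) := by
  rw [← card_stars, Finset.card_filter, ← Finset.sum_filter]
  rw [← sum_rep_add_antipode hk (fun _ => 1)]
  simp [mul_comm]

end Proj

/-! ### Logical operators of the projective code -/

section Logical

variable {M : ℕ}

/-! ### Cocycles for the logical operators of type X -/

def starSet (w : Word M) : Finset (Fin M) := {i | w i = none}

theorem mem_starSet {w : Word M} {i : Fin M} : i ∈ starSet w ↔ w i = none := by simp [starSet]

theorem card_starSet (w : Word M) : #(starSet w) = stars w := (stars_eq_card w).symm

theorem starSet_antipode (w : Word M) : starSet (antipode w) = starSet w := by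
  ext i; simp [mem_starSet, antipode_eq_none]

theorem starSet_update_some (w : Word M) (i : Fin M) (x : Bool) :
    starSet (Function.update w i (some x)) = (starSet w).erase i := by
  ext j
  rcases eq_or_ne j i with rfl | h <;> simp_all [mem_starSet]

/-- The cochain of all faces with a given set of free coordinates. -/
def starChain (A : Finset (Fin M)) : Chain M := fun w => if starSet w = A then 1 else 0

theorem isInvariant_starChain (A : Finset (Fin M)) : IsInvariant (starChain A) := fun w => by
  rw [starChain, starSet_antipode]; rfl

def bit : Option Bool → ZMod 2
  | some true => 1
  | _ => 0

/-- A cochain whose coboundary compares the free sets `insert i C` and `insert j C`. -/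
def swapChain (C : Finset (Fin M)) (i j : Fin M) : Chain M := fun w =>
  if starSet w = C then bit (w i) + bit (w j) else 0

theorem zmod_two_add_self (x : ZMod 2) : x + x = 0 := CharTwo.add_self_eq_zero x

/-- The antipode changes both bits, so their sum is unchanged; a single bit would not be invariant.
-/
theorem isInvariant_swapChain {C : Finset (Fin M)} {i j : Fin M} (hi : i ∉ C) (hj : j ∉ C) :
    IsInvariant (swapChain C i j) := fun w => by
  rw [swapChain, swapChain, starSet_antipode]
  split_ifs with h
  · have key : ∀ x : Option Bool, x ≠ none → bit (x.map not) = bit x + 1 := by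
      rintro (_ | _ | _) h
      · exact absurd rfl h
      · simp [bit]
      · simp [bit]; rfl
    have h1 : w i ≠ none := fun h' => hi (h ▸ mem_starSet.2 h')
    have h2 : w j ≠ none := fun h' => hj (h ▸ mem_starSet.2 h')
    rw [antipode, antipode, key _ h1, key _ h2]
    have := zmod_two_add_self 1
    linear_combination this
  · rfl

theorem hasDegree_swapChain (C : Finset (Fin M)) (i j : Fin M) :
    HasDegree #C (swapChain C i j) := fun w hw => by
  rw [swapChain] at hw
  rw [← card_starSet, (ite_ne_right_iff.1 hw).1]

/-- Summing over the two values of a freed coordinate detects dependence on that coordinate, and the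
cochain depends only on the bits `i` and `j`. Hence exchanging one free coordinate does not change
the cohomology class. -/
theorem cobd_swapChain {C : Finset (Fin M)} {i j : Fin M} (hij : i ≠ j) (hi : i ∉ C)
    (hj : j ∉ C) :
    cobd (swapChain C i j) = starChain (insert i C) + starChain (insert j C) := by
  funext w
  have key : ∀ s, (if w s = none then swapChain C i j (Function.update w s (some false)) +
      swapChain C i j (Function.update w s (some true)) else 0) =
      (if s = i then starChain (insert i C) w else 0) +
        (if s = j then starChain (insert j C) w else 0) := by
    intro s
    have hins : ∀ t, t ∉ C → w t = none → ((starSet w).erase t = C ↔ starSet w = insert t C) := by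
      intro t ht hw
      constructor
      · rintro rfl; rw [insert_erase (mem_starSet.2 hw)]
      · intro h; rw [h, erase_insert ht]
    have hno : ∀ t, w t ≠ none → starChain (insert t C) w = 0 := by
      intro t ht
      rw [starChain, if_neg]
      intro h
      exact ht (mem_starSet.1 (h ▸ mem_insert_self t C))
    by_cases hs : w s = none
    · rw [if_pos hs]
      simp only [swapChain, starSet_update_some]
      rcases eq_or_ne s i with rfl | hsi
      · rw [if_pos rfl, if_neg hij, starChain]
        simp [hins s hi hs, hij.symm, show bit (some false) = 0 from rfl,
          show bit (some true) = 1 from rfl]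
        split_ifs
        · have := zmod_two_add_self (bit (w j))
          linear_combination this
        · rfl
      · rcases eq_or_ne s j with rfl | hsj
        · rw [if_pos rfl, if_neg hij.symm, starChain]
          simp [hins s hj hs, hij, show bit (some false) = 0 from rfl,
            show bit (some true) = 1 from rfl]
          split_ifs
          · have := zmod_two_add_self (bit (w i))
            linear_combination this
          · rfl
        · simp only [if_neg hsi, if_neg hsj, Function.update_of_ne (Ne.symm hsi),
            Function.update_of_ne (Ne.symm hsj)]
          rw [zmod_two_add_self, add_zero]
    · rw [if_neg hs]
      rcases eq_or_ne s i with rfl | hsi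
      · rw [if_pos rfl, if_neg hij, hno s hs, add_zero]
      · rcases eq_or_ne s j with rfl | hsj
        · rw [if_pos rfl, if_neg hij.symm, hno s hs, add_zero]
        · rw [if_neg hsi, if_neg hsj, add_zero]
  rw [cobd, Finset.sum_congr rfl fun s _ => key s, Finset.sum_add_distrib]
  simp

/-! ### Cycles for the logical operators of type Z -/

/-- Each set of free coordinates has exactly one face in this chain. -/
def halfChain : (M : ℕ) → Chain M
  | 0 => 1
  | M + 1 => glue 0 (halfChain M) 0 (flipAll (halfChain M))

/-- The chain is a hemisphere in each degree: the boundary of one hemisphere is the whole sphere one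
dimension lower. Thus the chain plus its antipode is an invariant cycle; in the quotient it plays
the role of a projective subspace. -/
theorem bd_halfChain : ∀ M : ℕ, bd (halfChain M) = halfChain M + flipAll (halfChain M)
  | 0 => by
    funext w
    simp [bd, halfChain, flipAll, zmod_two_add_self]
  | M + 1 => by
    have hf : flipAll (halfChain (M + 1)) =
        glue 0 0 (flipAll (halfChain M)) (halfChain M) := by
      refine ext_slice 0 fun x => ?_
      rw [slice_flipAll]
      rcases x with _ | _ | _ <;> simp [halfChain, flipAll_flipAll]
      rfl
    have hs : ∀ x (a b : Chain (M + 1)), slice 0 x (a + b) = slice 0 x a + slice 0 x b :=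
      fun _ _ _ => rfl
    refine ext_slice 0 fun x => ?_
    rw [hs, hf]
    rcases x with _ | _ | _
    · rw [slice_none_bd]
      simp only [halfChain, slice_glue_none]
      rw [bd_flipAll, bd_halfChain M, flipAll_add, flipAll_flipAll]
    · rw [slice_some_bd]
      simp only [halfChain, slice_glue_none, slice_glue_false]
      rw [bd_halfChain M, add_left_comm, chain_add_self]
    · rw [slice_some_bd]
      simp only [halfChain, slice_glue_none, slice_glue_true]
      rw [bd_zero, add_zero, zero_add]

/-- The intersection number that makes the logical operators anticommute. -/
theorem sum_starChain_mul_halfChain : ∀ {M : ℕ} (A : Finset (Fin M)),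
    ∑ w, starChain A w * halfChain M w = 1
  | 0, A => by
    rw [Fintype.sum_unique]
    simp [starChain, halfChain, Finset.eq_empty_of_isEmpty]
  | M + 1, A => by
    have hA : ∀ (x : Option Bool) (w : Word M), starSet ((0 : Fin (M + 1)).insertNth x w) = A ↔
        (x = none ↔ 0 ∈ A) ∧ starSet w = ({i | i.succ ∈ A} : Finset (Fin M)) := by
      intro x w
      simp only [Finset.ext_iff, mem_starSet, Fin.forall_fin_succ, mem_filter, mem_univ, true_and]
      simp
    have hh : ∀ (x : Option Bool) (w : Word M), halfChain (M + 1) ((0 : Fin (M + 1)).insertNth x w)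
        = slice 0 x (halfChain (M + 1)) w := fun _ _ => rfl
    rw [sum_slice 0]
    simp only [starChain, hA, hh]
    simp only [halfChain, slice_glue_none, slice_glue_false, slice_glue_true]
    have ih := sum_starChain_mul_halfChain ({i | i.succ ∈ A} : Finset (Fin M))
    by_cases h0 : (0 : Fin (M + 1)) ∈ A
    · simp only [h0, true_and, reduceCtorEq, false_iff, not_true, false_and, if_false, zero_mul,
        Finset.sum_const_zero, add_zero]
      have e : Function.Involutive (antipode : Word M → Word M) := antipode_antipode_word
      refine Eq.trans ?_ ih
      rw [← Equiv.sum_comp e.toPerm]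
      refine Finset.sum_congr rfl fun w _ => ?_
      simp only [Function.Involutive.coe_toPerm, starSet_antipode, flipAll, antipode_antipode_word,
        starChain]
    · simp only [h0, true_and, reduceCtorEq, iff_false, not_true, false_and, if_false, zero_mul,
        Finset.sum_const_zero, Pi.zero_apply, mul_zero, add_zero, zero_add]
      exact ih

/-- Complementing the entries at the coordinates selected by `v`. -/
def twist (v : Fin M → Bool) (w : Word M) : Word M := fun i => (w i).map (xor (v i))

theorem antipode_twist (v : Fin M → Bool) (w : Word M) :
    antipode (twist v w) = twist v (antipode w) := by
  funext i
  simp only [antipode, twist, Option.map_map]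
  congr 1
  funext x
  cases x <;> cases v i <;> rfl

/-- Only one face of the half chain has the free set of `w`. It determines `v` on the fixed
coordinates, while the values of `v` on the free ones are arbitrary. -/
theorem card_twist_halfChain_le : ∀ {M : ℕ} (w : Word M),
    #{v : Fin M → Bool | halfChain M (twist v w) ≠ 0} ≤ 2 ^ stars w
  | 0, w => by
    refine (card_le_univ _).trans ?_
    simp [Nat.one_le_two_pow]
  | M + 1, w => by
    obtain ⟨⟨x, f⟩, rfl⟩ := (Fin.insertNthEquiv (fun _ => Option Bool) (0 : Fin (M + 1))).surjective w
    change #{v : Fin (M + 1) → Bool | halfChain (M + 1) (twist v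
      ((0 : Fin (M + 1)).insertNth x f)) ≠ 0} ≤ 2 ^ stars ((0 : Fin (M + 1)).insertNth x f : Word _)
    rw [Finset.card_filter, ← (Fin.insertNthEquiv (fun _ => Bool) (0 : Fin (M + 1))).sum_comp,
      Fintype.sum_prod_type]
    have ht : ∀ (b : Bool) (v : Fin M → Bool), twist ((0 : Fin (M + 1)).insertNth b v)
        ((0 : Fin (M + 1)).insertNth x f) =
        (0 : Fin (M + 1)).insertNth (x.map (xor b)) (twist v f) := by
      intro b v
      funext i
      refine Fin.cases ?_ (fun i => ?_) i <;> simp [twist]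
    have hh : ∀ (x : Option Bool) (w : Word M), halfChain (M + 1) ((0 : Fin (M + 1)).insertNth x w)
        = slice 0 x (halfChain (M + 1)) w := fun _ _ => rfl
    change ∑ b : Bool, ∑ v : Fin M → Bool, (if halfChain (M + 1) (twist
      ((0 : Fin (M + 1)).insertNth b v) ((0 : Fin (M + 1)).insertNth x f)) ≠ 0 then 1 else 0) ≤ _
    simp only [ht, hh, stars_insertNth, Fintype.sum_bool]
    have ih := card_twist_halfChain_le f
    have ih' := card_twist_halfChain_le (antipode f)
    rw [Finset.card_filter] at ih ih'
    rw [stars_antipode] at ih'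
    rcases x with _ | _ | _
    · simp only [Option.map_none, if_true, halfChain, slice_glue_none, flipAll, antipode_twist]
      rw [pow_add]; omega
    · simpa [halfChain] using ih
    · simpa [halfChain] using ih

/-- The invariant cycle formed by the half chain and its antipode, translated by `v`. -/
def twistCycle (v : Fin M → Bool) : Chain M := fun w =>
  halfChain M (twist v w) + halfChain M (antipode (twist v w))

theorem isInvariant_twistCycle (v : Fin M → Bool) : IsInvariant (twistCycle v) := fun w => by
  rw [twistCycle, ← antipode_twist, antipode_antipode_word, add_comm]; rfl

theorem card_twistCycle_le (w : Word M) :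
    #{v : Fin M → Bool | twistCycle v w ≠ 0} ≤ 2 ^ (stars w + 1) := by
  have h1 := card_twist_halfChain_le w
  have h2 := card_twist_halfChain_le (antipode w)
  rw [stars_antipode] at h2
  have : ({v : Fin M → Bool | twistCycle v w ≠ 0} : Finset _) ⊆
      ({v : Fin M → Bool | halfChain M (twist v w) ≠ 0} : Finset _) ∪
      ({v : Fin M → Bool | halfChain M (twist v (antipode w)) ≠ 0} : Finset _) := by
    intro v hv
    simp only [mem_filter, mem_univ, true_and, mem_union] at hv ⊢
    by_contra h
    push Not at h
    rw [twistCycle, antipode_twist, h.1, h.2] at hv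
    simp at hv
  refine (card_le_card this).trans ((card_union_le _ _).trans ?_)
  rw [pow_succ]; omega

theorem twist_update (v : Fin M → Bool) (w : Word M) (i : Fin M) (x : Option Bool) :
    twist v (Function.update w i x) = Function.update (twist v w) i (x.map (xor (v i))) := by
  funext j
  rcases eq_or_ne j i with rfl | h <;> simp_all [twist]

theorem bd_comp_twist (b : Chain M) (v : Fin M → Bool) :
    bd (fun w => b (twist v w)) = fun w => bd b (twist v w) := by
  funext w
  refine Finset.sum_congr rfl fun i _ => ?_
  simp only [twist_update, Option.map_none]
  have : twist v w i = none ↔ w i = none := by simp [twist]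
  simp only [this]

theorem bd_twistCycle (v : Fin M → Bool) : bd (twistCycle v) = 0 := by
  have h : bd (halfChain M + flipAll (halfChain M)) = 0 := by
    rw [← bd_halfChain, bd_bd]
  have := bd_comp_twist (halfChain M + flipAll (halfChain M)) v
  rw [h] at this
  exact this

/-- The cone over a coordinate direction. -/
def cone (i : Fin M) (b : Chain M) : Chain M := fun w =>
  if w i = none then b (Function.update w i (some false)) + b (Function.update w i (some true))
  else 0

theorem IsInvariant.cone {b : Chain M} (hb : IsInvariant b) (i : Fin M) :
    IsInvariant (cone i b) := fun w => by
  have h : ∀ x : Bool, b (Function.update (antipode w) i (some x)) =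
      b (Function.update w i (some (!x))) := fun x => by
    rw [← hb, antipode_update, antipode_antipode_word]; rfl
  simp only [ThermalTQO.cone, antipode_eq_none, h, Bool.not_false, Bool.not_true]
  split_ifs
  · rw [add_comm]
  · rfl

/-- The cone is the prism swept between a cycle and its mirror image in direction `i`. -/
theorem bd_cone {b : Chain M} (hb : bd b = 0) (i : Fin M) :
    bd (cone i b) = fun w => b w + b (Function.update w i ((w i).map not)) := by
  cases M with
  | zero => exact i.elim0
  | succ M =>
    have hup : ∀ (x y : Option Bool) (f : Word M), slice i x
        (fun w => b w + b (Function.update w i ((w i).map not))) f =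
        slice i x b f + slice i (x.map not) b f := by
      intro x y f
      simp only [slice, update_insertNth_self, Fin.insertNth_apply_same]
    have hcn : slice i none (cone i b) = slice i (some false) b + slice i (some true) b := by
      funext f
      simp [slice, cone]
    have hcs : ∀ x : Bool, slice i (some x) (cone i b) = 0 := by
      intro x; funext f; simp [slice, cone]
    have hbs : ∀ x : Bool, bd (slice i (some x) b) = slice i none b := by
      intro x
      have := slice_some_bd i x b
      rw [hb] at this
      exact (chain_add_eq_zero.1 this.symm).symm
    refine ext_slice i fun x => ?_
    funext f
    rw [hup x x]
    rcases x with _ | x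
    · rw [slice_none_bd, hcn, bd_add, hbs, hbs, chain_add_self]
      simp [zmod_two_add_self]
    · rw [slice_some_bd, hcn, hcs, bd_zero, add_zero]
      cases x
      · rfl
      · rw [add_comm]; rfl

/-- With `bd_cone`, this shows that changing one bit of `v` gives a homologous cycle. -/
theorem twistCycle_update (v : Fin M → Bool) (i : Fin M) (w : Word M) :
    twistCycle (Function.update v i (!v i)) w =
      twistCycle v (Function.update w i ((w i).map not)) := by
  have : twist (Function.update v i (!v i)) w = twist v (Function.update w i ((w i).map not)) := by
    rw [twist_update]
    funext j
    rcases eq_or_ne j i with rfl | h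
    · simp only [twist, Function.update_self, Option.map_map]
      congr 1; funext x; cases x <;> cases v j <;> rfl
    · simp [twist, h]
  rw [twistCycle, twistCycle, this]

end Logical

section Code

/-! ### The projective code -/

theorem bd_lift_proj {N k l : ℕ} (hkl : k + 1 = l) {B : Chain N} (hB : IsInvariant B) {w : Word N}
    (hw : stars w = k) : bd (lift (proj l B)) w = bd B w := by
  refine Finset.sum_congr rfl fun i _ => ?_
  split_ifs with h
  · rfl
  · rw [lift_proj_of_stars hB (by rw [stars_update_none h, hw, hkl])]

/-- Boundary and coboundary are transposes of each other, also on the projective cube. -/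
theorem sum_cobd_mul {N k l : ℕ} (hkl : k + 1 = l) (hl : l < N) (y : ProjFace N k → ZMod 2)
    (b : ProjFace N l → ZMod 2) :
    ∑ q, cobd (lift y) (rep q) * b q = ∑ f, y f * bd (lift b) (rep f) := by
  classical
  simp only [← sum_inBoundary_cobd hkl hl, ← sum_inBoundary_bd hkl, Finset.sum_mul,
    Finset.mul_sum]
  rw [Finset.sum_comm]
  refine Finset.sum_congr rfl fun f _ => Finset.sum_congr rfl fun q _ => ?_
  split_ifs <;> simp

variable {p : ℕ}

theorem syn_inl (hp : 1 ≤ p) (P : Pauli (Qubit p)) (f : ProjFace (2 * p) (p - 1)) :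
    syn checkPauli P (.inl f) = bd (lift P.2) (rep f) := by
  classical
  rw [← sum_inBoundary_bd (by omega), syn, symp_eq_sum]
  refine Finset.sum_congr rfl fun q _ => ?_
  by_cases h : InBoundary f q <;> simp [checkPauli, InSupport, h]

theorem syn_inr (hp : 2 ≤ p) (P : Pauli (Qubit p)) (g : ProjFace (2 * p) (p + 1)) :
    syn checkPauli P (.inr g) = cobd (lift P.1) (rep g) := by
  classical
  rw [← sum_inBoundary_cobd (by omega) (by omega), syn, symp_eq_sum]
  refine Finset.sum_congr rfl fun q _ => ?_
  by_cases h : InBoundary q g <;> simp [checkPauli, InSupport, h]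

theorem violates_iff (P : Pauli (Qubit p)) (i : Check p) :
    Violates P i ↔ syn checkPauli P i ≠ 0 :=
  (Pauli.commute_iff _ _).not

/-- The only nontrivial pairing is between a check of each type, and it vanishes because the
coboundary squares to zero. -/
theorem compatible_checkPauli (hp : 2 ≤ p) : Compatible (checkPauli (p := p)) := by
  classical
  rintro (f | g) (f' | g') <;> simp only [checkPauli, zero_dotProduct, dotProduct_zero]
  have hlift : (fun q => if InSupport q (Sum.inl f' : Check p) then (1 : ZMod 2) else 0) =
      fun q => cobd (lift (Pi.single f' 1)) (rep q) := by
    funext q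
    rw [← sum_inBoundary_cobd (by omega) (by omega)]
    rw [Finset.sum_eq_single f' (fun f _ hf => by simp [hf]) (by simp)]
    by_cases h : InBoundary f' q <;> simp [InSupport, h]
  have hd : HasDegree p (cobd (lift (Pi.single f' 1 : ProjFace (2 * p) (p - 1) → ZMod 2))) := by
    have := (hasDegree_lift (Pi.single f' 1 : ProjFace (2 * p) (p - 1) → ZMod 2)).cobd
    rwa [Nat.sub_add_cancel (by omega)] at this
  have hi : IsInvariant (cobd (lift (Pi.single f' 1 : ProjFace (2 * p) (p - 1) → ZMod 2))) := by
    rw [isInvariant_iff, ← cobd_flipAll, isInvariant_iff.1 (isInvariant_lift _)]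
  have h := sum_inBoundary_cobd (by omega : p + 1 = p + 1) (by omega : p + 1 < 2 * p)
    (proj p (cobd (lift (Pi.single f' 1)))) g
  rw [lift_proj hi hd, cobd_cobd] at h
  rw [hlift, dotProduct]
  refine Eq.trans (Finset.sum_congr rfl fun q _ => ?_) h
  by_cases h : InBoundary q g <;> simp [InSupport, h, proj]

theorem inSupport_iff {q : Qubit p} {i : Check p} :
    InSupport q i ↔ q ∈ pauliSupp (checkPauli i) := by
  rw [mem_pauliSupp]
  rcases i with f | g <;> simp [checkPauli]

open Classical in
theorem card_inSupport_le (hp : 2 ≤ p) (i : Check p) :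
    #{q | InSupport q i} ≤ 2 * (p + 1) := by
  rcases i with f | g
  · have := card_inBoundary_up (N := 2 * p) (by omega : p - 1 + 1 = p) f
    change #{q | InBoundary f q} ≤ _
    omega
  · exact (card_inBoundary_down rfl (by omega) g).le

open Classical in
theorem card_checks_le (hp : 2 ≤ p) (q : Qubit p) : #{i : Check p | InSupport q i} ≤ 3 * p := by
  rw [Finset.card_filter, Fintype.sum_sum_type, ← Finset.card_filter, ← Finset.card_filter]
  change #{f : ProjFace (2 * p) (p - 1) | InBoundary f q} +
    #{g : ProjFace (2 * p) (p + 1) | InBoundary q g} ≤ _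
  have h1 := card_inBoundary_down (N := 2 * p) (by omega : p - 1 + 1 = p) (by omega) q
  have h2 := card_inBoundary_up (N := 2 * p) (rfl : p + 1 = p + 1) q
  omega

theorem two_mul_numQubits (hp : 1 ≤ p) : 2 * numQubits p = p.centralBinom * 2 ^ p := by
  rw [numQubits, two_mul_card_projFace (by omega), Nat.centralBinom,
    show 2 * p - p = p by omega]

/-- Both binomial coefficients next to the central one are `p / (p + 1)` times it; the powers of 2
contribute the factors 2 and 1/2. -/
theorem card_check (hp : 2 ≤ p) : 2 * (p + 1) * Fintype.card (Check p) = 5 * p * numQubits p := by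
  have h0 := two_mul_numQubits (by omega : 1 ≤ p)
  have h1 := two_mul_card_projFace (by omega : p - 1 < 2 * p)
  have h2 := two_mul_card_projFace (by omega : p + 1 < 2 * p)
  have hc : (2 * p).choose (p + 1) * (p + 1) = p.centralBinom * p := by
    rw [Nat.choose_succ_right_eq, Nat.centralBinom]; congr 1; omega
  have hs : (2 * p).choose (p - 1) = (2 * p).choose (p + 1) :=
    Nat.choose_symm_of_eq_add (by omega)
  rw [hs, show 2 * p - (p - 1) = p + 1 by omega] at h1
  obtain ⟨k, rfl⟩ := Nat.exists_eq_add_of_le' (by omega : 1 ≤ p)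
  rw [show 2 * (k + 1) - (k + 1 + 1) = k by omega] at h2
  rw [Fintype.card_sum]
  have h3 : 2 * (2 * (k + 1 + 1) * (Fintype.card (ProjFace (2 * (k + 1)) (k + 1 - 1)) +
      Fintype.card (ProjFace (2 * (k + 1)) (k + 1 + 1)))) =
      2 * (5 * (k + 1) * numQubits (k + 1)) := by
    have e : 2 * (2 * (k + 1 + 1) * (Fintype.card (ProjFace (2 * (k + 1)) (k + 1 - 1)) +
      Fintype.card (ProjFace (2 * (k + 1)) (k + 1 + 1)))) = 2 * (k + 1 + 1) *
      (2 * Fintype.card (ProjFace (2 * (k + 1)) (k + 1 - 1)) +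
      2 * Fintype.card (ProjFace (2 * (k + 1)) (k + 1 + 1))) := by ring
    have e' : 2 * (5 * (k + 1) * numQubits (k + 1)) =
      5 * (k + 1) * (2 * numQubits (k + 1)) := by ring
    rw [e, e', h0, h1, h2]
    calc _ = ((2 * (k + 1)).choose (k + 1 + 1) * (k + 1 + 1)) * (2 * 5 * 2 ^ k) := by
          simp only [pow_succ]; ring
      _ = _ := by rw [hc]; simp only [pow_succ]; ring
  omega

/-! Soundness -/

theorem card_pauliSupp_le (P : Pauli (Qubit p)) :
    (pauliSupp P).card ≤ #{q | P.1 q ≠ 0} + #{q | P.2 q ≠ 0} := by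
  refine le_trans (card_le_card fun q hq => ?_) (card_union_le _ _)
  simpa [mem_pauliSupp] using hq

theorem isInvariant_cobd {N : ℕ} {a : Chain N} (ha : IsInvariant a) : IsInvariant (cobd a) := by
  rw [isInvariant_iff, ← cobd_flipAll, isInvariant_iff.1 ha]

theorem isInvariant_bd {N : ℕ} {a : Chain N} (ha : IsInvariant a) : IsInvariant (bd a) := by
  rw [isInvariant_iff, ← bd_flipAll, isInvariant_iff.1 ha]

theorem size_eq_two_mul {N k : ℕ} (hk : k < N) {a : Chain N} (ha : IsInvariant a)
    (hd : HasDegree k a) : size a = 2 * #{q : ProjFace N k | a (rep q) ≠ 0} := by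
  conv_lhs => rw [← lift_proj ha hd]
  exact size_lift hk _

/-- The two parts of `P` are replaced independently by a small invariant filling and cofilling with
the same syndrome. The factor 2 between chains and projective faces cancels. -/
theorem reducedWeight_le (hp : 2 ≤ p) (P : Pauli (Qubit p)) :
    reducedWeight P ≤ (p + 1) * {j | Violates P j}.ncard := by
  classical
  have hi1 := isInvariant_lift P.1
  have hd1 := hasDegree_lift P.1
  have hi2 := isInvariant_lift P.2
  have hd2 : HasDegree (p - 1 + 1) (lift P.2) := by
    rw [Nat.sub_add_cancel (by omega)]; exact hasDegree_lift P.2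
  obtain ⟨c, hci, hcd, hcc, hcs⟩ := exists_invariant_cofilling p _ hi1 hd1
  obtain ⟨c', hci', hcd', hcc', hcs'⟩ :=
    exists_invariant_filling (p - 1) _ hi2 hd2 (by omega)
  have hbd := hd2.bd
  rw [Nat.sub_add_cancel (by omega)] at hcd' hcs'
  have hV : {j | Violates P j}.ncard = #{f : ProjFace (2 * p) (p - 1) | bd (lift P.2) (rep f) ≠ 0} +
      #{g : ProjFace (2 * p) (p + 1) | cobd (lift P.1) (rep g) ≠ 0} := by
    rw [Set.ncard_eq_toFinset_card', Set.toFinset_ofPred, Finset.card_filter,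
      Fintype.sum_sum_type, ← Finset.card_filter, ← Finset.card_filter]
    simp only [violates_iff, syn_inl (by omega : 1 ≤ p), syn_inr hp]
  rw [size_eq_two_mul (by omega) hci hcd,
    size_eq_two_mul (by omega) (isInvariant_cobd hi1) hd1.cobd] at hcs
  rw [size_eq_two_mul (by omega) hci' hcd',
    size_eq_two_mul (by omega) (isInvariant_bd hi2) hbd] at hcs'
  set z : Pauli (Qubit p) := (proj p c, proj p c') with hz
  have hmem : z.weight ∈ {w | ∃ z : Pauli (Qubit p), (∀ i, ¬ Violates z i) ∧
      w = (P + z).weight} := by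
    refine ⟨P + z, fun i => ?_, ?_⟩
    · rw [violates_iff, not_not, syn_add]
      rcases i with f | g
      · rw [Pi.add_apply, syn_inl (by omega), syn_inl (by omega), hz]
        simp only
        rw [lift_proj hci' hcd', hcc', zmod_two_add_self]
      · rw [Pi.add_apply, syn_inr hp, syn_inr hp, hz]
        simp only
        rw [lift_proj hci hcd, hcc, zmod_two_add_self]
    · rw [← add_assoc, pauli_add_self, zero_add]
  have h1 : reducedWeight P ≤ z.weight := Nat.sInf_le hmem
  rw [weight_eq] at h1
  have h2 := card_pauliSupp_le z
  rw [hV, mul_add]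
  simp only [hz, proj] at h2
  set A := #{q : Qubit p | c (rep q) ≠ 0}
  set B := #{q : Qubit p | c' (rep q) ≠ 0}
  set X := #{f : ProjFace (2 * p) (p - 1) | bd (lift P.2) (rep f) ≠ 0}
  set Y := #{g : ProjFace (2 * p) (p + 1) | cobd (lift P.1) (rep g) ≠ 0}
  nlinarith

/-! Logical operators -/

theorem cobd_starChain (A : Finset (Fin (2 * p))) : cobd (starChain A) = 0 := by
  funext w
  refine Finset.sum_eq_zero fun i _ => ?_
  simp only [starChain, starSet_update_some, zmod_two_add_self, ite_self]

theorem hasDegree_starChain {A : Finset (Fin (2 * p))} (hA : #A = p) :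
    HasDegree p (starChain A) := fun w hw => by
  rw [← card_starSet, (ite_ne_right_iff.1 hw).1, hA]

def xLogical (A : Finset (Fin (2 * p))) : Pauli (Qubit p) := (proj p (starChain A), 0)

def zLogical (v : Fin (2 * p) → Bool) : Pauli (Qubit p) := (0, proj p (twistCycle v))

theorem syn_xLogical (hp : 2 ≤ p) {A : Finset (Fin (2 * p))} (hA : #A = p) :
    syn checkPauli (xLogical A) = 0 := by
  funext i
  rcases i with f | g
  · rw [syn_inl (by omega), xLogical]
    simp only
    rw [show lift (0 : Qubit p → ZMod 2) = 0 by funext w; simp [lift], bd_zero]; rfl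
  · rw [syn_inr hp, xLogical]
    simp only
    rw [lift_proj (isInvariant_starChain A) (hasDegree_starChain hA), cobd_starChain]
    rfl

theorem syn_zLogical (hp : 2 ≤ p) (v : Fin (2 * p) → Bool) :
    syn checkPauli (zLogical v) = 0 := by
  funext i
  rcases i with f | g
  · rw [syn_inl (by omega), zLogical]
    simp only
    rw [bd_lift_proj (by omega) (isInvariant_twistCycle v) (stars_rep f), bd_twistCycle]; rfl
  · rw [syn_inr hp, zLogical]
    simp only
    rw [show lift (0 : Qubit p → ZMod 2) = 0 by funext w; simp [lift], cobd_zero]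
    rfl

theorem symp_xLogical (A : Finset (Fin (2 * p))) (P : Pauli (Qubit p)) :
    symp (xLogical A) P = ∑ q, starChain A (rep q) * P.2 q := by
  simp [symp, xLogical, dotProduct, proj]

theorem symp_zLogical (v : Fin (2 * p) → Bool) (P : Pauli (Qubit p)) :
    symp (zLogical v) P = ∑ q, twistCycle v (rep q) * P.1 q := by
  simp [symp, zLogical, dotProduct, proj]

/-- Summing the cycle over classes is summing the half chain over all faces, which meets the cocycle
exactly once. -/
theorem symp_xLogical_zLogical (hp : 2 ≤ p) {A : Finset (Fin (2 * p))} (hA : #A = p) :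
    symp (xLogical A) (zLogical fun _ => false) = 1 := by
  rw [symp_xLogical, ← sum_starChain_mul_halfChain A]
  have ht : ∀ w : Word (2 * p), twist (fun _ => false) w = w := fun w => by
    funext i; cases h : w i <;> simp [twist, h]
  have h := sum_rep_add_antipode (by omega : p < 2 * p)
    (fun w => starChain A w * halfChain (2 * p) w)
  simp only [zLogical, proj, twistCycle, ht, mul_add]
  rw [Finset.sum_filter] at h
  refine Eq.trans (Finset.sum_congr rfl fun q _ => ?_) (h.trans (Finset.sum_congr rfl fun w _ => ?_))
  · simp only [isInvariant_starChain A _]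
  · split_ifs with hw
    · rfl
    · rw [starChain, if_neg, zero_mul]
      rintro rfl
      exact hw ((card_starSet w).symm.trans hA)

/-- The set of coordinates chosen by `ε` when they are grouped into pairs by `φ`. -/
def choiceSet (φ : Fin p × Bool ≃ Fin (2 * p)) (ε : Fin p → Bool) : Finset (Fin (2 * p)) :=
  {i | ε (φ.symm i).1 = (φ.symm i).2}

theorem mem_choiceSet (φ : Fin p × Bool ≃ Fin (2 * p)) (ε : Fin p → Bool) (k : Fin p) (b : Bool) :
    φ (k, b) ∈ choiceSet φ ε ↔ ε k = b := by simp [choiceSet]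

theorem card_choiceSet (φ : Fin p × Bool ≃ Fin (2 * p)) (ε : Fin p → Bool) :
    #(choiceSet φ ε) = p := by
  have : choiceSet φ ε = univ.map ⟨fun k => φ (k, ε k), fun k l h => by
      simpa using congrArg Prod.fst (φ.injective h)⟩ := by
    ext i
    obtain ⟨⟨k, b⟩, rfl⟩ := φ.surjective i
    rw [mem_choiceSet]
    simp only [mem_map, mem_univ, true_and]
    constructor
    · rintro rfl; exact ⟨k, rfl⟩
    · rintro ⟨a, ha⟩
      obtain ⟨rfl, rfl⟩ := Prod.mk.inj (φ.injective ha)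
      rfl
  rw [this, card_map, card_univ, Fintype.card_fin]

theorem choiceSet_injective (φ : Fin p × Bool ≃ Fin (2 * p)) :
    Function.Injective (choiceSet φ) := by
  intro ε ε' h
  funext k
  exact ((mem_choiceSet φ ε' k (ε k)).1 (h ▸ (mem_choiceSet φ ε k (ε k)).2 rfl)).symm

theorem choiceSet_update (φ : Fin p × Bool ≃ Fin (2 * p)) (ε : Fin p → Bool) (k : Fin p) :
    choiceSet φ (Function.update ε k (!ε k)) =
      insert (φ (k, !ε k)) ((choiceSet φ ε).erase (φ (k, ε k))) := by
  ext i
  obtain ⟨⟨l, b⟩, rfl⟩ := φ.surjective i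
  simp only [mem_choiceSet, mem_insert, mem_erase, ne_eq, EmbeddingLike.apply_eq_iff_eq,
    Prod.mk.injEq]
  rcases eq_or_ne l k with rfl | h
  · simp only [Function.update_self, true_and]
    cases ε l <;> cases b <;> simp
  · simp [h]

/-- Changing one choice swaps one free coordinate, so the cocycles differ by a coboundary, which
pairs to zero with an undetected error. -/
theorem symp_xLogical_choiceSet (hp : 2 ≤ p) (φ : Fin p × Bool ≃ Fin (2 * p)) {P : Pauli (Qubit p)}
    (hP : syn checkPauli P = 0) (ε ε' : Fin p → Bool) :
    symp (xLogical (choiceSet φ ε)) P = symp (xLogical (choiceSet φ ε')) P := by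
  refine eq_of_forall_update_eq (F := fun ε => symp (xLogical (choiceSet φ ε)) P)
    (fun ε k x => ?_) ε ε'
  rcases eq_or_ne x (ε k) with rfl | hx
  · simp
  obtain rfl : x = !ε k := by cases x <;> cases h : ε k <;> simp_all
  simp only [symp_xLogical]
  rw [choiceSet_update]
  set i := φ (k, ε k)
  set j := φ (k, !ε k)
  set C := (choiceSet φ ε).erase i
  have hij : i ≠ j := fun h => by simpa using congrArg Prod.snd (φ.injective h)
  have hi : i ∉ C := notMem_erase _ _
  have hj : j ∉ C := fun h => by
    have := (mem_choiceSet φ ε k _).1 (mem_of_mem_erase h)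
    simp at this
  have hmem : i ∈ choiceSet φ ε := (mem_choiceSet φ ε k _).2 rfl
  have hins : insert i C = choiceSet φ ε := insert_erase hmem
  have hC : #C = p - 1 := by rw [card_erase_of_mem hmem, card_choiceSet]
  have key := sum_cobd_mul (by omega : p - 1 + 1 = p) (by omega) (proj (p - 1) (swapChain C i j))
    P.2
  rw [lift_proj (isInvariant_swapChain hi hj) (hC ▸ hasDegree_swapChain C i j),
    cobd_swapChain hij hi hj, hins] at key
  simp only [← syn_inl (by omega : 1 ≤ p), hP, Pi.zero_apply, mul_zero, Finset.sum_const_zero,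
    Pi.add_apply, add_mul, Finset.sum_add_distrib] at key
  exact (CharTwo.add_eq_zero.1 key).symm

theorem symp_zLogical_eq (hp : 2 ≤ p) {P : Pauli (Qubit p)}
    (hP : syn checkPauli P = 0) (v v' : Fin (2 * p) → Bool) :
    symp (zLogical v) P = symp (zLogical v') P := by
  refine eq_of_forall_update_eq (F := fun v => symp (zLogical v) P)
    (fun v i x => ?_) v v'
  rcases eq_or_ne x (v i) with rfl | hx
  · simp
  obtain rfl : x = !v i := by cases x <;> cases h : v i <;> simp_all
  simp only [symp_zLogical]
  have key := sum_cobd_mul (by omega : p + 1 = p + 1) (by omega) P.1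
    (proj (p + 1) (cone i (twistCycle v)))
  simp only [← syn_inr hp, hP, Pi.zero_apply, zero_mul, Finset.sum_const_zero] at key
  have hb : ∀ q : Qubit p, bd (lift (proj (p + 1) (cone i (twistCycle v)))) (rep q) =
      twistCycle v (rep q) + twistCycle (Function.update v i (!v i)) (rep q) := fun q => by
    rw [bd_lift_proj rfl ((isInvariant_twistCycle v).cone i) (stars_rep q),
      bd_cone (bd_twistCycle v), twistCycle_update]
  simp only [hb, mul_comm (P.1 _), add_mul, Finset.sum_add_distrib] at key
  exact (CharTwo.add_eq_zero.1 key.symm).symm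

/-- The error must meet all `2 ^ p` equivalent operators, and their supports are disjoint because
their free sets differ. -/
theorem card_le_of_symp_xLogical_ne (hp : 2 ≤ p) (φ : Fin p × Bool ≃ Fin (2 * p))
    {P : Pauli (Qubit p)} (hP : syn checkPauli P = 0) (ε : Fin p → Bool)
    (h : symp (xLogical (choiceSet φ ε)) P ≠ 0) : 2 ^ p ≤ (pauliSupp P).card := by
  have hex : ∀ ε' : Fin p → Bool, ∃ q : Qubit p, q ∈ pauliSupp P ∧
      starSet (rep q) = choiceSet φ ε' := by
    intro ε'
    rw [symp_xLogical_choiceSet hp φ hP ε ε', symp_xLogical] at h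
    obtain ⟨q, -, hq⟩ := exists_ne_zero_of_sum_ne_zero h
    refine ⟨q, mem_pauliSupp.2 (Or.inr (right_ne_zero_of_mul hq)), ?_⟩
    exact (ite_ne_right_iff.1 (left_ne_zero_of_mul hq)).1
  choose g hg1 hg2 using hex
  have : #(univ : Finset (Fin p → Bool)) ≤ #(pauliSupp P) :=
    card_le_card_of_injOn g (fun ε _ => hg1 ε) fun ε₁ _ ε₂ _ h =>
      choiceSet_injective φ ((hg2 ε₁).symm.trans ((congrArg (fun q => starSet (rep q)) h).trans
        (hg2 ε₂)))
  simpa using this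

/-- The error must meet all `2 ^ (2 p)` translated cycles, and a face lies in at most `2 ^ (p + 1)`
of them. -/
theorem card_le_of_symp_zLogical_ne (hp : 2 ≤ p) {P : Pauli (Qubit p)}
    (hP : syn checkPauli P = 0) (v : Fin (2 * p) → Bool) (h : symp (zLogical v) P ≠ 0) :
    2 ^ (p - 1) ≤ (pauliSupp P).card := by
  have hex : ∀ v' : Fin (2 * p) → Bool,
      v' ∈ (pauliSupp P).biUnion fun q => {v' | twistCycle v' (rep q) ≠ 0} := by
    intro v'
    rw [symp_zLogical_eq hp hP v v', symp_zLogical] at h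
    obtain ⟨q, -, hq⟩ := exists_ne_zero_of_sum_ne_zero h
    exact mem_biUnion.2 ⟨q, mem_pauliSupp.2 (Or.inl (right_ne_zero_of_mul hq)),
      mem_filter.2 ⟨mem_univ _, left_ne_zero_of_mul hq⟩⟩
  have h1 : #(univ : Finset (Fin (2 * p) → Bool)) ≤ #(pauliSupp P) * 2 ^ (p + 1) :=
    (card_le_card fun v' _ => hex v').trans (card_biUnion_le_card_mul _ _ _ fun q _ => by
      simpa [stars_rep] using card_twistCycle_le (rep q))
  rw [card_univ, Fintype.card_fun, Fintype.card_bool, Fintype.card_fin] at h1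
  have h2 : 2 ^ (2 * p) = 2 ^ (p - 1) * 2 ^ (p + 1) := by rw [← pow_add]; congr 1; omega
  rw [h2] at h1
  exact Nat.le_of_mul_le_mul_right h1 (by positivity)

theorem exists_logical (hp : 2 ≤ p) : ∃ X Z : Pauli (Qubit p), syn checkPauli X = 0 ∧
    syn checkPauli Z = 0 ∧ symp X Z = 1 ∧ ∀ z, syn checkPauli z = 0 →
      (pauliSupp z).card < 2 ^ (p - 1) → symp X z = 0 ∧ symp Z z = 0 := by
  let φ : Fin p × Bool ≃ Fin (2 * p) := Fintype.equivOfCardEq (by simp [mul_comm])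
  refine ⟨xLogical (choiceSet φ fun _ => false), zLogical fun _ => false,
    syn_xLogical hp (card_choiceSet φ _), syn_zLogical hp _,
    symp_xLogical_zLogical hp (card_choiceSet φ _), fun z hz hc => ⟨?_, ?_⟩⟩
  · by_contra h
    have h1 := card_le_of_symp_xLogical_ne hp φ hz _ h
    have h2 : 2 ^ (p - 1) ≤ 2 ^ p := Nat.pow_le_pow_right (by norm_num) (by omega)
    omega
  · by_contra h
    have h1 := card_le_of_symp_zLogical_ne hp hz _ h
    omega

end Code

/-! ### Existence of amplifications -/

section Counting

open Classical in
-- Markov's inequality for the exponential moment of independent uniform draws. The sign of `θ`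
-- selects the upper or the lower tail, and multiplying by `Real.exp θ - 1` orients the hypothesis
-- accordingly.
theorem card_family_tail_le {β : Type*} [Fintype β] (B : Finset β) (X : ℕ) (θ x q : ℝ)
    (hB : (Real.exp θ - 1) * #B ≤ (Real.exp θ - 1) * q * Fintype.card β) :
    (#{F : Fin X → β | 0 ≤ θ * (#{j | F j ∈ B} - x)} : ℝ) ≤
      Fintype.card β ^ X * Real.exp (-θ * x + (Real.exp θ - 1) * q * X) := by
  have h1 : (#{F : Fin X → β | 0 ≤ θ * (#{j | F j ∈ B} - x)} : ℝ) ≤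
      ∑ F : Fin X → β, Real.exp (-θ * x) * ∏ j, Real.exp (if F j ∈ B then θ else 0) := by
    rw [Finset.card_filter]
    push_cast
    refine Finset.sum_le_sum fun F _ => ?_
    rw [← Real.exp_sum, ← Real.exp_add, ← Finset.sum_filter, Finset.sum_const, nsmul_eq_mul]
    split_ifs with h
    · exact Real.one_le_exp (by linarith)
    · exact (Real.exp_pos _).le
  refine h1.trans ?_
  rw [← Finset.mul_sum, ← Fintype.sum_pow (fun b => Real.exp (if b ∈ B then θ else 0)) X]
  have h2 : ∑ b : β, Real.exp (if b ∈ B then θ else 0) =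
      Fintype.card β + (Real.exp θ - 1) * #B := by
    have : ∀ b : β, Real.exp (if b ∈ B then θ else 0) =
        1 + (if b ∈ B then (Real.exp θ - 1) else 0) := fun b => by split_ifs <;> simp
    simp only [this, Finset.sum_add_distrib, Finset.sum_ite_mem, Finset.univ_inter,
      Finset.sum_const, nsmul_eq_mul, Finset.card_univ]
    ring
  have h3 : ∑ b : β, Real.exp (if b ∈ B then θ else 0) ≤
      Fintype.card β * Real.exp ((Real.exp θ - 1) * q) := by
    rw [h2]
    have := mul_le_mul_of_nonneg_left (Real.add_one_le_exp ((Real.exp θ - 1) * q))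
      (Nat.cast_nonneg (α := ℝ) (Fintype.card β))
    linarith
  have h4 := pow_le_pow_left₀ (Finset.sum_nonneg fun b _ => (Real.exp_pos _).le) h3 X
  refine (mul_le_mul_of_nonneg_left h4 (Real.exp_pos _).le).trans (le_of_eq ?_)
  rw [mul_pow, ← Real.exp_nat_mul, Real.exp_add, mul_comm (X : ℝ)]
  ring

open Classical in
theorem card_tuples_meeting {I : Type*} [Fintype I] (V : Finset I) (t : ℕ) :
    (#{b : Fin t → I | ∃ k, b k ∈ V} : ℝ) =
      (Fintype.card I : ℝ) ^ t - (Fintype.card I - #V : ℝ) ^ t := by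
  have h : #{b : Fin t → I | ∃ k, b k ∈ V} + #(Fintype.piFinset fun _ : Fin t => Vᶜ) =
      Fintype.card I ^ t := by
    have h1 := Finset.card_filter_add_card_filter_not (s := (univ : Finset (Fin t → I)))
      (fun b => ∃ k, b k ∈ V)
    rw [Finset.card_univ, Fintype.card_fun, Fintype.card_fin] at h1
    rw [← h1]
    congr 2
    ext b; simp
  rw [Fintype.card_piFinset_const, Finset.card_compl] at h
  have h' : (#{b : Fin t → I | ∃ k, b k ∈ V} : ℝ) + ((Fintype.card I - #V : ℕ) : ℝ) ^ t =
      (Fintype.card I : ℝ) ^ t := by exact_mod_cast h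
  rw [Nat.cast_sub (card_le_univ V)] at h'
  linarith

open Classical in
-- A random tuple misses `V` with probability at most `(1 - s u) ^ t ≤ exp (-u)`, and convexity
-- bounds `exp (-u)` by its chord on `[0, 1]`.
theorem card_tuples_meeting_ge {I : Type*} [Fintype I] (V : Finset I) (t : ℕ) {s u : ℝ}
    (hu : 0 ≤ u) (hu1 : u ≤ 1) (hV : s * u * Fintype.card I ≤ #V) (hs : 1 ≤ s * t) :
    (1 - Real.exp (-1)) * u * Fintype.card (Fin t → I) ≤ #{b : Fin t → I | ∃ k, b k ∈ V} := by
  rw [card_tuples_meeting, Fintype.card_fun, Fintype.card_fin]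
  set m : ℝ := ((Fintype.card I : ℕ) : ℝ)
  have hm : 0 ≤ m := Nat.cast_nonneg _
  have hVm : (#V : ℝ) ≤ m := Nat.cast_le.2 (card_le_univ V)
  have h1 : (m - #V) ≤ m * Real.exp (-(s * u)) := by
    have := mul_le_mul_of_nonneg_left (Real.add_one_le_exp (-(s * u))) hm
    linarith
  have h2 : (m - #V) ^ t ≤ m ^ t * Real.exp (-u) := by
    refine (pow_le_pow_left₀ (by linarith) h1 t).trans ?_
    rw [mul_pow, ← Real.exp_nat_mul]
    refine mul_le_mul_of_nonneg_left (Real.exp_le_exp.2 ?_) (by positivity)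
    nlinarith
  have h3 : Real.exp (-u) ≤ 1 - u + u * Real.exp (-1) := by
    have := convexOn_exp.2 (Set.mem_univ 0) (Set.mem_univ (-1)) (by linarith : 0 ≤ 1 - u) hu
      (by ring)
    simpa using this
  have h4 := mul_le_mul_of_nonneg_left h3 (pow_nonneg hm t)
  push_cast
  change _ * m ^ t ≤ _
  nlinarith

open Classical in
theorem card_tuples_meeting_le {I : Type*} [Fintype I] [Nonempty I] (V : Finset I) (t : ℕ) :
    (#{b : Fin t → I | ∃ k, b k ∈ V} : ℝ) ≤
      (t * #V / Fintype.card I) * Fintype.card (Fin t → I) := by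
  rw [card_tuples_meeting, Fintype.card_fun, Fintype.card_fin]
  set m : ℝ := ((Fintype.card I : ℕ) : ℝ) with hmdef
  have hm : 0 < m := by rw [hmdef]; exact_mod_cast Fintype.card_pos
  have hVm : (#V : ℝ) ≤ m := Nat.cast_le.2 (card_le_univ V)
  have h := one_add_mul_le_pow (a := -(#V / m : ℝ))
    (by have : (#V : ℝ) / m ≤ 1 := (div_le_one hm).2 hVm
        linarith) t
  have h1 : (m - #V) ^ t = m ^ t * (1 + -(#V / m : ℝ)) ^ t := by
    rw [← mul_pow]; congr 1; field_simp; ring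
  rw [h1]
  push_cast
  change _ ≤ _ * m ^ t
  have h2 := mul_le_mul_of_nonneg_left h (pow_pos hm t).le
  have h3 : (t * #V / m : ℝ) = t * (#V / m) := by ring
  rw [h3]
  nlinarith

theorem sum_pow_card_pauliSupp {Q : Type} [Fintype Q] [DecidableEq Q] (z : ℝ) :
    ∑ P : Pauli Q, z ^ (pauliSupp P).card = (1 + 3 * z) ^ Fintype.card Q := by
  have h : ∀ P : Pauli Q, z ^ (pauliSupp P).card =
      ∏ q, if P.1 q ≠ 0 ∨ P.2 q ≠ 0 then z else 1 := by
    intro P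
    rw [pauliSupp, ← Finset.prod_filter, Finset.prod_const]
  simp only [h]
  rw [← (Equiv.arrowProdEquivProdArrow Q (fun _ => ZMod 2) (fun _ => ZMod 2)).sum_comp]
  have h2 := Finset.prod_univ_sum (fun _ : Q => (univ : Finset (ZMod 2 × ZMod 2)))
    (fun _ x => if x.1 ≠ 0 ∨ x.2 ≠ 0 then z else 1)
  rw [Fintype.piFinset_univ] at h2
  refine Eq.trans ?_ (h2.symm.trans ?_)
  · rfl
  · rw [Finset.prod_const, Finset.card_univ]
    congr 1
    rw [Fintype.sum_prod_type]
    have : ∀ f : ZMod 2 → ℝ, ∑ x, f x = f 0 + f 1 := fun f => Fin.sum_univ_two f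
    simp [this]; ring

theorem exp_neg_one_le : Real.exp (-1) ≤ 0.3679 := by
  rw [Real.exp_neg]
  exact inv_le_of_inv_le₀ (by norm_num) (le_trans (by norm_num) Real.exp_one_gt_d9.le)

theorem exp_half_le : Real.exp (1 / 2) ≤ 1.65 := by
  have h : Real.exp (1 / 2) ^ 2 = Real.exp 1 := by rw [← Real.exp_nat_mul]; norm_num
  have he2 := Real.exp_one_lt_d9
  by_contra hcon
  push Not at hcon
  nlinarith

open Classical in
-- The mean is at least `(1 - 1/e) X u` and the threshold is `X u / e`. With `θ = -1` the exponent
-- gains `(1 - 1/e)² - 1/e`, slightly more than 0.03.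
theorem card_sparse_families_le {I : Type*} [Fintype I] (V : Finset I) (X t : ℕ) {s u : ℝ}
    (hu : 0 ≤ u) (hu1 : u ≤ 1) (hV : s * u * Fintype.card I ≤ #V) (hs : 1 ≤ s * t) :
    (#{F : Fin X → Fin t → I | #{j | ∃ k, F j k ∈ V} ≤ X * u * Real.exp (-1)} : ℝ) ≤
      Fintype.card (Fin t → I) ^ X * Real.exp (-(0.03 * (X * u))) := by
  have hge := card_tuples_meeting_ge V t hu hu1 hV hs
  have hem := exp_neg_one_le
  have hem0 := Real.exp_pos (-1)
  have h := card_family_tail_le ({b : Fin t → I | ∃ k, b k ∈ V} : Finset _) X (-1)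
    (X * u * Real.exp (-1)) ((1 - Real.exp (-1)) * u)
    (by rw [mul_assoc]; exact mul_le_mul_of_nonpos_left hge (by linarith))
  refine le_trans (le_of_eq ?_) (h.trans (mul_le_mul_of_nonneg_left (Real.exp_le_exp.2 ?_)
    (by positivity)))
  · congr 2
    ext F
    simp only [mem_filter, mem_univ, true_and]
    constructor <;> intro h <;> linarith
  · have hpos : 0 ≤ (X : ℝ) * u := by positivity
    have hc : 0.03 ≤ (1 - Real.exp (-1)) ^ 2 - Real.exp (-1) := by nlinarith
    have := mul_le_mul_of_nonneg_right hc hpos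
    linarith

open Classical in
theorem card_dense_families_le {I : Type*} [Fintype I] [Nonempty I] (V : Finset I) (X t : ℕ)
    {y μ : ℝ} (hμ : t * #V / Fintype.card I * X ≤ μ) :
    (#{F : Fin X → Fin t → I | y ≤ #{j | ∃ k, F j k ∈ V}} : ℝ) ≤
      Fintype.card (Fin t → I) ^ X * Real.exp (0.65 * μ - y / 2) := by
  have hle := card_tuples_meeting_le V t
  have hexp := exp_half_le
  have hexp1 : 1 ≤ Real.exp (1 / 2) := Real.one_le_exp (by norm_num)
  have h := card_family_tail_le ({b : Fin t → I | ∃ k, b k ∈ V} : Finset _) X (1 / 2)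
    y (t * #V / Fintype.card I)
    (by rw [mul_assoc]; exact mul_le_mul_of_nonneg_left hle (by linarith))
  refine le_trans (le_of_eq ?_) (h.trans (mul_le_mul_of_nonneg_left (Real.exp_le_exp.2 ?_)
    (by positivity)))
  · congr 2
    ext F
    simp only [mem_filter, mem_univ, true_and]
    constructor <;> intro h <;> linarith
  · have hq0 : 0 ≤ (t * #V / Fintype.card I : ℝ) * X := by positivity
    nlinarith

open Classical in
-- Union bound over uniformly random families. Failure at `E` has probability at most `z ^ |E|`, so
-- the errors contribute at most `(1 + 3 z) ^ n - 1`, which is small once `n z` is. Together with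
-- overloaded qubits, less than the whole is excluded.
theorem exists_family {I Q : Type} [Fintype I] [Nonempty I] [Fintype Q] [DecidableEq Q]
    (C : I → Pauli Q) (viol : Pauli Q → Finset I) (star : Q → Finset I) (X t : ℕ) {s y μ : ℝ}
    (hs : 1 ≤ s * t) (hQ : (0 : ℝ) < Fintype.card Q)
    (hviol : ∀ E, IsMin C E → s * (#(pauliSupp E) / Fintype.card Q) * Fintype.card I ≤ #(viol E))
    (hμ : ∀ q, t * #(star q) / Fintype.card I * X ≤ μ)
    (hX : Fintype.card Q * Real.exp (-(0.03 * (X / Fintype.card Q))) ≤ 1 / 100)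
    (hy : Fintype.card Q * Real.exp (0.65 * μ - y / 2) ≤ 1 / 4) :
    ∃ F : Fin X → Fin t → I,
      (∀ E, E ≠ 0 → IsMin C E → X * (#(pauliSupp E) / Fintype.card Q) * Real.exp (-1) ≤
        #{j | ∃ k, F j k ∈ viol E}) ∧ ∀ q, #{j | ∃ k, F j k ∈ star q} ≤ y := by
  let T : ℝ := (Fintype.card (Fin t → I) : ℝ) ^ X
  have hT : 0 < T := by
    have : (0 : ℝ) < Fintype.card (Fin t → I) := by exact_mod_cast Fintype.card_pos
    positivity
  let badE : Pauli Q → Finset (Fin X → Fin t → I) := fun E =>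
    {F | (E ≠ 0 ∧ IsMin C E) ∧ #{j | ∃ k, F j k ∈ viol E} ≤
      X * ((#(pauliSupp E) : ℝ) / Fintype.card Q) * Real.exp (-1)}
  let badq : Q → Finset (Fin X → Fin t → I) := fun q =>
    {F | y ≤ #{j | ∃ k, F j k ∈ star q}}
  let z : ℝ := Real.exp (-(0.03 * (X / Fintype.card Q)))
  have hz0 : 0 < z := Real.exp_pos _
  -- Subtracting `T` at `E = 0` removes the constant term of the generating function; without it the
  -- union bound would be useless.
  have hbadE : ∀ E, (#(badE E) : ℝ) ≤ T * z ^ #(pauliSupp E) - if E = 0 then T else 0 := by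
    intro E
    by_cases hE0 : E = 0
    · have h0 : pauliSupp (0 : Pauli Q) = ∅ := by
        ext q; simp [mem_pauliSupp]
      simp [badE, hE0, h0]
    rw [if_neg hE0, sub_zero]
    by_cases hE : IsMin C E
    · have h := card_sparse_families_le (viol E) X t (u := #(pauliSupp E) / Fintype.card Q)
        (by positivity) ((div_le_one hQ).2 (Nat.cast_le.2 (card_le_univ _))) (hviol E hE) hs
      have e : z ^ #(pauliSupp E) =
          Real.exp (-(0.03 * (X * (#(pauliSupp E) / Fintype.card Q)))) := by
        rw [← Real.exp_nat_mul]; congr 1; ring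
      rw [e]
      simpa only [badE, hE0, hE, ne_eq, not_false_iff, true_and] using h
    · simp only [badE, hE, and_false, false_and, Finset.filter_false, card_empty, Nat.cast_zero]
      positivity
  have hbadq : ∀ q, (#(badq q) : ℝ) ≤ T * Real.exp (0.65 * μ - y / 2) := fun q =>
    card_dense_families_le (star q) X t (hμ q)
  have hsumE : ∑ E, (#(badE E) : ℝ) ≤ T * (1 / 4) := by
    refine (Finset.sum_le_sum fun E _ => hbadE E).trans ?_
    rw [Finset.sum_sub_distrib, ← Finset.mul_sum, sum_pow_card_pauliSupp]
    simp only [Finset.sum_ite_eq', mem_univ, if_true]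
    have h2 : (1 + 3 * z) ^ Fintype.card Q ≤ Real.exp (Fintype.card Q * (3 * z)) := by
      rw [Real.exp_nat_mul]
      refine pow_le_pow_left₀ (by positivity) ?_ _
      linarith [Real.add_one_le_exp (3 * z)]
    have h3 : Fintype.card Q * z ≤ 1 / 100 := hX
    have hz1 : 0 ≤ Fintype.card Q * z := by positivity
    have h4 := Real.abs_exp_sub_one_le (x := Fintype.card Q * (3 * z))
      (by rw [abs_le]; constructor <;> linarith)
    have h5 := (abs_le.1 h4).2
    rw [abs_of_nonneg (by linarith)] at h5
    have h6 : (1 + 3 * z) ^ Fintype.card Q - 1 ≤ 1 / 4 := by linarith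
    nlinarith
  have hsumq : ∑ q, (#(badq q) : ℝ) ≤ T * (1 / 4) := by
    refine (Finset.sum_le_sum fun q _ => hbadq q).trans ?_
    rw [Finset.sum_const, nsmul_eq_mul, Finset.card_univ]
    nlinarith
  have hex : ∃ F : Fin X → Fin t → I, (∀ E, F ∉ badE E) ∧ ∀ q, F ∉ badq q := by
    by_contra hcon
    push Not at hcon
    have hsub : (univ : Finset (Fin X → Fin t → I)) ⊆ univ.biUnion badE ∪ univ.biUnion badq := by
      intro F _
      by_cases h : ∀ E, F ∉ badE E
      · obtain ⟨q, hq⟩ := hcon F h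
        exact mem_union_right _ (mem_biUnion.2 ⟨q, mem_univ _, hq⟩)
      · push Not at h
        obtain ⟨E, hE⟩ := h
        exact mem_union_left _ (mem_biUnion.2 ⟨E, mem_univ _, hE⟩)
    have h1 := (card_le_card hsub).trans ((card_union_le _ _).trans
      (add_le_add card_biUnion_le card_biUnion_le))
    have h2 : (#(univ : Finset (Fin X → Fin t → I)) : ℝ) ≤
        ∑ E, (#(badE E) : ℝ) + ∑ q, (#(badq q) : ℝ) := by
      exact_mod_cast h1
    have h3 : (#(univ : Finset (Fin X → Fin t → I)) : ℝ) = T := by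
      rw [Finset.card_univ, Fintype.card_fun, Fintype.card_fin]; push_cast; rfl
    linarith
  obtain ⟨F, hFE, hFq⟩ := hex
  refine ⟨F, fun E hE0 hE => ?_, fun q => ?_⟩
  · have h := hFE E
    simp only [badE, mem_filter, mem_univ, true_and, not_and, not_le] at h
    exact (h ⟨hE0, hE⟩).le
  · have h := hFq q
    simp only [badq, mem_filter, mem_univ, true_and, not_le] at h
    exact h.le

end Counting

section Amplification

variable {p : ℕ}

theorem reducedWeight_eq {P E : Pauli (Qubit p)} (hE : syn checkPauli E = syn checkPauli P)
    (hmin : IsMin checkPauli E) : reducedWeight P = (pauliSupp E).card := by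
  refine le_antisymm (Nat.sInf_le ⟨P + E, fun i => ?_, ?_⟩) (le_csInf ?_ ?_)
  · rw [violates_iff, not_not, syn_add, hE, Pi.add_apply, zmod_two_add_self]
  · rw [← add_assoc, pauli_add_self, zero_add, weight_eq]
  · exact ⟨_, 0, fun i => by rw [violates_iff, not_not, syn_zero]; rfl, rfl⟩
  · rintro _ ⟨z, hz, rfl⟩
    rw [weight_eq]
    refine hmin _ ?_
    have : syn checkPauli z = 0 := by
      funext i; simpa [violates_iff] using hz i
    rw [syn_add, this, add_zero, hE]

theorem violates_congr {P E : Pauli (Qubit p)} (hE : syn checkPauli E = syn checkPauli P)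
    (i : Check p) : Violates P i ↔ Violates E i := by
  rw [violates_iff, violates_iff, hE]

theorem numQubits_pos (hp : 1 ≤ p) : 0 < numQubits p := by
  have := two_mul_numQubits hp
  have h2 : 0 < p.centralBinom * 2 ^ p := Nat.mul_pos (Nat.centralBinom_pos p) (by positivity)
  omega

theorem card_check_pos (hp : 2 ≤ p) : 0 < Fintype.card (Check p) := by
  have h := card_check hp
  have h2 : 0 < 5 * p * numQubits p :=
    Nat.mul_pos (by omega) (numQubits_pos (by omega))
  exact Nat.pos_of_mul_pos_left (h ▸ h2)

theorem tupleSize_eq (p : ℕ) : tupleSize p = ⌈Real.log (numQubits p) ^ 2⌉₊ := by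
  rw [tupleSize, baseSoundness, one_div_one_div]

open Classical in
-- This bounds the expected number of tuples at a qubit: `ℓ ^ 2` draws per tuple, about `n ℓ ^ 4`
-- tuples, and a chance of at most `0.6 ℓ / n` per draw to hit one of the checks at `q`.
theorem mul_card_star_le (hp : 2 ≤ p) {ℓ t X : ℝ} (hl : 2 * (p : ℝ) + 3 ≤ ℓ) (hl10 : 10 ≤ ℓ)
    (htu : t ≤ ℓ ^ 2 + 1) (hX0 : 0 ≤ X) (hXu : X ≤ numQubits p * (ℓ ^ 4 + 1))
    (q : Qubit p) :
    t * #{i : Check p | InSupport q i} / Fintype.card (Check p) * X ≤ 0.7 * ℓ ^ 7 := by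
  have hst : (#{i : Check p | InSupport q i} : ℝ) ≤ 3 * p := by exact_mod_cast card_checks_le hp q
  have hcc : (2 * (p + 1) : ℝ) * Fintype.card (Check p) = 5 * p * numQubits p := by
    have h := congrArg (Nat.cast (R := ℝ)) (card_check hp)
    push_cast at h
    exact h
  have hn0 : (0 : ℝ) < numQubits p := Nat.cast_pos.2 (numQubits_pos (by omega))
  have hm : (0 : ℝ) < Fintype.card (Check p) := Nat.cast_pos.2 (card_check_pos hp)
  have hc0 : (0 : ℝ) ≤ #{i : Check p | InSupport q i} := Nat.cast_nonneg _
  generalize (#{i : Check p | InSupport q i} : ℝ) = c at *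
  generalize (Fintype.card (Check p) : ℝ) = m at *
  generalize (numQubits p : ℝ) = n at *
  have h1 : c / m ≤ 0.6 * ℓ / n := by
    rw [div_le_div_iff₀ hm hn0]
    have : 0.6 * (2 * (p + 1)) * m ≤ 0.6 * ℓ * m :=
      mul_le_mul_of_nonneg_right (by linarith) hm.le
    have h3 := mul_le_mul_of_nonneg_right hst hn0.le
    nlinarith
  calc t * c / m * X = t * (c / m) * X := by ring
    _ ≤ (ℓ ^ 2 + 1) * (0.6 * ℓ / n) * (n * (ℓ ^ 4 + 1)) := by
      have : 0 ≤ 0.6 * ℓ / n := by positivity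
      gcongr
    _ = (ℓ ^ 2 + 1) * (0.6 * ℓ) * (ℓ ^ 4 + 1) := by field_simp
    _ ≤ 0.7 * ℓ ^ 7 := by
      have hl0 : 0 ≤ ℓ := by linarith
      have a1 : ℓ ^ 2 + 1 ≤ 1.01 * ℓ ^ 2 := by nlinarith
      have a2 : ℓ ^ 4 + 1 ≤ 1.01 * ℓ ^ 4 := by nlinarith [pow_nonneg hl0 2]
      calc (ℓ ^ 2 + 1) * (0.6 * ℓ) * (ℓ ^ 4 + 1)
          ≤ (1.01 * ℓ ^ 2) * (0.6 * ℓ) * (1.01 * ℓ ^ 4) := by gcongr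
        _ = 0.61206 * ℓ ^ 7 := by ring
        _ ≤ 0.7 * ℓ ^ 7 := by
          have := pow_nonneg hl0 7
          linarith

theorem exp_neg_le_of_le {x y : ℝ} (h : y ≤ x) (hy : 0 ≤ y) : Real.exp (-x) ≤ 1 / (y + 1) := by
  rw [Real.exp_neg, one_div]
  exact inv_anti₀ (by linarith) ((Real.add_one_le_exp y).trans (Real.exp_le_exp.2 h))

open Classical in
theorem exists_isAmplification (hp : 2 ≤ p)
    (hs : HasSoundness (Violates (p := p)) (baseSoundness p))
    (hl : 2 * (p : ℝ) + 3 ≤ Real.log (numQubits p)) (hl10 : 10 ≤ Real.log (numQubits p)) :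
    ∃ F : TupleFamily p, IsAmplification F := by
  have hn0 : (0 : ℝ) < numQubits p := Nat.cast_pos.2 (numQubits_pos (by omega))
  obtain ⟨ℓ, hℓ⟩ : ∃ ℓ, ℓ = Real.log (numQubits p) := ⟨_, rfl⟩
  rw [← hℓ] at hl hl10
  have hn : (numQubits p : ℝ) = Real.exp ℓ := by rw [hℓ, Real.exp_log hn0]
  have hm : (0 : ℝ) < Fintype.card (Check p) := Nat.cast_pos.2 (card_check_pos hp)
  have : Nonempty (Check p) := Fintype.card_pos_iff.1 (card_check_pos hp)
  have hts := tupleSize_eq p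
  rw [← hℓ] at hts
  have htl : ℓ ^ 2 ≤ tupleSize p := hts ▸ Nat.le_ceil (ℓ ^ 2)
  have htu : (tupleSize p : ℝ) ≤ ℓ ^ 2 + 1 := hts ▸ (Nat.ceil_lt_add_one (by positivity)).le
  have hXe : numAmplified p = ⌈numQubits p * ℓ ^ 4⌉₊ := by rw [hℓ]; rfl
  have hXl : numQubits p * ℓ ^ 4 ≤ numAmplified p := hXe ▸ Nat.le_ceil _
  have hXu : (numAmplified p : ℝ) ≤ numQubits p * ℓ ^ 4 + 1 :=
    hXe ▸ (Nat.ceil_lt_add_one (by positivity)).le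
  have hn1 : (1 : ℝ) ≤ numQubits p := by rw [hn]; exact Real.one_le_exp (by linarith)
  have hXpos : (0 : ℝ) < numAmplified p := lt_of_lt_of_le (by positivity) hXl
  have hl0 : 0 ≤ ℓ := by linarith
  obtain ⟨F, hF1, hF2⟩ := exists_family (checkPauli (p := p)) (fun E => {i | Violates E i})
    (fun q => {i | InSupport q i}) (numAmplified p) (tupleSize p) (s := 1 / ℓ ^ 2) (y := ℓ ^ 7)
    (μ := 0.7 * ℓ ^ 7) (by
      rw [one_div, ← div_eq_inv_mul, one_le_div (by positivity)]; exact htl) hn0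
    (fun E hE => by
      have := hs E
      rw [reducedWeight_eq rfl hE, le_div_iff₀ hm, Set.ncard_eq_toFinset_card',
        Set.toFinset_ofPred] at this
      rw [hℓ]
      exact this)
    (mul_card_star_le hp hl hl10 htu (Nat.cast_nonneg _) (by linarith))
    (by
      change (numQubits p : ℝ) * Real.exp (-(0.03 * (numAmplified p / numQubits p))) ≤ _
      have h1 : ℓ ^ 4 ≤ (numAmplified p : ℝ) / numQubits p := by
        rw [le_div_iff₀ hn0]; linarith
      have h3 : (1000 : ℝ) ≤ ℓ ^ 3 := by
        have := pow_le_pow_left₀ (by norm_num) hl10 3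
        linarith
      have h4 : ℓ ^ 4 ≥ 1000 * ℓ := by
        have := mul_le_mul_of_nonneg_right h3 hl0
        linarith [pow_succ ℓ 3]
      refine le_trans (le_of_eq ?_) ((exp_neg_le_of_le (y := 99)
        (x := 0.03 * (numAmplified p / numQubits p) - ℓ) (by linarith) (by norm_num)).trans
          (by norm_num))
      conv_lhs => rw [hn, ← Real.exp_add, ← hn]
      congr 1
      ring)
    (by
      change (numQubits p : ℝ) * _ ≤ _
      -- The exponent is `0.65 * 0.7 - 1 / 2 = -0.045` times `ℓ ^ 7`, which easily beats the `n =
      -- exp ℓ` qubits.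
      have h6 : (1000000 : ℝ) ≤ ℓ ^ 6 := by
        have := pow_le_pow_left₀ (by norm_num) hl10 6
        linarith
      have h7 : ℓ ^ 7 ≥ 1000000 * ℓ := by
        have := mul_le_mul_of_nonneg_right h6 hl0
        linarith [pow_succ ℓ 6]
      rw [hn, ← Real.exp_add]
      refine le_trans (le_of_eq ?_) ((exp_neg_le_of_le (y := 3)
        (x := 0.045 * ℓ ^ 7 - ℓ) (by linarith) (by norm_num)).trans (by norm_num))
      congr 1
      ring)
  refine ⟨F, ⟨fun P => ?_, fun q => ?_⟩⟩
  · obtain ⟨E, hE, hmin⟩ := exists_isMin checkPauli P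
    rw [reducedWeight_eq hE hmin]
    by_cases hE0 : E = 0
    · have h0 : pauliSupp E = ∅ := by ext q; simp [mem_pauliSupp, hE0]
      rw [h0]
      simp only [card_empty, Nat.cast_zero, zero_div, mul_zero]
      positivity
    have h := hF1 E hE0 hmin
    have hset : ({j | ViolatesTuple F P j} : Set _).ncard =
        #{j | ∃ k, F j k ∈ ({i | Violates E i} : Finset _)} := by
      rw [Set.ncard_eq_toFinset_card', Set.toFinset_ofPred]
      congr 1
      ext j
      simp [ViolatesTuple, violates_congr hE]
    rw [hset, Fintype.card_fin, le_div_iff₀ hXpos, one_div, ← Real.exp_neg]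
    calc Real.exp (-1) * (#(pauliSupp E) / numQubits p) * numAmplified p
        = numAmplified p * (#(pauliSupp E) / numQubits p) * Real.exp (-1) := by ring
      _ ≤ _ := by convert h
  · have h := hF2 q
    have hset : ({j | ∃ k, InSupport q (F j k)} : Set _).ncard =
        #{j | ∃ k, F j k ∈ ({i | InSupport q i} : Finset _)} := by
      rw [Set.ncard_eq_toFinset_card', Set.toFinset_ofPred]
      congr 1
      ext j
      simp
    rw [hset, ← hℓ]
    refine Nat.cast_le.1 (le_trans ?_ (h.trans (Nat.le_ceil _)))
    exact le_of_eq (by congr!)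

end Amplification

/-! ### The terms of the amplified Hamiltonian -/

section Terms

variable {p : ℕ}

/-- The checks of the projective code that enter a term of the Hamiltonian. -/
def termChecks (F : TupleFamily p) : Check p ⊕ Fin (numAmplified p) → Finset (Check p)
  | .inl i => {i}
  | .inr j => univ.image (F j)

def termSupport (F : TupleFamily p) (t : Check p ⊕ Fin (numAmplified p)) : Finset (Qubit p) :=
  (termChecks F t).biUnion fun i => pauliSupp (checkPauli i)

theorem half_mul_one_add_sgn (x : ZMod 2) : (1 / 2 : ℂ) * (1 + sgn x) = if x = 0 then 1 else 0 := by
  rcases zmod_two_cases x with rfl | rfl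
  · rw [sgn_zero]; norm_num
  · rw [sgn_one]; norm_num

open Classical in
theorem amplifiedTerms_eq_fc (hC : Compatible (checkPauli (p := p))) (F : TupleFamily p)
    (t : Check p ⊕ Fin (numAmplified p)) :
    amplifiedTerms F t =
      fc hC (fun s => ((if ∃ i ∈ termChecks F t, s i ≠ 0 then 1 else 0 : ℝ) : ℂ)) := by
  rcases t with i | j
  · have h : (fun s : Check p → ZMod 2 =>
        ((if ∃ i' ∈ termChecks F (.inl i), s i' ≠ 0 then 1 else 0 : ℝ) : ℂ)) =
        (1 / 2 : ℂ) • (1 - fun s => sgn (s i)) := by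
      funext s
      simp only [termChecks, mem_singleton, exists_eq_left, Pi.smul_apply, Pi.sub_apply,
        Pi.one_apply, smul_eq_mul]
      rcases zmod_two_cases (s i) with h | h
      · simp [h, sgn_zero]
      · rw [h, sgn_one]; norm_num
    rw [h, map_smul, map_sub, map_one, fc_check]
    rfl
  · have h : (fun s : Check p → ZMod 2 =>
        ((if ∃ i' ∈ termChecks F (.inr j), s i' ≠ 0 then 1 else 0 : ℝ) : ℂ)) =
        1 - (List.ofFn fun k => (1 / 2 : ℂ) • (1 + fun s : Check p → ZMod 2 => sgn (s (F j k)))).prod := by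
      funext s
      rw [List.prod_ofFn]
      simp only [termChecks, mem_image, mem_univ, true_and, Pi.sub_apply, Pi.one_apply,
        Finset.prod_apply, Pi.smul_apply, Pi.add_apply, smul_eq_mul, half_mul_one_add_sgn,
        exists_exists_eq_and]
      by_cases hs : ∃ k, s (F j k) ≠ 0
      · obtain ⟨k, hk⟩ := hs
        rw [if_pos ⟨k, hk⟩, Finset.prod_eq_zero (mem_univ k) (if_neg hk)]
        simp
      · rw [if_neg hs]
        push Not at hs
        simp [hs]
    rw [h, map_sub, map_one, map_list_prod, List.map_ofFn]
    have hk : (fc hC ∘ fun k => (1 / 2 : ℂ) • (1 + fun s : Check p → ZMod 2 => sgn (s (F j k)))) =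
        fun k => (1 / 2 : ℂ) • (1 + checkOp (F j k)) := by
      funext k
      rw [Function.comp_apply, map_smul, map_add, map_one, fc_check]
      rfl
    rw [hk]
    rfl

theorem commute_amplifiedTerms (hp : 2 ≤ p) (F : TupleFamily p)
    (t t' : Check p ⊕ Fin (numAmplified p)) :
    Commute (amplifiedTerms F t) (amplifiedTerms F t') := by
  classical
  rw [amplifiedTerms_eq_fc (compatible_checkPauli hp), amplifiedTerms_eq_fc (compatible_checkPauli hp)]
  exact (Commute.all _ _).map _

theorem suppOn_checkOp {T : Finset (Qubit p)} {i : Check p} (h : pauliSupp (checkPauli i) ⊆ T) :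
    SuppOn (T : Set (Qubit p)) (checkOp i) :=
  suppOn_toOp _ fun _ hq => notMem_pauliSupp.1 fun hq' => hq (h hq')

theorem actsOn_amplifiedTerms (F : TupleFamily p) (t : Check p ⊕ Fin (numAmplified p)) :
    ActsOn (termSupport F t) (amplifiedTerms F t) := by
  refine SuppOn.actsOn ?_
  rcases t with i | j
  · refine ((suppOn_one _).sub (suppOn_checkOp ?_)).smul _
    exact subset_biUnion_of_mem (fun i => pauliSupp (checkPauli i)) (by simp [termChecks])
  · refine (suppOn_one _).sub (SuppOn.list_prod fun M hM => ?_)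
    obtain ⟨k, rfl⟩ := List.mem_ofFn.1 hM
    refine ((suppOn_one _).add (suppOn_checkOp ?_)).smul _
    exact subset_biUnion_of_mem (fun i => pauliSupp (checkPauli i)) (by simp [termChecks])

theorem card_pauliSupp_checkPauli_le (hp : 2 ≤ p) (i : Check p) :
    #(pauliSupp (checkPauli i)) ≤ 2 * (p + 1) := by
  classical
  refine le_trans (card_le_card fun q hq => ?_) (card_inSupport_le hp i)
  simpa [inSupport_iff] using hq

theorem card_termSupport_inl_le (hp : 2 ≤ p) (F : TupleFamily p) (i : Check p) :
    #(termSupport F (.inl i)) ≤ 2 * (p + 1) := by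
  simpa [termSupport, termChecks] using card_pauliSupp_checkPauli_le hp i

theorem card_termSupport_inr_le (hp : 2 ≤ p) (F : TupleFamily p) (j : Fin (numAmplified p)) :
    #(termSupport F (.inr j)) ≤ tupleSize p * (2 * (p + 1)) := by
  refine (card_biUnion_le_card_mul _ _ _ fun i _ => card_pauliSupp_checkPauli_le hp i).trans ?_
  refine Nat.mul_le_mul_right _ (card_image_le.trans ?_)
  simp

/-- The three summands count the qubit itself, those sharing a check of the code, and those sharing
a tuple. -/
theorem card_nbr_le (hp : 2 ≤ p) {F : TupleFamily p} (hF : IsAmplification F) (q : Qubit p) :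
    (nbr checkPauli (termChecks F) q).card ≤ 1 + 3 * p * (2 * (p + 1)) +
      ⌈Real.log (numQubits p) ^ 7⌉₊ * (tupleSize p * (2 * (p + 1))) := by
  classical
  let A : Finset (Check p) := {i | InSupport q i}
  let B : Finset (Fin (numAmplified p)) := {j | ∃ k, InSupport q (F j k)}
  have hsub : nbr checkPauli (termChecks F) q ⊆
      ({q} ∪ A.biUnion fun i => termSupport F (.inl i)) ∪ B.biUnion fun j => termSupport F (.inr j) := by
    intro q' hq'
    rcases mem_nbr.1 hq' with rfl | ⟨t | j, i, hi, i', hi', h, h'⟩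
    · simp
    · refine mem_union_left _ (mem_union_right _ (mem_biUnion.2 ⟨t, ?_, mem_biUnion.2 ⟨i', hi', h'⟩⟩))
      obtain rfl : i = t := by simpa [termChecks] using hi
      simpa [A, inSupport_iff] using h
    · refine mem_union_right _ (mem_biUnion.2 ⟨j, ?_, mem_biUnion.2 ⟨i', hi', h'⟩⟩)
      obtain ⟨k, -, rfl⟩ := mem_image.1 hi
      simp only [B, mem_filter, mem_univ, true_and]
      exact ⟨k, inSupport_iff.2 h⟩
  refine (card_le_card hsub).trans ((card_union_le _ _).trans (add_le_add
    ((card_union_le _ _).trans (add_le_add (by simp) ?_)) ?_))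
  · refine (card_biUnion_le_card_mul _ _ _ fun i _ => card_termSupport_inl_le hp F i).trans ?_
    exact Nat.mul_le_mul_right _ (card_checks_le hp q)
  · refine (card_biUnion_le_card_mul _ _ _ fun j _ => card_termSupport_inr_le hp F j).trans ?_
    refine Nat.mul_le_mul_right _ ?_
    have := hF.degree q
    rwa [Set.ncard_eq_toFinset_card', Set.toFinset_ofPred] at this

/-- The Peierls condition. Only the amplified terms are counted; by their soundness a fraction `|E|
/ (e n)` of them is violated. -/
theorem le_energy (hp : 2 ≤ p) {F : TupleFamily p} (hF : IsAmplification F)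
    (hX : 0 < numAmplified p) {E : Pauli (Qubit p)} (hE : IsMin checkPauli E) :
    (numAmplified p / (Real.exp 1 * numQubits p) : ℝ) * #(pauliSupp E) ≤
      energy (termChecks F) (syn checkPauli E) := by
  classical
  have h := hF.sound E
  have hn : (0 : ℝ) < numQubits p := Nat.cast_pos.2 (numQubits_pos (by omega))
  rw [reducedWeight_eq rfl hE, Fintype.card_fin, le_div_iff₀ (Nat.cast_pos.2 hX)] at h
  have hV : ({j | ViolatesTuple F E j}.ncard : ℝ) ≤
      energy (termChecks F) (syn checkPauli E) := by
    rw [energy, Fintype.sum_sum_type, Set.ncard_eq_toFinset_card', Set.toFinset_ofPred,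
      Finset.card_filter]
    push_cast
    refine le_add_of_nonneg_of_le (Finset.sum_nonneg fun i _ => by split_ifs <;> norm_num)
      (Finset.sum_le_sum fun j _ => ?_)
    have : ViolatesTuple F E j ↔ ∃ i ∈ termChecks F (.inr j), syn checkPauli E i ≠ 0 := by
      simp [ViolatesTuple, violates_iff, termChecks]
    by_cases h' : ViolatesTuple F E j
    · rw [if_pos h', if_pos (this.1 h')]
    · rw [if_neg h', if_neg (this.not.1 h')]
  refine le_trans (le_of_eq ?_) (h.trans hV)
  field_simp

theorem card_check_le (hp : 2 ≤ p) : Fintype.card (Check p) ≤ 3 * numQubits p := by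
  have h := card_check hp
  by_contra hcon
  push Not at hcon
  have h2 : 2 * (p + 1) * (3 * numQubits p) < 2 * (p + 1) * Fintype.card (Check p) :=
    Nat.mul_lt_mul_of_pos_left hcon (by omega)
  nlinarith

theorem hasSoundness_base (hp : 2 ≤ p)
    (hl : 2 * (p : ℝ) + 3 ≤ Real.log (numQubits p)) :
    HasSoundness (Violates (p := p)) (baseSoundness p) := by
  intro P
  have h := reducedWeight_le hp P
  have hn : (0 : ℝ) < numQubits p := Nat.cast_pos.2 (numQubits_pos (by omega))
  have hm : (0 : ℝ) < Fintype.card (Check p) := Nat.cast_pos.2 (card_check_pos hp)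
  have hmn : (Fintype.card (Check p) : ℝ) ≤ 3 * numQubits p := by exact_mod_cast card_check_le hp
  have hw : (reducedWeight P : ℝ) ≤ (p + 1) * ({j | Violates P j}.ncard : ℝ) := by exact_mod_cast h
  rw [baseSoundness, le_div_iff₀ hm]
  generalize Real.log (numQubits p) = ℓ at *
  generalize (Fintype.card (Check p) : ℝ) = m at *
  generalize (numQubits p : ℝ) = n at *
  generalize (reducedWeight P : ℝ) = r at *
  have hV : (0 : ℝ) ≤ ({j | Violates P j}.ncard : ℝ) := Nat.cast_nonneg _
  generalize ({j | Violates P j}.ncard : ℝ) = V at *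
  have hp0 : (0 : ℝ) ≤ p := Nat.cast_nonneg _
  have hl2 : 3 * ((p : ℝ) + 1) ≤ ℓ ^ 2 := by nlinarith
  have hl0 : 0 < ℓ ^ 2 := by nlinarith
  have e : 1 / ℓ ^ 2 * (r / n) * m = r * m / (ℓ ^ 2 * n) := by field_simp
  rw [e, div_le_iff₀ (by positivity)]
  calc r * m ≤ ((p + 1) * V) * (3 * n) := by gcongr
    _ = (3 * (p + 1)) * (V * n) := by ring
    _ ≤ ℓ ^ 2 * (V * n) := by gcongr
    _ = V * (ℓ ^ 2 * n) := by ring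

end Terms

/-! ### Asymptotics -/

section Asymptotics

variable {p : ℕ}

theorem log_numQubits_le (hp : 1 ≤ p) : Real.log (numQubits p) ≤ 3 * p := by
  have h0 := two_mul_numQubits hp
  have h1 : p.centralBinom ≤ 2 ^ (2 * p) := Nat.choose_le_two_pow _ _
  have h2 : numQubits p ≤ 2 ^ (3 * p) := by
    have h3 : p.centralBinom * 2 ^ p ≤ 2 ^ (2 * p) * 2 ^ p := Nat.mul_le_mul_right _ h1
    rw [← pow_add, show 2 * p + p = 3 * p by ring] at h3
    omega
  have h3 : (numQubits p : ℝ) ≤ 2 ^ (3 * p) := by exact_mod_cast h2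
  have h4 := Real.log_le_log (Nat.cast_pos.2 (numQubits_pos hp)) h3
  rw [Real.log_pow] at h4
  have := Real.log_two_lt_d9
  push_cast at h4
  have hp0 : (0 : ℝ) ≤ p := Nat.cast_nonneg _
  nlinarith

/-- Up to a factor linear in `p`, `n` is at least `2 ^ (3 p)`, and `3 log 2` exceeds 2. The
threshold 10000 makes the surplus absorb the crude bounds for the logarithm of `4 p`, split as `400
* (p / 100)`. -/
theorem le_log_numQubits (hp : 10000 ≤ p) : 2 * (p : ℝ) + 3 ≤ Real.log (numQubits p) := by
  have h0 := two_mul_numQubits (by omega : 1 ≤ p)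
  have h1 := Nat.four_pow_le_two_mul_self_mul_centralBinom p (by omega)
  have hp0 : (0 : ℝ) < p := Nat.cast_pos.2 (by omega)
  have hp1 : (10000 : ℝ) ≤ p := by exact_mod_cast hp
  have h2 : 2 ^ (3 * p) ≤ 4 * p * numQubits p := by
    calc 2 ^ (3 * p) = 4 ^ p * 2 ^ p := by
          rw [show 3 * p = 2 * p + p by ring, pow_add, pow_mul]; norm_num
      _ ≤ 2 * p * p.centralBinom * 2 ^ p := Nat.mul_le_mul_right _ h1
      _ = 2 * p * (p.centralBinom * 2 ^ p) := by ring
      _ = 4 * p * numQubits p := by rw [← h0]; ring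
  have hn : (0 : ℝ) < numQubits p := Nat.cast_pos.2 (numQubits_pos (by omega))
  have h3 : (2 : ℝ) ^ (3 * p) ≤ 400 * (p / 100) * numQubits p := by
    have : (2 : ℝ) ^ (3 * p) ≤ 4 * p * numQubits p := by exact_mod_cast h2
    linarith
  have h4 := Real.log_le_log (by positivity) h3
  rw [Real.log_pow, Real.log_mul (by positivity) hn.ne', Real.log_mul (by norm_num) (by positivity)]
    at h4
  have h5 := Real.log_le_sub_one_of_pos (by positivity : (0 : ℝ) < p / 100)
  have h6 := Real.log_le_sub_one_of_pos (by norm_num : (0 : ℝ) < 400)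
  have h7 := Real.log_two_gt_d9
  push_cast at h4
  nlinarith

/-- The bound on the number of qubits that share a term with a given qubit. -/
def linkDegree (p : ℕ) : ℕ := 1 + 3 * p * (2 * (p + 1)) +
  ⌈Real.log (numQubits p) ^ 7⌉₊ * (tupleSize p * (2 * (p + 1)))

theorem linkDegree_le (hp : 10000 ≤ p) :
    (linkDegree p : ℝ) ≤ Real.log (numQubits p) ^ 11 := by
  have hl := le_log_numQubits hp
  have hts := tupleSize_eq p
  have hp1 : (10000 : ℝ) ≤ p := by exact_mod_cast hp
  have h2 : (tupleSize p : ℝ) ≤ Real.log (numQubits p) ^ 2 + 1 :=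
    hts ▸ (Nat.ceil_lt_add_one (by positivity)).le
  have h7 : (⌈Real.log (numQubits p) ^ 7⌉₊ : ℝ) ≤ Real.log (numQubits p) ^ 7 + 1 :=
    (Nat.ceil_lt_add_one (pow_nonneg (by linarith) 7)).le
  rw [linkDegree]
  push_cast
  generalize Real.log (numQubits p) = ℓ at *
  generalize (⌈ℓ ^ 7⌉₊ : ℝ) = a at *
  have ht0 : (0 : ℝ) ≤ tupleSize p := Nat.cast_nonneg _
  generalize (tupleSize p : ℝ) = t at *
  have hl0 : 0 < ℓ := by linarith
  have hl1 : 1 ≤ ℓ := by linarith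
  have b7 : 1 ≤ ℓ ^ 7 := one_le_pow₀ hl1
  have b2 : 1 ≤ ℓ ^ 2 := one_le_pow₀ hl1
  have c1 : 3 * (p : ℝ) * (2 * (p + 1)) ≤ 3 * ℓ * ℓ := by gcongr <;> linarith
  have c2 : a * (t * (2 * ((p : ℝ) + 1))) ≤ (2 * ℓ ^ 7) * ((2 * ℓ ^ 2) * ℓ) := by
    gcongr <;> linarith
  have d1 : ℓ ^ 2 ≤ ℓ ^ 10 := pow_le_pow_right₀ hl1 (by norm_num)
  have d2 : 1 ≤ ℓ ^ 10 := one_le_pow₀ hl1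
  have d3 : 8 * ℓ ^ 10 ≤ ℓ * ℓ ^ 10 := by
    have : 0 ≤ ℓ ^ 10 := by positivity
    gcongr
    linarith
  calc 1 + 3 * (p : ℝ) * (2 * (p + 1)) + a * (t * (2 * ((p : ℝ) + 1)))
      ≤ 1 + 3 * ℓ * ℓ + (2 * ℓ ^ 7) * ((2 * ℓ ^ 2) * ℓ) := by linarith
    _ = 1 + 3 * ℓ ^ 2 + 4 * ℓ ^ 10 := by ring
    _ ≤ 8 * ℓ ^ 10 := by linarith
    _ ≤ ℓ * ℓ ^ 10 := d3
    _ = ℓ ^ 11 := by ring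

theorem card_termSupport_le (hp : 10000 ≤ p) (F : TupleFamily p)
    (t : Check p ⊕ Fin (numAmplified p)) :
    #(termSupport F t) ≤ ⌈Real.log (numQubits p) ^ 3⌉₊ := by
  have hl := le_log_numQubits hp
  have hts := tupleSize_eq p
  have h2 : (tupleSize p : ℝ) ≤ Real.log (numQubits p) ^ 2 + 1 :=
    hts ▸ (Nat.ceil_lt_add_one (by positivity)).le
  have ht1 : 1 ≤ tupleSize p := by
    rw [hts, Nat.one_le_ceil_iff]
    have : (0 : ℝ) ≤ p := Nat.cast_nonneg _
    exact pow_pos (by linarith) 2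
  have h1 : #(termSupport F t) ≤ tupleSize p * (2 * (p + 1)) := by
    rcases t with i | j
    · exact (card_termSupport_inl_le (by omega) F i).trans (Nat.le_mul_of_pos_left _ ht1)
    · exact card_termSupport_inr_le (by omega) F j
  refine h1.trans ?_
  have h3 : (tupleSize p : ℝ) * (2 * (p + 1)) ≤ Real.log (numQubits p) ^ 3 := by
    have hp0 : (0 : ℝ) ≤ p := Nat.cast_nonneg _
    generalize Real.log (numQubits p) = ℓ at *
    calc (tupleSize p : ℝ) * (2 * (p + 1)) ≤ (ℓ ^ 2 + 1) * (ℓ - 1) := by gcongr; linarith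
      _ ≤ ℓ ^ 3 := by nlinarith
  have h4 := h3.trans (Nat.le_ceil _)
  exact_mod_cast h4

theorem exp_bounds {ℓ l2 : ℝ} (hl2 : 10000 ≤ l2) (hℓ : ℓ = Real.exp l2) :
    5000 * l2 ≤ ℓ := by
  have := Real.quadratic_le_exp_of_nonneg (by linarith : 0 ≤ l2)
  rw [hℓ]
  nlinarith

/-- Connected sets of errors of this size are unlikely. -/
def cutoff (p : ℕ) : ℕ :=
  ⌈Real.log (numQubits p) / Real.log (Real.log (numQubits p)) ^ 2⌉₊

/-- The neighbourhood factor is `exp (O(ℓ / l2))`, hence `n ^ o(1)`, and a light cone has at most `n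
^ 0.07` qubits, while `2 ^ (p - 1)` is about `n ^ 0.23` or more. -/
theorem linkDegree_pow_mul_lt (hp : 10000 ≤ p)
    (hll : 10000 ≤ Real.log (Real.log (numQubits p))) {k : ℕ}
    (hk : (k : ℝ) < 1 / 10 * Real.log (numQubits p)) :
    linkDegree p ^ (2 * cutoff p + 1) * 2 ^ k < 2 ^ (p - 1) := by
  have hl := le_log_numQubits hp
  have hlu := log_numQubits_le (by omega : 1 ≤ p)
  have hD := linkDegree_le hp
  have hD1 : (1 : ℝ) ≤ linkDegree p := by
    have : 1 ≤ linkDegree p := by unfold linkDegree; omega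
    exact_mod_cast this
  have hp1 : (10000 : ℝ) ≤ p := by exact_mod_cast hp
  have hw : (cutoff p : ℝ) ≤ Real.log (numQubits p) / Real.log (Real.log (numQubits p)) ^ 2 + 1 :=
    (Nat.ceil_lt_add_one (by positivity)).le
  generalize cutoff p = w at *
  generalize linkDegree p = D at *
  have hexp : Real.log (numQubits p) = Real.exp (Real.log (Real.log (numQubits p))) :=
    (Real.exp_log (by linarith)).symm
  have hb := exp_bounds hll hexp
  have hlogD : Real.log D ≤ 11 * Real.log (Real.log (numQubits p)) := by
    have := Real.log_le_log (by linarith) hD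
    rwa [Real.log_pow] at this
  generalize Real.log (Real.log (numQubits p)) = l2 at *
  generalize Real.log (numQubits p) = ℓ at *
  have hgoal : (D : ℝ) ^ (2 * w + 1) * 2 ^ k < 2 ^ (p - 1) := by
    rw [← Real.log_lt_log_iff (by positivity) (by positivity),
      Real.log_mul (by positivity) (by positivity), Real.log_pow, Real.log_pow, Real.log_pow,
      Nat.cast_sub (by omega)]
    push_cast
    have g1 := Real.log_two_gt_d9
    have g2 := Real.log_two_lt_d9
    have e1 : (2 * (w : ℝ) + 1) * Real.log D ≤ (2 * (ℓ / l2 ^ 2 + 1) + 1) * (11 * l2) := by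
      have := Real.log_nonneg hD1
      have hl0 : 0 ≤ ℓ := by linarith
      have : 0 ≤ 2 * (ℓ / l2 ^ 2 + 1) + 1 := by positivity
      gcongr
    have e2 : (2 * (ℓ / l2 ^ 2 + 1) + 1) * (11 * l2) = 22 * (ℓ / l2) + 33 * l2 := by
      field_simp; ring
    have e3 : ℓ / l2 ≤ ℓ / 10000 := by gcongr; linarith
    have e4 : (k : ℝ) * Real.log 2 ≤ 1 / 10 * ℓ * 0.7 := by
      have : 0 ≤ Real.log 2 := by linarith
      exact mul_le_mul hk.le (by linarith) this (by linarith)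
    have e5 : (ℓ / 3 - 1) * 0.69 ≤ ((p : ℝ) - 1) * Real.log 2 := by
      have : 0 ≤ Real.log 2 := by linarith
      have h0 : 0 ≤ (p : ℝ) - 1 := by linarith
      gcongr <;> linarith
    linarith
  exact_mod_cast hgoal

/-- The degree is at most `exp (11 l2)`, so its square costs `22 l2` in the exponent, negligible
against `0.9 l2 ^ 2`. -/
theorem link_decay (hll : 10000 ≤ Real.log (Real.log (numQubits p))) (hp : 10000 ≤ p) {x : ℝ}
    (hx : 9.9 * Real.log (Real.log (numQubits p)) ^ 2 ≤ x) :
    4 * (linkDegree p : ℝ) ^ 2 * Real.exp (-x) ≤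
      Real.exp (-(9 * Real.log (Real.log (numQubits p)) ^ 2)) := by
  have hl := le_log_numQubits hp
  have hD := linkDegree_le hp
  have hexp : Real.log (numQubits p) = Real.exp (Real.log (Real.log (numQubits p))) :=
    (Real.exp_log (by linarith [(Nat.cast_nonneg p : (0 : ℝ) ≤ p)])).symm
  generalize Real.log (Real.log (numQubits p)) = l2 at *
  have hD2 : (linkDegree p : ℝ) ^ 2 ≤ Real.exp (22 * l2) := by
    refine (pow_le_pow_left₀ (Nat.cast_nonneg _) hD 2).trans (le_of_eq ?_)
    rw [hexp, ← pow_mul, ← Real.exp_nat_mul]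
    norm_num
  have h4 : (4 : ℝ) ≤ Real.exp 3 := by linarith [Real.add_one_le_exp (3 : ℝ)]
  calc 4 * (linkDegree p : ℝ) ^ 2 * Real.exp (-x)
      ≤ Real.exp 3 * Real.exp (22 * l2) * Real.exp (-(9.9 * l2 ^ 2)) := by gcongr
    _ = Real.exp (3 + 22 * l2 + -(9.9 * l2 ^ 2)) := by rw [Real.exp_add, Real.exp_add]
    _ ≤ _ := Real.exp_le_exp.2 (by nlinarith)

/-- The factor `e` in the temperature threshold cancels that of the soundness, and the amplified
terms make up at least 99 percent of all terms, which turns 10 into 9.9. -/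
theorem nine_le_exponent (hp : 10000 ≤ p) :
    9.9 * Real.log (Real.log (numQubits p)) ^ 2 ≤
      20 * Real.exp 1 * Real.log (Real.log (numQubits p)) ^ 2 *
        ((Fintype.card (Check p ⊕ Fin (numAmplified p)) / Fintype.card (Qubit p) : ℝ)⁻¹) *
        (numAmplified p / (Real.exp 1 * numQubits p)) / 2 := by
  have hl := le_log_numQubits hp
  have hp1 : (10000 : ℝ) ≤ p := by exact_mod_cast hp
  have hn : (0 : ℝ) < numQubits p := Nat.cast_pos.2 (numQubits_pos (by omega))
  have hm : (Fintype.card (Check p) : ℝ) ≤ 3 * numQubits p := by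
    exact_mod_cast card_check_le (by omega : 2 ≤ p)
  have hX : (numQubits p : ℝ) * Real.log (numQubits p) ^ 4 ≤ numAmplified p := Nat.le_ceil _
  rw [Fintype.card_sum, Fintype.card_fin]
  push_cast
  change _ ≤ 20 * Real.exp 1 * Real.log (Real.log (numQubits p)) ^ 2 *
    ((Fintype.card (Check p) + numAmplified p : ℝ) / (numQubits p : ℝ))⁻¹ * _ / 2
  have hy : 0 ≤ Real.log (Real.log (numQubits p)) ^ 2 := by positivity
  generalize Real.log (Real.log (numQubits p)) ^ 2 = y at *
  have hl4 : 300 ≤ Real.log (numQubits p) ^ 4 :=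
    le_trans (by norm_num) (pow_le_pow_left₀ (by norm_num : (0 : ℝ) ≤ 10) (by linarith) 4)
  generalize Real.log (numQubits p) = ℓ at *
  have hX2 : 300 * (numQubits p : ℝ) ≤ numAmplified p := by nlinarith
  have hm0 : (0 : ℝ) ≤ Fintype.card (Check p) := Nat.cast_nonneg _
  generalize (Fintype.card (Check p) : ℝ) = m at *
  generalize (numAmplified p : ℝ) = X at *
  generalize (numQubits p : ℝ) = n at *
  have he := Real.exp_pos 1
  have e : 20 * Real.exp 1 * y * ((m + X) / n)⁻¹ * (X / (Real.exp 1 * n)) / 2 =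
      10 * y * X / (m + X) := by
    have : m + X ≠ 0 := by linarith
    field_simp
    ring
  rw [e, le_div_iff₀ (by linarith)]
  have : 0.99 * (m + X) ≤ X := by linarith
  nlinarith

open Classical in
theorem depth_ge (hp : 10000 ≤ p) (hll : 10000 ≤ Real.log (Real.log (numQubits p)))
    {F : TupleFamily p} (hF : IsAmplification F) {ρ : Op (Qubit p)}
    (hρ : IsThermalState (amplifiedTerms F)
      (20 * Real.exp 1 * Real.log (Real.log (numQubits p)) ^ 2) ρ)
    {ι : Type} [Fintype ι] [DecidableEq ι] (U : Circuit ι) (S : Qubit p ↪ ι)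
    (hd : traceDist (reducedOp S U.output) ρ ≤ 0.1 * ((numQubits p : ℝ) ^ 2)⁻¹) :
    1 / 10 * Real.log (numQubits p) ≤ U.depth := by
  by_contra hcon
  push Not at hcon
  have hl := le_log_numQubits hp
  have hp2 : 2 ≤ p := by omega
  have hp1 : (10000 : ℝ) ≤ p := by exact_mod_cast hp
  have hn : (0 : ℝ) < numQubits p := Nat.cast_pos.2 (numQubits_pos (by omega))
  have hX : 0 < numAmplified p := Nat.ceil_pos.2 (mul_pos hn (pow_pos (by linarith) 4))
  have hU := linkDegree_pow_mul_lt hp hll hcon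
  obtain ⟨Xl, Zl, hXl, hZl, hXZ, hdist⟩ := exists_logical hp2
  have hw1 : 1 ≤ cutoff p := Nat.one_le_ceil_iff.2 (div_pos (by linarith) (by positivity))
  have hD2 : 2 ≤ linkDegree p := by
    have : 0 < 3 * p * (2 * (p + 1)) := by positivity
    unfold linkDegree; omega
  have hwd : cutoff p ≤ 2 ^ (p - 1) := by
    refine le_trans (le_trans ?_ (Nat.le_mul_of_pos_right _ (by positivity))) hU.le
    calc cutoff p ≤ 2 ^ cutoff p := Nat.lt_two_pow_self.le
      _ ≤ 2 ^ (2 * cutoff p + 1) := Nat.pow_le_pow_right (by norm_num) (by omega)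
      _ ≤ linkDegree p ^ (2 * cutoff p + 1) := Nat.pow_le_pow_left hD2 _
  have key := half_le_of_thermal (compatible_checkPauli hp2) (K := termChecks F)
    (fun t => amplifiedTerms_eq_fc (compatible_checkPauli hp2) F t)
    (fun i => ⟨.inl i, by simp [termChecks]⟩)
    (κ₀ := numAmplified p / (Real.exp 1 * numQubits p)) hw1
    (by positivity) (by positivity) (by omega : 1 ≤ linkDegree p)
    (fun e he => le_energy hp2 hF hX he) (card_nbr_le hp2 hF)
    (link_decay hll hp (nine_le_exponent hp))
    (by
      refine (exp_neg_le_of_le (y := 1) (by nlinarith) (by norm_num)).trans (by norm_num))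
    hXl hZl hXZ hdist hwd hρ U S hU
  -- The cutoff times `l2 ^ 2` is at least `ℓ`, so large clusters have probability of order `n ^
  -- (-8)`.
  have hr : Real.exp (-(9 * Real.log (Real.log (numQubits p)) ^ 2)) ^ cutoff p ≤
      Real.exp (-(9 * Real.log (numQubits p))) := by
    rw [← Real.exp_nat_mul]
    refine Real.exp_le_exp.2 ?_
    have hc : Real.log (numQubits p) / Real.log (Real.log (numQubits p)) ^ 2 ≤ cutoff p :=
      Nat.le_ceil _
    rw [div_le_iff₀ (by positivity)] at hc
    linarith
  have h2 : (2 : ℝ) ^ U.depth ≤ Real.exp (0.07 * Real.log (numQubits p)) := by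
    rw [← Real.exp_log (by norm_num : (0 : ℝ) < 2), ← Real.exp_nat_mul]
    refine Real.exp_le_exp.2 ?_
    have g2 := Real.log_two_lt_d9
    have := mul_le_mul hcon.le (by linarith : Real.log 2 ≤ 0.7) (Real.log_nonneg (by norm_num))
      (by linarith)
    linarith
  have hne : (numQubits p : ℝ) = Real.exp (Real.log (numQubits p)) := (Real.exp_log hn).symm
  change 1 / 2 ≤ (numQubits p : ℝ) * 2 ^ U.depth * (4 * (2 * numQubits p * _ + _)) at key
  have hbig : 9 ≤ Real.log (numQubits p) := by linarith
  generalize Real.log (numQubits p) = ℓ at *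
  have h3 : (numQubits p : ℝ) ^ 2 = Real.exp (2 * ℓ) := by
    rw [hne, ← Real.exp_nat_mul]; norm_num
  rw [h3, ← Real.exp_neg] at hd
  rw [hne] at key
  have h4 : Real.exp ℓ * Real.exp (-(9 * ℓ)) ≤ 0.1 * Real.exp (-(2 * ℓ)) := by
    have e : Real.exp ℓ * Real.exp (-(9 * ℓ)) = Real.exp (-(6 * ℓ)) * Real.exp (-(2 * ℓ)) := by
      rw [← Real.exp_add, ← Real.exp_add]; congr 1; ring
    rw [e]
    refine mul_le_mul_of_nonneg_right ?_ (Real.exp_pos _).le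
    exact (exp_neg_le_of_le (y := 9) (by linarith) (by norm_num)).trans (by norm_num)
  have h5 : 2 * Real.exp ℓ *
      Real.exp (-(9 * Real.log ℓ ^ 2)) ^ cutoff p +
      2 * traceDist (reducedOp S U.output) ρ ≤ Real.exp (-(2 * ℓ)) := by
    have := mul_le_mul_of_nonneg_left hr (Real.exp_pos ℓ).le
    linarith [Real.exp_pos (-(2 * ℓ))]
  -- The total error is at most `4 n ^ (1 + 0.07 - 2)`, below `1 / 2`, against `key`.
  have h6 : Real.exp ℓ * 2 ^ U.depth * (4 * (2 * Real.exp ℓ *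
      Real.exp (-(9 * Real.log ℓ ^ 2)) ^ cutoff p +
      2 * traceDist (reducedOp S U.output) ρ)) ≤
      Real.exp ℓ * Real.exp (0.07 * ℓ) * (4 * Real.exp (-(2 * ℓ))) := by
    refine mul_le_mul (mul_le_mul_of_nonneg_left h2 (Real.exp_pos _).le) (by linarith) ?_
      (by positivity)
    by_contra hneg
    push Not at hneg
    have : Real.exp ℓ * 2 ^ U.depth * (4 * (2 * Real.exp ℓ *
      Real.exp (-(9 * Real.log ℓ ^ 2)) ^ cutoff p +
      2 * traceDist (reducedOp S U.output) ρ)) < 0 := mul_neg_of_pos_of_neg (by positivity) hneg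
    linarith
  have h7 : Real.exp ℓ * Real.exp (0.07 * ℓ) * (4 * Real.exp (-(2 * ℓ))) =
      4 * Real.exp (-(0.93 * ℓ)) := by
    rw [mul_left_comm, ← Real.exp_add, ← Real.exp_add]; congr 2; ring
  have h8 := exp_neg_le_of_le (x := 0.93 * ℓ) (y := 8.1) (by linarith) (by norm_num)
  have h9 : (1 : ℝ) / (8.1 + 1) < 1 / 8 := by norm_num
  linarith

end Asymptotics

end ThermalTQO

end

theorem theorem1 :
    ∃ c : ℝ, 0 < c ∧ ∃ p₀ : ℕ, ∀ p : ℕ, p₀ ≤ p →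
      HasSoundness (Violates (p := p)) (baseSoundness p) ∧
      (∃ F : TupleFamily p, IsAmplification F) ∧
      ∀ F : TupleFamily p, IsAmplification F →
        (∀ t, ∃ T : Finset (Qubit p), T.card ≤ ⌈Real.log (numQubits p) ^ 3⌉₊ ∧
          ActsOn T (amplifiedTerms F t)) ∧
        (∀ t t', Commute (amplifiedTerms F t) (amplifiedTerms F t')) ∧
        ∀ ρ : Op (Qubit p),
          IsThermalState (amplifiedTerms F)
            (20 * Real.exp 1 * Real.log (Real.log (numQubits p)) ^ 2) ρ →
          ∀ (a : ℕ), numQubits p ≤ a → ∀ (U : Circuit (Fin a)) (S : Qubit p ↪ Fin a),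
            traceDist (reducedOp S U.output) ρ ≤ 0.1 * ((numQubits p : ℝ) ^ 2)⁻¹ →
            c * Real.log (numQubits p) ≤ U.depth := by
  -- The summand `Real.exp 10000` makes the iterated logarithm of `n` at least 10000.
  refine ⟨1 / 10, by norm_num, 10000 + ⌈Real.exp 10000⌉₊, fun p hp => ?_⟩
  have hp1 : 10000 ≤ p := by omega
  have hp2 : Real.exp 10000 ≤ p :=
    (Nat.le_ceil _).trans (Nat.cast_le.2 (by omega : ⌈Real.exp 10000⌉₊ ≤ p))
  have hp3 : (10000 : ℝ) ≤ p := by exact_mod_cast hp1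
  have hl := le_log_numQubits hp1
  have hll : 10000 ≤ Real.log (Real.log (numQubits p)) := by
    rw [Real.le_log_iff_exp_le (by linarith)]
    linarith
  have hs := hasSoundness_base (by omega) hl
  refine ⟨hs, exists_isAmplification (by omega) hs hl (by linarith), fun F hF =>
    ⟨fun t => ⟨termSupport F t, card_termSupport_le hp1 F t, actsOn_amplifiedTerms F t⟩,
      commute_amplifiedTerms (by omega) F, fun ρ hρ a _ U S hd => depth_ge hp1 hll hF hρ U S hd⟩⟩
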